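/- Let $(X,d,\mu)$ be a PI space: $(X,d)$ is a complete metric space and $\mu$ is a Borel measure on $X$, with all balls of positive finite measure, such that (i) for every $R>0$ there is $\beta(R)<\infty$ with $\mu(B_{2r}(x))\le\beta(R)\,\mu(B_r(x))$ for all $x\in X$, $0<r\le R$; (ii) there is $\lambda\ge 1$, and for every $R>0$ some $\tau(R)<\infty$, such that $$\int_{B_r(x)}|u-u_{x,r}|\,d\mu\le r\,\tau(R)\int_{B_{\lambda r}(x)}\rho\,d\mu\qquad(x\in X,\ 0<r\le R)$$ for every locally integrable $u:X\to\mathbb R$ and every upper gradient $\rho$ of $u$, where $u_{x,r}$ is the mean of $u$ on $B_r(x)$; here a Borel function $\rho:X\to[0,\infty]$ is an upper gradient of $u$ if $|u(c(\ell))-u(c(0))|\le\int_0^\ell\rho(c(s))\,ds$ for every rectifiable curve $c:[0,\ell]\to X$ parametrized by arclength. Let $U\subset X$ be open and let $(Y,\nu)$ be a $\sigma$-finite measure space. For a Banach space $V$ and $h\in L^1(U,V)$ put $$\operatorname{VAR}(h,U)=\inf_{(h_i)}\ \liminf_{i\to\infty}\int_U\operatorname{Lip}h_i\,d\mu\in[0,\infty],\qquad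 \operatorname{Lip}h_i(x)=\liminf_{r\to0}\sup_{d(x,x')<r}\frac{\|h_i(x)-h_i(x')\|}{r},$$ the infimum being over all sequences of locally Lipschitz functions $h_i:U\to V$ with $h_i\to h$ in $L^1(U,V)$; $h\in\operatorname{BV}(U,V)$ means that there is such a sequence with $\liminf_i\int_U\operatorname{Lip}h_i\,d\mu<\infty$. Let $\operatorname{Cut}(U)\subset L^1(U)$ be the set of classes of characteristic functions $\chi_E$ of measurable sets $E\subset U$ of finite measure (modulo null sets), with the Borel $\sigma$-algebra induced from $L^1(U)$, and let $\operatorname{PER}(E,U)=\operatorname{VAR}(\chi_E,U)$. A Borel measure $\Sigma$ on $\operatorname{Cut}(U)$ is a cut measure if $\int_{\operatorname{Cut}(U)}\|\cdot\|_{L^1}\,d\Sigma<\infty$, and a finite-perimeter (FP) cut measure if moreover its total perimeter $\int_{\operatorname{Cut}(U)}\operatorname{PER}(E,U)\,d\Sigma(E)$ is finite. Let $\operatorname{Slice}:L^1(U)\times\mathbb R\to\operatorname{Cut}(U)$ send $(u,t)$ to $\{u\ge t\}$ if $t>0$, to $\emptyset$ if $t=0$, and to $\{u\le t\}$ if $t<0$.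 Let $f\in L^1(U,L^1(Y))$. Let $H\in L^1(U\times Y)$ be the function with $H(x,\cdot)=f(x)$ in $L^1(Y)$ for a.e. $x\in U$, let $g:Y\to L^1(U)$ be given by $g(y)=H(\cdot,y)$ if $H(\cdot,y)\in L^1(U)$ and $g(y)=0$ otherwise, and let $$\Sigma_f=\operatorname{Slice}_*\big(g_*\nu\times\mathcal L\big),$$ where $\mathcal L$ is Lebesgue measure on $\mathbb R$. Then $\Sigma_f$ is an FP cut measure if and only if $f\in\operatorname{BV}(U,L^1(Y))$. Moreover, as elements of $[0,\infty]$, $$\int_{\operatorname{Cut}(U)}\operatorname{PER}(E,U)\,d\Sigma_f(E)=\int_Y\operatorname{VAR}(g(y),U)\,d\nu(y).$$ -/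

import Mathlib

open Set Filter Topology MeasureTheory
open scoped ENNReal NNReal

noncomputable section

/-! ### PI spaces -/

/-- A Borel function `g : X → [0, ∞]` is an upper gradient of `f : X → ℝ` if
`|f (c ℓ) - f (c 0)| ≤ ∫₀^ℓ g (c s) ds` for every rectifiable curve `c : [0, ℓ] → X`
parametrized by arclength. -/
def IsUpperGradient {X : Type*} [MetricSpace X] [MeasurableSpace X]
    (f : X → ℝ) (g : X → ℝ≥0∞) : Prop :=
  Measurable g ∧ ∀ (l : ℝ) (c : ℝ → X), 0 ≤ l → HasUnitSpeedOn c (Icc 0 l) →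
    ENNReal.ofReal |f (c l) - f (c 0)| ≤ ∫⁻ s in Icc 0 l, g (c s)

/-- A PI space: a complete metric space with a Borel measure for which balls have positive finite
measure, satisfying the (local) doubling condition and the (local) `(1,1)`-Poincaré inequality. -/
structure IsPISpace {X : Type*} [MetricSpace X] [MeasurableSpace X] (μ : Measure X) : Prop where
  complete : CompleteSpace X
  ball_pos : ∀ (x : X) (r : ℝ), 0 < r → 0 < μ (Metric.ball x r)
  ball_lt_top : ∀ (x : X) (r : ℝ), μ (Metric.ball x r) < ∞
  doubling : ∀ R : ℝ, 0 < R → ∃ β : ℝ≥0, ∀ (x : X) (r : ℝ), 0 < r → r ≤ R →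
    μ (Metric.ball x (2 * r)) ≤ β * μ (Metric.ball x r)
  poincare : ∃ Λ : ℝ, 1 ≤ Λ ∧ ∀ R : ℝ, 0 < R → ∃ τ : ℝ≥0,
    ∀ (f : X → ℝ) (g : X → ℝ≥0∞), LocallyIntegrable f μ → IsUpperGradient f g →
      ∀ (x : X) (r : ℝ), 0 < r → r ≤ R →
        ∫⁻ z in Metric.ball x r, ENNReal.ofReal |f z - ⨍ w in Metric.ball x r, f w ∂μ| ∂μ ≤
          ENNReal.ofReal r * τ * ∫⁻ z in Metric.ball x (Λ * r), g z ∂μ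

/-! ### Functions of bounded variation on an open set -/

/-- The pointwise Lipschitz constant
`Lip f (x) = liminf_{r → 0} sup_{d(x, x') < r} d(f x, f x') / r`. -/
def pointwiseLip {X V : Type*} [MetricSpace X] [NormedAddCommGroup V] (f : X → V) (x : X) : ℝ≥0∞ :=
  liminf (fun r : ℝ => ⨆ x' ∈ Metric.ball x r, edist (f x) (f x') / ENNReal.ofReal r) (𝓝[>] 0)

/-- `u` is a sequence of locally Lipschitz functions on `U` converging to `h` in `L¹(U, V)`. -/
structure IsLipApprox {X V : Type*} [MetricSpace X] [MeasurableSpace X] [NormedAddCommGroup V]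
    (μ : Measure X) (U : Set X) (h : X → V) (u : ℕ → X → V) : Prop where
  locallyLipschitz : ∀ n, LocallyLipschitzOn U (u n)
  memLp : ∀ n, MemLp (u n) 1 (μ.restrict U)
  tendsto : Tendsto (fun n => eLpNorm (u n - h) 1 (μ.restrict U)) atTop (𝓝 0)

/-- The function `h` (an element of `L¹(U, V)`) has bounded variation on `U`. -/
def IsBV {X V : Type*} [MetricSpace X] [MeasurableSpace X] [NormedAddCommGroup V]
    (μ : Measure X) (U : Set X) (h : X → V) : Prop :=
  ∃ u : ℕ → X → V, IsLipApprox μ U h u ∧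
    liminf (fun n => ∫⁻ x in U, pointwiseLip (u n) x ∂μ) atTop < ∞

/-- The variation `VAR(h, U) ∈ [0, ∞]`. -/
def VAR {X V : Type*} [MetricSpace X] [MeasurableSpace X] [NormedAddCommGroup V]
    (μ : Measure X) (U : Set X) (h : X → V) : ℝ≥0∞ :=
  ⨅ (u : ℕ → X → V) (_ : IsLipApprox μ U h u),
    liminf (fun n => ∫⁻ x in U, pointwiseLip (u n) x ∂μ) atTop

/-! ### Cuts, slices and cut measures -/

/-- `L¹` spaces carry their Borel σ-algebra. -/
instance instMeasurableSpaceL1 {X : Type*} [MeasurableSpace X] (m : Measure X) :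
    MeasurableSpace (Lp ℝ 1 m) := borel _

instance instBorelSpaceL1 {X : Type*} [MeasurableSpace X] (m : Measure X) :
    BorelSpace (Lp ℝ 1 m) := ⟨rfl⟩

/-- The space of cuts: the elements of `L¹` represented by characteristic functions, with the
metric and the Borel σ-algebra inherited from `L¹`. -/
abbrev Cut {X : Type*} [MeasurableSpace X] (m : Measure X) : Type _ :=
  {u : Lp ℝ 1 m // ∃ E : Set X, MeasurableSet E ∧ u =ᵐ[m] E.indicator fun _ => (1 : ℝ)}

/-- The set underlying `Slice (u, t)`. -/
def sliceSet {X : Type*} [MeasurableSpace X] {m : Measure X} (u : Lp ℝ 1 m) (t : ℝ) : Set X :=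
  {x | (0 < t ∧ t ≤ u x) ∨ (t < 0 ∧ u x ≤ t)}

theorem measurableSet_sliceSet {X : Type*} [MeasurableSpace X] {m : Measure X}
    (u : Lp ℝ 1 m) (t : ℝ) : MeasurableSet (sliceSet u t) := by
  have hu : Measurable (u : X → ℝ) := (Lp.stronglyMeasurable u).measurable
  exact ((MeasurableSet.const _).inter (measurableSet_le measurable_const hu)).union
    ((MeasurableSet.const _).inter (measurableSet_le hu measurable_const))

theorem measure_sliceSet_ne_top {X : Type*} [MeasurableSpace X] {m : Measure X}
    (u : Lp ℝ 1 m) (t : ℝ) : m (sliceSet u t) ≠ ∞ := by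
  have hu : Integrable (u : X → ℝ) m := L1.integrable_coeFn u
  rcases lt_trichotomy t 0 with ht | ht | ht
  · refine ne_top_of_le_ne_top (hu.measure_le_lt_top ht).ne (measure_mono ?_)
    rintro x (hx | hx)
    · exact absurd hx.1 ht.not_gt
    · exact hx.2
  · simp [sliceSet, ht]
  · refine ne_top_of_le_ne_top (hu.measure_ge_lt_top ht).ne (measure_mono ?_)
    rintro x (hx | hx)
    · exact hx.2
    · exact absurd hx.1 ht.not_gt

/-- The map `Slice : L¹ × ℝ → Cut`: the cut `{u ≥ t}` for `t > 0`, `∅` for `t = 0`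
and `{u ≤ t}` for `t < 0`. -/
def Slice {X : Type*} [MeasurableSpace X] {m : Measure X} (p : Lp ℝ 1 m × ℝ) : Cut m :=
  ⟨indicatorConstLp 1 (measurableSet_sliceSet p.1 p.2) (measure_sliceSet_ne_top p.1 p.2) (1 : ℝ),
    sliceSet p.1 p.2, measurableSet_sliceSet p.1 p.2, indicatorConstLp_coeFn⟩

/-- A Borel measure `S` on the space of cuts is a cut measure if `∫ ‖·‖ dS < ∞`. -/
def IsCutMeasure {X : Type*} [MeasurableSpace X] {m : Measure X} (S : Measure (Cut m)) : Prop :=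
  ∫⁻ E, ‖(E : Lp ℝ 1 m)‖ₑ ∂S < ∞

/-- The perimeter `PER(E, U) = VAR(χ_E, U)` of a cut of `U`. -/
def PER {X : Type*} [MetricSpace X] [MeasurableSpace X] (μ : Measure X) (U : Set X)
    (E : Cut (μ.restrict U)) : ℝ≥0∞ :=
  VAR μ U ((E : Lp ℝ 1 (μ.restrict U)) : X → ℝ)

/-- The total perimeter of a measure on cuts of `U`. -/
def totalPerimeter {X : Type*} [MetricSpace X] [MeasurableSpace X] (μ : Measure X) (U : Set X)
    (S : Measure (Cut (μ.restrict U))) : ℝ≥0∞ :=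
  ∫⁻ E, PER μ U E ∂S

/-- Finite perimeter (FP) cut measures. -/
def IsFPCutMeasure {X : Type*} [MetricSpace X] [MeasurableSpace X] (μ : Measure X) (U : Set X)
    (S : Measure (Cut (μ.restrict U))) : Prop :=
  IsCutMeasure S ∧ totalPerimeter μ U S < ∞

/-! ### The map `g : Y → L¹(X)` and the cut measure associated with `f : X → L¹(Y)` -/

/-- `H` is a representative on the product of the map `f : X → L¹(Y)`. -/
def IsJointRep {X Y : Type*} [MeasurableSpace X] [MeasurableSpace Y] (m : Measure X)
    (ν : Measure Y) (f : X → Lp ℝ 1 ν) (H : X × Y → ℝ) : Prop :=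
  Integrable H (m.prod ν) ∧ ∀ᵐ x ∂m, (fun y => H (x, y)) =ᵐ[ν] f x

theorem IsJointRep.lintegral_sub {X Y : Type*} [MeasurableSpace X] [MeasurableSpace Y]
    {m : Measure X} {ν : Measure Y} [SFinite ν] {f f' : X → Lp ℝ 1 ν} {H H' : X × Y → ℝ}
    (h : IsJointRep m ν f H) (h' : IsJointRep m ν f' H') :
    ∫⁻ z, ‖H z - H' z‖ₑ ∂(m.prod ν) = ∫⁻ x, ‖f x - f' x‖ₑ ∂m := by
  rw [lintegral_prod (fun z => ‖H z - H' z‖ₑ) (h.1.sub h'.1).aestronglyMeasurable.enorm]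
  refine lintegral_congr_ae ?_
  filter_upwards [h.2, h'.2] with x hx hx'
  rw [Lp.enorm_def, eLpNorm_one_eq_lintegral_enorm]
  refine lintegral_congr_ae ?_
  filter_upwards [hx, hx', Lp.coeFn_sub (f x) (f' x)] with y hy hy' hs
  rw [hs, Pi.sub_apply, hy, hy']

theorem exists_isJointRep {X Y : Type*} [MeasurableSpace X] [MeasurableSpace Y] (m : Measure X)
    (ν : Measure Y) [SFinite ν] (f : Lp (Lp ℝ 1 ν) 1 m) : ∃ H, IsJointRep m ν f H := by
  refine Integrable.induction (fun f : X → Lp ℝ 1 ν => ∃ H, IsJointRep m ν f H)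
    ?_ ?_ ?_ ?_ (L1.integrable_coeFn f)
  · intro c s hs hms
    refine ⟨fun z => s.indicator (fun _ => (1 : ℝ)) z.1 * c z.2, ?_, ?_⟩
    · exact ((integrable_indicator_iff hs).2 (integrableOn_const hms.ne)).mul_prod
        (L1.integrable_coeFn c)
    · refine ae_of_all _ fun x => ?_
      by_cases hx : x ∈ s
      · simp [hx]
      · have h0 : (fun _ : Y => (0 : ℝ)) =ᵐ[ν] (0 : Lp ℝ 1 ν) := (Lp.coeFn_zero ℝ 1 ν).symm
        simpa [hx] using h0
  · rintro f f' - - - ⟨H, hH⟩ ⟨H', hH'⟩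
    refine ⟨H + H', hH.1.add hH'.1, ?_⟩
    filter_upwards [hH.2, hH'.2] with x hx hx'
    filter_upwards [hx, hx', Lp.coeFn_add (f x) (f' x)] with y hy hy' hs
    rw [Pi.add_apply, Pi.add_apply, hs, Pi.add_apply, hy, hy']
  · refine IsSeqClosed.isClosed fun F φ hF hφ => ?_
    choose H hH using hF
    have hdist : ∀ k l, dist ((hH k).1.toL1 (H k)) ((hH l).1.toL1 (H l)) = dist (F k) (F l) := by
      intro k l
      have h1 : edist ((hH k).1.toL1 (H k)) ((hH l).1.toL1 (H l)) = edist (F k) (F l) := by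
        rw [Integrable.edist_toL1_toL1, L1.edist_def]
        simp only [edist_eq_enorm_sub]
        exact (hH k).lintegral_sub (hH l)
      rw [dist_edist, dist_edist, h1]
    have hcau : CauchySeq fun k => (hH k).1.toL1 (H k) := by
      have := hφ.cauchySeq
      rw [Metric.cauchySeq_iff] at this ⊢
      simpa only [hdist] using this
    obtain ⟨h, hh⟩ := cauchySeq_tendsto_of_complete hcau
    have hint : Integrable (h : X × Y → ℝ) (m.prod ν) := L1.integrable_coeFn h
    refine ⟨h, hint, ?_⟩
    have hmeas : ∀ k, AEMeasurable (fun z => ‖H k z - h z‖ₑ) (m.prod ν) := fun k =>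
      ((hH k).1.sub hint).aestronglyMeasurable.enorm
    let G : ℕ → X → ℝ≥0∞ := fun k x => (∫⁻ y, ‖H k (x, y) - h (x, y)‖ₑ ∂ν) + ‖F k x - φ x‖ₑ
    have hG : ∀ k, AEMeasurable (G k) m := fun k =>
      (hmeas k).lintegral_prod_right'.add
        ((Lp.aestronglyMeasurable (F k)).sub (Lp.aestronglyMeasurable φ)).enorm
    have hGint : ∀ k, ∫⁻ x, G k x ∂m = edist ((hH k).1.toL1 (H k)) h + edist (F k) φ := by
      intro k
      rw [lintegral_add_left' (hmeas k).lintegral_prod_right', ← lintegral_prod _ (hmeas k),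
        L1.edist_def, L1.edist_def]
      simp only [edist_eq_enorm_sub]
      congr 1
      refine lintegral_congr_ae ?_
      filter_upwards [(hH k).1.coeFn_toL1] with z hz
      rw [hz]
    have hlim : Tendsto (fun k => ∫⁻ x, G k x ∂m) atTop (𝓝 0) := by
      simp only [hGint]
      simpa using (tendsto_iff_edist_tendsto_0.1 hh).add (tendsto_iff_edist_tendsto_0.1 hφ)
    have hzero : ∫⁻ x, ⨅ k, G k x ∂m = 0 := by
      refine le_antisymm (ge_of_tendsto' hlim fun k => ?_) (zero_le)
      exact lintegral_mono fun x => iInf_le _ k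
    rw [lintegral_eq_zero_iff' (AEMeasurable.iInf hG)] at hzero
    have hsec : ∀ᵐ x ∂m, ∀ k, (fun y => H k (x, y)) =ᵐ[ν] F k x := ae_all_iff.2 fun k => (hH k).2
    have hHm : ∀ᵐ x ∂m, ∀ k, AEMeasurable (fun y => ‖H k (x, y) - h (x, y)‖ₑ) ν := by
      refine ae_all_iff.2 fun k => ?_
      filter_upwards [((hH k).1.sub hint).aestronglyMeasurable.prodMk_left] with x hx
      exact hx.enorm
    filter_upwards [hzero, hsec, hHm, hint.aestronglyMeasurable.prodMk_left]
      with x hx hs hm hsm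
    have hle : ∫⁻ y, ‖h (x, y) - φ x y‖ₑ ∂ν ≤ ⨅ k, G k x := by
      refine le_iInf fun k => ?_
      have h2 : ‖F k x - φ x‖ₑ = ∫⁻ y, ‖H k (x, y) - φ x y‖ₑ ∂ν := by
        rw [Lp.enorm_def, eLpNorm_one_eq_lintegral_enorm]
        refine lintegral_congr_ae ?_
        filter_upwards [hs k, Lp.coeFn_sub (F k x) (φ x)] with y hy hsub
        rw [hsub, Pi.sub_apply, hy]
      simp only [G]
      rw [h2, ← lintegral_add_left' (hm k)]
      refine lintegral_mono fun y => ?_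
      rw [← edist_eq_enorm_sub, ← edist_eq_enorm_sub, ← edist_eq_enorm_sub, edist_comm (H k (x, y))]
      exact edist_triangle _ _ _
    have h0 : ∫⁻ y, ‖h (x, y) - φ x y‖ₑ ∂ν = 0 := le_antisymm (hle.trans_eq hx) (zero_le)
    have hm0 : AEMeasurable (fun y => ‖h (x, y) - φ x y‖ₑ) ν :=
      (hsm.sub (Lp.aestronglyMeasurable (φ x))).enorm
    rw [lintegral_eq_zero_iff' hm0] at h0
    filter_upwards [h0] with y hy
    exact sub_eq_zero.1 (enorm_eq_zero.1 hy)
  · rintro f f' hff - ⟨H, hH⟩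
    refine ⟨H, hH.1, ?_⟩
    filter_upwards [hff, hH.2] with x hx hx'
    rwa [← hx]

/-- The function `H ∈ L¹(X × Y)` corresponding to `f ∈ L¹(X, L¹(Y))`: `H(x, ·) = f x` in `L¹(Y)`
for a.e. `x`. -/
def jointRep {X Y : Type*} [MeasurableSpace X] [MeasurableSpace Y] {m : Measure X}
    {ν : Measure Y} [SFinite ν] (f : Lp (Lp ℝ 1 ν) 1 m) : X × Y → ℝ :=
  Classical.choose (exists_isJointRep m ν f)

open scoped Classical in
/-- The map `g : Y → L¹(X)` corresponding to `f ∈ L¹(X, L¹(Y))`: `g y = H(·, y)` when this is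
integrable, and `g y = 0` otherwise. -/
def interchange {X Y : Type*} [MeasurableSpace X] [MeasurableSpace Y] {m : Measure X}
    {ν : Measure Y} [SFinite ν] (f : Lp (Lp ℝ 1 ν) 1 m) (y : Y) : Lp ℝ 1 m :=
  if h : Integrable (fun x => jointRep f (x, y)) m then h.toL1 _ else 0

/-- The Borel measure `T_f = g_* ν` on `L¹(X)`. -/
def tautMeasure {X Y : Type*} [MeasurableSpace X] [MeasurableSpace Y] {m : Measure X}
    {ν : Measure Y} [SFinite ν] (f : Lp (Lp ℝ 1 ν) 1 m) : Measure (Lp ℝ 1 m) :=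
  ν.map (interchange f)

/-- The cut measure `Σ_f = Slice_* (T_f × Lebesgue)` associated with `f ∈ L¹(X, L¹(Y))`. -/
def cutMeasure {X Y : Type*} [MeasurableSpace X] [MeasurableSpace Y] {m : Measure X}
    {ν : Measure Y} [SFinite ν] (f : Lp (Lp ℝ 1 ν) 1 m) : Measure (Cut m) :=
  ((tautMeasure f).prod volume).map Slice

end

/-! ### Separability of a PI space -/

section Separability

/-! The formula for the total perimeter is the coarea formula `∫ PER (Slice (u, t)) dt = VAR u` for
a single `u ∈ L¹(U)` (`lintegral_PER_Slice`), integrated over `g_* ν`. It uses neither doubling nor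
the Poincaré inequality. The cut-measure condition is automatic, because `∫ ‖Slice (u, t)‖ dt ≤ ‖u‖`
and `∫ ‖g y‖ dν` is the `L¹` norm of `H`. What remains is that `∫ VAR (g y) dν` and `VAR f` are
finite together.

Coarea, upper bound: for locally Lipschitz `v`, the characteristic function of a slice is the limit
of steep ramps composed with `v / t`. At a point `x` such a ramp has nonzero slope only for heights
`t` slightly beyond `v x`, and the total slope over all heights tends to `1`. Fatou's lemma and
Tonelli's theorem give the bound for `v`, and lower semicontinuity of `VAR` extends it to `L¹`.

Coarea, lower bound: a suitably translated Riemann sum of the perimeters is at most their integral,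
and the corresponding layer sums converge to `u` in `L¹`. The variation of a layer sum has to be
bounded by the sum of the perimeters. The pointwise constant is a liminf, so it does not obey the
triangle inequality termwise. Its place is taken by submodularity under `max` and `min`
(`VAR_max_add_VAR_min_le`): away from ties, the maximum and the minimum of two functions are locally
those two functions in some order.

Comparison of `f` with `g`: for a scale function `r` on `U` consider the energy `∫∫ κ(x, z) ‖f z - f
x‖`, where `κ(x, z)` is `1 / (r x · μ (B(x, r x)))` for `d(x, z) < 2 r x` and `0` otherwise. Since
the norm of `L¹(Y)` is an integral, Tonelli's theorem makes the energy of `f` equal to the integral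
over `y` of the energies of `g y` (`nonlocalEnergy_interchange`). For values in a Banach space these
energies are comparable to `VAR`. They are at most `C · VAR` uniformly in the scale
(`PIConstants.nonlocalEnergy_le_VAR`): apply the scalar Poincaré inequality to `‖f - f x‖` and
telescope over dyadic balls. Conversely, convolution at scale `r` is a locally Lipschitz
approximation whose Lipschitz integral is bounded by the energy, so `VAR ≤ K · liminf` of the
energies as `r → 0` (`PIConstants.VAR_le_liminf_nonlocalEnergy`). The constants are lost here, so
this comparison gives equivalence of finiteness only. -/

theorem IsPISpace.sigmaFinite {X : Type*} [MetricSpace X] [MeasurableSpace X]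
    [BorelSpace X] {μ : Measure X} (hμ : IsPISpace μ) : SigmaFinite μ := by
  rcases isEmpty_or_nonempty X with h | ⟨⟨x₀⟩⟩
  · rw [Measure.eq_zero_of_isEmpty μ]; infer_instance
  · refine ⟨⟨⟨fun n : ℕ => Metric.ball x₀ n, fun _ => trivial, fun n => hμ.ball_lt_top _ _,
      Metric.iUnion_ball_nat x₀⟩⟩⟩

/-- A metric space in which balls have positive measure for some σ-finite measure is second
countable. -/
theorem secondCountableTopology_of_ball_pos {X : Type*} [MetricSpace X] [MeasurableSpace X]
    [BorelSpace X] {μ : Measure X} [SigmaFinite μ]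
    (h : ∀ (x : X) (r : ℝ), 0 < r → 0 < μ (Metric.ball x r)) : SecondCountableTopology X := by
  refine Metric.secondCountable_of_almost_dense_set fun ε hε => ?_
  obtain ⟨s, hs⟩ : ∃ s : Set X, Maximal (fun N => N ⊆ univ ∧
      Metric.IsSeparated (ENNReal.ofReal ε) N) s := by
    obtain ⟨s, -, hs⟩ := zorn_subset_nonempty
      {N : Set X | N ⊆ univ ∧ Metric.IsSeparated (ENNReal.ofReal ε) N}
      (fun c hc hchain _ => ⟨⋃₀ c, ⟨subset_univ _,
        (pairwise_sUnion hchain.directedOn).2 fun a ha => (hc ha).2⟩,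
        fun s hs => subset_sUnion_of_mem hs⟩)
      ∅ ⟨empty_subset _, .empty⟩
    exact ⟨s, hs⟩
  have hsep : Metric.IsSeparated (ENNReal.ofReal ε) s := hs.1.2
  refine ⟨s, ?_, fun x => ?_⟩
  -- The half-radius balls about an `ε`-separated set are disjoint and of positive measure, so
  -- σ-finiteness allows only countably many of them.
  · have := Measure.countable_meas_pos_of_disjoint_iUnion (μ := μ)
      (As := fun x : s => Metric.ball (x : X) (ε / 2)) (fun _ => measurableSet_ball) ?_
    · have h2 : {i : s | 0 < μ (Metric.ball (i : X) (ε / 2))} = univ :=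
        eq_univ_of_forall fun i => h _ _ (half_pos hε)
      rw [h2] at this
      exact countable_coe_iff.1 (countable_univ_iff.1 this)
    · intro x y hxy
      refine Metric.ball_disjoint_ball ?_
      have : ENNReal.ofReal ε < edist (x : X) y := hsep x.2 y.2 (fun h => hxy (Subtype.ext h))
      rw [edist_dist, ENNReal.ofReal_lt_ofReal_iff_of_nonneg hε.le] at this
      linarith
  · have := Metric.IsCover.of_maximal_isSeparated (ε := Real.toNNReal ε) (N := s) (s := univ) hs
    obtain ⟨y, hy, hxy⟩ := this (mem_univ x)
    refine ⟨y, hy, ?_⟩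
    have hxy' : edist x y ≤ (Real.toNNReal ε : ℝ≥0∞) := hxy
    rw [edist_dist] at hxy'
    exact (ENNReal.ofReal_le_ofReal_iff hε.le).1 hxy'

end Separability

/-! ### The pointwise Lipschitz constant and its measurability -/

section PointwiseLip

variable {X V : Type*} [MetricSpace X] [NormedAddCommGroup V]

theorem pointwiseLip_congr {f g : X → V} {x : X} (h : f =ᶠ[𝓝 x] g) :
    pointwiseLip f x = pointwiseLip g x := by
  refine liminf_congr ?_
  obtain ⟨ε, hε, hb⟩ := Metric.eventually_nhds_iff_ball.1 h
  filter_upwards [Ioo_mem_nhdsGT hε] with r hr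
  refine iSup_congr fun x' => iSup_congr fun hx' => ?_
  rw [hb x (Metric.mem_ball_self hε), hb x' (Metric.ball_subset_ball hr.2.le hx')]

theorem pointwiseLip_le_of_edist_le {W : Type*} [NormedAddCommGroup W] {f : X → V} {g : X → W}
    {x : X} {K : ℝ≥0∞} (hK : K ≠ ∞) (h : ∀ᶠ y in 𝓝 x, edist (g x) (g y) ≤ K * edist (f x) (f y)) :
    pointwiseLip g x ≤ K * pointwiseLip f x := by
  obtain ⟨ε, hε, hb⟩ := Metric.eventually_nhds_iff_ball.1 h
  rw [pointwiseLip, pointwiseLip, ← ENNReal.liminf_const_mul_of_ne_top hK]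
  refine liminf_le_liminf ?_
  filter_upwards [Ioo_mem_nhdsGT hε] with r hr
  refine iSup₂_le fun y hy => ?_
  calc edist (g x) (g y) / ENNReal.ofReal r
      ≤ K * edist (f x) (f y) / ENNReal.ofReal r := by
        gcongr; exact hb y (Metric.ball_subset_ball hr.2.le hy)
    _ = K * (edist (f x) (f y) / ENNReal.ofReal r) := mul_div_assoc _ _ _
    _ ≤ _ := by gcongr; exact le_iSup₂_of_le y hy le_rfl

theorem pointwiseLip_le_of_edist_le' {W : Type*} [NormedAddCommGroup W] {f : X → V} {g : X → W}
    {x : X} (h : ∀ᶠ y in 𝓝 x, edist (g x) (g y) ≤ edist (f x) (f y)) :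
    pointwiseLip g x ≤ pointwiseLip f x := by
  simpa using pointwiseLip_le_of_edist_le (K := 1) (by simp) (by simpa using h)

theorem pointwiseLip_eq_zero {f : X → V} {x : X} (h : ∀ᶠ y in 𝓝 x, f y = f x) :
    pointwiseLip f x = 0 := by
  refine le_antisymm ?_ zero_le
  have := pointwiseLip_le_of_edist_le (f := f) (g := f) (K := 0) (x := x) (by simp)
    (h.mono fun y hy => by simp [hy])
  simpa using this

theorem pointwiseLip_le_of_bound {f : X → V} {x : X} {K : ℝ≥0∞}
    (h : ∀ᶠ y in 𝓝 x, edist (f x) (f y) ≤ K * edist x y) : pointwiseLip f x ≤ K := by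
  obtain ⟨ε, hε, hb⟩ := Metric.eventually_nhds_iff_ball.1 h
  refine liminf_le_of_frequently_le' (Eventually.frequently ?_)
  filter_upwards [Ioo_mem_nhdsGT hε] with r hr
  refine iSup₂_le fun y hy => ?_
  refine ENNReal.div_le_of_le_mul ((hb y (Metric.ball_subset_ball hr.2.le hy)).trans ?_)
  gcongr
  rw [edist_comm, edist_dist]
  exact ENNReal.ofReal_le_ofReal (Metric.mem_ball.1 hy).le

theorem locallyLipschitzOn_of_ball {U : Set X} {f : X → V}
    (h : ∀ x ∈ U, ∃ K : ℝ≥0, ∃ ε > 0, LipschitzOnWith K f (Metric.ball x ε)) :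
    LocallyLipschitzOn U f := fun x hx => by
  obtain ⟨K, ε, hε, hK⟩ := h x hx
  exact ⟨K, _, mem_nhdsWithin_of_mem_nhds (Metric.ball_mem_nhds x hε), hK⟩

theorem LocallyLipschitzOn.comp_lipschitz {W : Type*} [NormedAddCommGroup W] {U : Set X}
    {f : X → V} (hf : LocallyLipschitzOn U f) {φ : V → W} {K : ℝ≥0} (hφ : LipschitzWith K φ) :
    LocallyLipschitzOn U (fun x => φ (f x)) := fun x hx => by
  obtain ⟨L, t, ht, hL⟩ := hf hx
  exact ⟨K * L, t, ht, hφ.comp_lipschitzOnWith hL⟩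

/-- At a fixed radius the supremum of difference quotients is lower semicontinuous on `U`, as a
supremum of continuous functions over open conditions. Rational radii compute the liminf: the
supremum over a ball is monotone in the radius and division by the radius is continuous, so a
rational `q` just below `r` gives a quotient not much larger than that at `r`. -/
theorem exists_measurable_eqOn_pointwiseLip [MeasurableSpace X] [BorelSpace X] {U : Set X}
    (hU : IsOpen U) {f : X → V} (hf : ContinuousOn f U) :
    ∃ G : X → ℝ≥0∞, Measurable G ∧ EqOn (pointwiseLip f) G U := by
  classical
  let T : ℚ → X → ℝ≥0∞ := fun q x =>
    if x ∈ U then ⨆ x' ∈ Metric.ball x q ∩ U, edist (f x) (f x') / ENNReal.ofReal q else 0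
  have hT : ∀ q : ℚ, 0 < q → Measurable (T q) := fun q hq => by
    refine LowerSemicontinuous.measurable fun x a ha => ?_
    by_cases hx : x ∈ U
    · simp only [T, hx, if_true, lt_iSup_iff] at ha
      obtain ⟨x', ⟨hx', hx'U⟩, hlt⟩ := ha
      have h1 : ∀ᶠ y in 𝓝 x, a < edist (f y) (f x') / ENNReal.ofReal q := by
        have : ContinuousAt (fun y => edist (f y) (f x') / ENNReal.ofReal q) x := by
          have hq' : ENNReal.ofReal (q : ℝ) ≠ 0 := by
            rw [Ne, ENNReal.ofReal_eq_zero, not_le]; exact_mod_cast hq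
          exact ENNReal.Tendsto.div_const
            (((hf.continuousAt (hU.mem_nhds hx)).edist continuousAt_const)) (Or.inr hq')
        exact this.eventually (lt_mem_nhds hlt)
      have h2 : ∀ᶠ y in 𝓝 x, dist x' y < q :=
        (continuous_const.dist continuous_id).continuousAt.eventually
          (gt_mem_nhds (Metric.mem_ball.1 hx'))
      filter_upwards [h1, h2, hU.mem_nhds hx] with y hy1 hy2 hyU
      simp only [T, hyU, if_true, lt_iSup_iff]
      exact ⟨x', ⟨hy2, hx'U⟩, hy1⟩
    · simp [T, hx] at ha
  refine ⟨fun x => ⨆ n : ℕ, ⨅ q : {q : ℚ // 0 < q ∧ (q : ℝ) < 1 / ((n : ℝ) + 1)}, T q x,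
    .iSup fun n => .iInf fun q => hT q q.2.1, fun x hx => ?_⟩
  simp only [T, hx, if_true]
  let S : ℝ → ℝ≥0∞ := fun r => ⨆ x' ∈ Metric.ball x r ∩ U, edist (f x) (f x') / ENNReal.ofReal r
  have hS : pointwiseLip f x = liminf S (𝓝[>] 0) := by
    refine liminf_congr ?_
    obtain ⟨ε, hε, hb⟩ := Metric.isOpen_iff.1 hU x hx
    filter_upwards [Ioo_mem_nhdsGT hε] with r hr
    simp only [S]
    rw [inter_eq_left.2 ((Metric.ball_subset_ball hr.2.le).trans hb)]
  rw [hS, (nhdsGT_basis (0 : ℝ)).liminf_eq_iSup_iInf]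
  refine le_antisymm (iSup₂_le fun b hb => ?_) (iSup_le fun n => ?_)
  · obtain ⟨n, hn⟩ := exists_nat_one_div_lt hb
    refine le_iSup_of_le n (le_iInf fun q => iInf₂_le_of_le (q : ℝ) ⟨?_, q.2.2.trans hn⟩ le_rfl)
    exact_mod_cast q.2.1
  · refine le_iSup₂_of_le (1 / ((n : ℝ) + 1)) (by positivity) (le_iInf₂ fun r hr => ?_)
    let A : ℝ≥0∞ := ⨆ x' ∈ Metric.ball x r ∩ U, edist (f x) (f x')
    have hA : S r = A / ENNReal.ofReal r := by simp only [S, A, ENNReal.iSup_div]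
    change _ ≤ S r
    rw [hA]
    refine le_of_forall_gt fun c hc => ?_
    have hcont : ContinuousAt (fun q : ℝ => A / ENNReal.ofReal q) r := by
      refine ENNReal.Tendsto.div tendsto_const_nhds (Or.inr ?_)
        (ENNReal.continuous_ofReal.tendsto r) (Or.inl ENNReal.ofReal_ne_top)
      rw [Ne, ENNReal.ofReal_eq_zero, not_le]; exact hr.1
    obtain ⟨ε, hε, hb⟩ := Metric.eventually_nhds_iff_ball.1 (hcont.eventually (gt_mem_nhds hc))
    obtain ⟨q, hq1, hq2⟩ := exists_rat_btwn (show max (r - ε) 0 < r from max_lt (by linarith) hr.1)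
    have hq0 : (0 : ℝ) < q := (le_max_right _ _).trans_lt hq1
    refine (iInf_le _ ⟨q, by exact_mod_cast hq0, hq2.trans hr.2⟩).trans_lt (lt_of_le_of_lt ?_
      (hb q ?_))
    · simp only [A, ENNReal.iSup_div]
      exact biSup_mono fun x' hx' => ⟨Metric.ball_subset_ball hq2.le hx'.1, hx'.2⟩
    · rw [Metric.mem_ball, Real.dist_eq, abs_lt]
      constructor <;> linarith [(le_max_left (r - ε) 0).trans_lt hq1]

theorem aemeasurable_pointwiseLip [MeasurableSpace X] [BorelSpace X] {U : Set X}
    (hU : IsOpen U) {f : X → V} (hf : ContinuousOn f U) (μ : Measure X) :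
    AEMeasurable (pointwiseLip f) (μ.restrict U) := by
  obtain ⟨G, hG, h⟩ := exists_measurable_eqOn_pointwiseLip hU hf
  exact ⟨G, hG, (ae_restrict_iff' hU.measurableSet).2 (ae_of_all _ h)⟩

end PointwiseLip

/-! ### Approximating sequences and lower semicontinuity of the variation -/

section Variation

variable {X V : Type*} [MetricSpace X] [MeasurableSpace X] [NormedAddCommGroup V]
  {μ : Measure X} {U : Set X}

theorem isBV_iff_VAR_lt_top {h : X → V} : IsBV μ U h ↔ VAR μ U h < ∞ := by
  simp only [IsBV, VAR, iInf_lt_iff, exists_prop]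

theorem exists_approx_of_VAR_lt {h : X → V} {c : ℝ≥0∞} (hc : VAR μ U h < c) {ε : ℝ≥0∞}
    (hε : 0 < ε) : ∃ v : X → V, LocallyLipschitzOn U v ∧ MemLp v 1 (μ.restrict U) ∧
      eLpNorm (v - h) 1 (μ.restrict U) < ε ∧ ∫⁻ x in U, pointwiseLip v x ∂μ < c := by
  simp only [VAR, iInf_lt_iff] at hc
  obtain ⟨u, hu, hlt⟩ := hc
  have h1 := frequently_lt_of_liminf_lt (by isBoundedDefault) hlt
  obtain ⟨n, hn1, hn2⟩ := (h1.and_eventually (hu.tendsto.eventually (gt_mem_nhds hε))).exists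
  exact ⟨u n, hu.locallyLipschitz n, hu.memLp n, hn2, hn1⟩

theorem VAR_le_liminf_of_isLipApprox {h : X → V} {u : ℕ → X → V} (hu : IsLipApprox μ U h u) :
    VAR μ U h ≤ liminf (fun n => ∫⁻ x in U, pointwiseLip (u n) x ∂μ) atTop :=
  iInf₂_le u hu

theorem VAR_le_of_forall_approx {h : X → V} {c : ℝ≥0∞}
    (H : ∀ ε : ℝ≥0∞, 0 < ε → ∃ v : X → V, LocallyLipschitzOn U v ∧ MemLp v 1 (μ.restrict U) ∧
      eLpNorm (v - h) 1 (μ.restrict U) ≤ ε ∧ ∫⁻ x in U, pointwiseLip v x ∂μ ≤ c) :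
    VAR μ U h ≤ c := by
  have hpos : ∀ n : ℕ, (0 : ℝ≥0∞) < ((n : ℝ≥0∞) + 1)⁻¹ := fun n => by
    simp [ENNReal.inv_pos]
  choose u h1 h2 h3 h4 using fun n : ℕ => H _ (hpos n)
  have hu : IsLipApprox μ U h u := by
    refine ⟨h1, h2, tendsto_of_tendsto_of_tendsto_of_le_of_le tendsto_const_nhds ?_
      (fun _ => zero_le) h3⟩
    have := (tendsto_add_atTop_iff_nat 1).2 ENNReal.tendsto_inv_nat_nhds_zero
    simpa using this
  refine (VAR_le_liminf_of_isLipApprox hu).trans ?_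
  exact liminf_le_of_frequently_le' (Eventually.frequently (Eventually.of_forall h4))

/-- A diagonal choice attains the infimum by a genuine limit, not only a liminf. Hence the integrals
still converge along subsequences and may be added. -/
theorem exists_isLipApprox_tendsto {h : X → V} (hh : VAR μ U h ≠ ∞) :
    ∃ u : ℕ → X → V, IsLipApprox μ U h u ∧
      Tendsto (fun n => ∫⁻ x in U, pointwiseLip (u n) x ∂μ) atTop (𝓝 (VAR μ U h)) := by
  have hpos : ∀ n : ℕ, (0 : ℝ≥0∞) < ((n : ℝ≥0∞) + 1)⁻¹ := fun n => by
    simp [ENNReal.inv_pos]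
  have hlim : Tendsto (fun n : ℕ => ((n : ℝ≥0∞) + 1)⁻¹) atTop (𝓝 0) := by
    have := (tendsto_add_atTop_iff_nat 1).2 ENNReal.tendsto_inv_nat_nhds_zero
    simpa using this
  choose u h1 h2 h3 h4 using fun n : ℕ =>
    exists_approx_of_VAR_lt (ENNReal.lt_add_right hh (hpos n).ne') (hpos n)
  have hu : IsLipApprox μ U h u :=
    ⟨h1, h2, tendsto_of_tendsto_of_tendsto_of_le_of_le tendsto_const_nhds hlim
      (fun _ => zero_le) fun n => (h3 n).le⟩
  refine ⟨u, hu, tendsto_of_le_liminf_of_limsup_le (VAR_le_liminf_of_isLipApprox hu) ?_⟩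
  have h5 : Tendsto (fun n : ℕ => VAR μ U h + ((n : ℝ≥0∞) + 1)⁻¹) atTop (𝓝 (VAR μ U h)) := by
    simpa using tendsto_const_nhds.add hlim
  rw [← h5.limsup_eq]
  exact limsup_le_limsup (Eventually.of_forall fun n => (h4 n).le)

theorem VAR_congr_ae {h h' : X → V} (hh : h =ᵐ[μ.restrict U] h') : VAR μ U h = VAR μ U h' := by
  have key : ∀ {h h' : X → V}, h =ᵐ[μ.restrict U] h' → VAR μ U h ≤ VAR μ U h' := by
    intro h h' hh
    refine le_of_forall_gt fun c hc => lt_of_le_of_lt ?_ hc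
    refine le_of_forall_gt fun c' hc' => ?_
    obtain ⟨c'', h1, h2⟩ := exists_between hc'
    refine lt_of_le_of_lt (VAR_le_of_forall_approx (c := c'') fun ε hε => ?_) h2
    obtain ⟨v, hv1, hv2, hv3, hv4⟩ := exists_approx_of_VAR_lt h1 hε
    refine ⟨v, hv1, hv2, ?_, hv4.le⟩
    rw [eLpNorm_congr_ae (Filter.EventuallyEq.rfl.sub hh)]
    exact hv3.le
  exact le_antisymm (key hh) (key hh.symm)

theorem VAR_le_liminf {ι : Type*} {l : Filter ι} {h : X → V} {hn : ι → X → V}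
    (hh : AEStronglyMeasurable h (μ.restrict U))
    (hhn : ∀ n, AEStronglyMeasurable (hn n) (μ.restrict U))
    (hlim : Tendsto (fun n => eLpNorm (hn n - h) 1 (μ.restrict U)) l (𝓝 0)) :
    VAR μ U h ≤ liminf (fun n => VAR μ U (hn n)) l := by
  refine le_of_forall_gt fun c hc => ?_
  obtain ⟨c', h1, h2⟩ := exists_between hc
  refine lt_of_le_of_lt (VAR_le_of_forall_approx (c := c') fun ε hε => ?_) h2
  have hε2 : 0 < ε / 2 := ENNReal.half_pos hε.ne'
  have hf := frequently_lt_of_liminf_lt (by isBoundedDefault) h1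
  obtain ⟨n, hn1, hn2⟩ := (hf.and_eventually (hlim.eventually (gt_mem_nhds hε2))).exists
  obtain ⟨v, hv1, hv2, hv3, hv4⟩ := exists_approx_of_VAR_lt hn1 hε2
  refine ⟨v, hv1, hv2, ?_, hv4.le⟩
  calc eLpNorm (v - h) 1 (μ.restrict U)
      = eLpNorm ((v - hn n) + (hn n - h)) 1 (μ.restrict U) := by rw [sub_add_sub_cancel]
    _ ≤ eLpNorm (v - hn n) 1 (μ.restrict U) + eLpNorm (hn n - h) 1 (μ.restrict U) :=
        eLpNorm_add_le (hv2.1.sub (hhn n)) ((hhn n).sub hh) le_rfl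
    _ ≤ ε / 2 + ε / 2 := add_le_add hv3.le hn2.le
    _ = ε := ENNReal.add_halves ε

theorem VAR_le_lintegral_pointwiseLip {v : X → V} (h1 : LocallyLipschitzOn U v)
    (h2 : MemLp v 1 (μ.restrict U)) : VAR μ U v ≤ ∫⁻ x in U, pointwiseLip v x ∂μ :=
  VAR_le_of_forall_approx fun ε _ => ⟨v, h1, h2, by simp, le_rfl⟩

theorem pointwiseLip_neg {X V : Type*} [MetricSpace X] [NormedAddCommGroup V] (v : X → V) : pointwiseLip (-v) = pointwiseLip v := by
  funext x
  simp [pointwiseLip, edist_neg_neg]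

theorem VAR_neg (h : X → V) : VAR μ U (-h) = VAR μ U h := by
  have key : ∀ h : X → V, VAR μ U (-h) ≤ VAR μ U h := by
    intro h
    refine le_of_forall_gt fun c hc => ?_
    obtain ⟨c', h1, h2⟩ := exists_between hc
    refine lt_of_le_of_lt (VAR_le_of_forall_approx (c := c') fun ε hε => ?_) h2
    obtain ⟨v, hv1, hv2, hv3, hv4⟩ := exists_approx_of_VAR_lt h1 hε
    refine ⟨-v, hv1.comp_lipschitz (φ := fun y => -y) (K := 1) (LipschitzWith.id.neg),
      hv2.neg, ?_, by rw [pointwiseLip_neg]; exact hv4.le⟩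
    rw [← neg_sub', eLpNorm_neg]
    exact hv3.le
  exact le_antisymm (key h) (by simpa using key (-h))

theorem VAR_zero : VAR μ U (0 : X → V) = 0 := by
  refine le_antisymm ((VAR_le_lintegral_pointwiseLip
    ((LocallyLipschitz.const (0 : V)).locallyLipschitzOn) MemLp.zero).trans ?_) zero_le
  have : ∀ x, pointwiseLip (0 : X → V) x = 0 := fun x => pointwiseLip_eq_zero (by simp)
  exact (lintegral_congr this).trans_le (by simp)

/-- This is the source of Borel measurability of the variation on `L¹` and of the perimeter on cuts.
-/
theorem lowerSemicontinuous_VAR [BorelSpace X] :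
    LowerSemicontinuous fun u : Lp V 1 (μ.restrict U) => VAR μ U (u : X → V) := by
  rw [lowerSemicontinuous_iff_le_liminf]
  intro u
  refine VAR_le_liminf (Lp.aestronglyMeasurable u) (fun v => Lp.aestronglyMeasurable v) ?_
  have : Tendsto (fun v : Lp V 1 (μ.restrict U) => edist v u) (𝓝 u) (𝓝 0) :=
    tendsto_iff_edist_tendsto_0.1 tendsto_id
  simpa only [Lp.edist_def] using this

end Variation

/-! ### Almost everywhere convergence along a subsequence -/

section Subsequence

/-- Along a subsequence with integrals at most `2⁻ⁿ` the sum of the functions is integrable, so it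
is finite almost everywhere and its terms tend to zero. -/
theorem exists_seq_tendsto_zero_ae {α : Type*} [MeasurableSpace α] {ν : Measure α}
    {F : ℕ → α → ℝ≥0∞} (hF : ∀ n, AEMeasurable (F n) ν)
    (hlim : Tendsto (fun n => ∫⁻ t, F n t ∂ν) atTop (𝓝 0)) :
    ∃ ns : ℕ → ℕ, StrictMono ns ∧ ∀ᵐ t ∂ν, Tendsto (fun i => F (ns i) t) atTop (𝓝 0) := by
  obtain ⟨ns, hns, h⟩ := extraction_forall_of_eventually'
    (P := fun n k => ∫⁻ t, F k t ∂ν ≤ (2⁻¹ : ℝ≥0∞) ^ n) fun n => by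
      obtain ⟨N, hN⟩ := eventually_atTop.1 (hlim.eventually
        (ge_mem_nhds (ENNReal.pow_pos (show (0 : ℝ≥0∞) < 2⁻¹ by simp) n)))
      exact ⟨N, hN⟩
  refine ⟨ns, hns, ?_⟩
  have hsum : ∫⁻ t, ∑' i, F (ns i) t ∂ν ≠ ∞ := by
    rw [lintegral_tsum fun i => hF (ns i)]
    refine ne_top_of_le_ne_top ?_ (ENNReal.tsum_le_tsum h)
    rw [ENNReal.tsum_geometric]
    simp
  filter_upwards [ae_lt_top' (AEMeasurable.tsum fun i => hF (ns i)) hsum] with t ht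
  exact ENNReal.tendsto_atTop_zero_of_tsum_ne_top ht.ne

end Subsequence

/-! ### Level indicators and their ramp approximations -/

section Level

/-- The value at a point of the characteristic function of a slice at height `t`, for a function
with value `a` at that point. -/
noncomputable def levelIndicator (a t : ℝ) : ℝ := if 1 ≤ a / t then 1 else 0

/-- The single inequality covers both signs of `t`. At `t = 0` the convention `a / 0 = 0` makes it
false, in agreement with the empty slice there. -/
theorem one_le_div_iff_slice {a t : ℝ} : 1 ≤ a / t ↔ (0 < t ∧ t ≤ a) ∨ (t < 0 ∧ a ≤ t) := by
  rcases lt_trichotomy t 0 with ht | ht | ht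
  · rw [one_le_div_of_neg ht]; simp [ht, ht.not_gt]
  · simp [ht]
  · rw [one_le_div ht]; simp [ht, ht.not_gt]

@[fun_prop]
theorem measurable_levelIndicator : Measurable fun p : ℝ × ℝ => levelIndicator p.1 p.2 :=
  Measurable.ite (measurableSet_le measurable_const (measurable_fst.div measurable_snd))
    measurable_const measurable_const

@[simp]
theorem levelIndicator_zero_left (t : ℝ) : levelIndicator 0 t = 0 := by simp [levelIndicator]

/-- The two indicators can differ only at heights between `a` and `b`. After integration over `x`
this turns `L¹` convergence of functions into `L¹` convergence of slices, averaged over heights. -/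
theorem lintegral_levelIndicator_sub_le (a b : ℝ) :
    ∫⁻ t, ‖levelIndicator a t - levelIndicator b t‖ₑ ≤ ‖a - b‖ₑ := by
  calc ∫⁻ t, ‖levelIndicator a t - levelIndicator b t‖ₑ
      ≤ ∫⁻ t, (uIcc a b).indicator 1 t := by
        refine lintegral_mono fun t => ?_
        by_cases h : t ∈ uIcc a b
        · simp only [h, indicator_of_mem, Pi.one_apply, levelIndicator]
          split_ifs <;> simp
        · rw [indicator_of_notMem h]
          suffices levelIndicator a t = levelIndicator b t by simp [this]
          simp only [levelIndicator, one_le_div_iff_slice]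
          rw [mem_uIcc, not_or, not_and, not_and] at h
          congr 1
          have : (0 < t ∧ t ≤ a ∨ t < 0 ∧ a ≤ t) ↔ (0 < t ∧ t ≤ b ∨ t < 0 ∧ b ≤ t) := by
            grind
          exact propext this
    _ = volume (uIcc a b) := lintegral_indicator_one measurableSet_uIcc
    _ = ‖a - b‖ₑ := by
        rw [Real.volume_interval, Real.enorm_eq_ofReal_abs, abs_sub_comm]

/-- Piecewise linear approximation of the characteristic function of `[1, ∞)`. -/
noncomputable def ramp (n : ℕ) (s : ℝ) : ℝ := max 0 (min 1 ((n + 2) * (s - 1) + 1))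

theorem ramp_nonneg (n : ℕ) (s : ℝ) : 0 ≤ ramp n s := le_max_left _ _

theorem ramp_le_one (n : ℕ) (s : ℝ) : ramp n s ≤ 1 := max_le zero_le_one (min_le_left _ _)

theorem ramp_of_one_le {n : ℕ} {s : ℝ} (h : 1 ≤ s) : ramp n s = 1 := by
  have : 1 ≤ ((n : ℝ) + 2) * (s - 1) + 1 := by
    have : 0 ≤ ((n : ℝ) + 2) * (s - 1) := mul_nonneg (by positivity) (by linarith)
    linarith
  rw [ramp, min_eq_left this, max_eq_right zero_le_one]

theorem ramp_of_le {n : ℕ} {s : ℝ} (h : s ≤ (n + 1) / (n + 2)) : ramp n s = 0 := by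
  have : ((n : ℝ) + 2) * (s - 1) + 1 ≤ 0 := by
    rw [le_div_iff₀ (by positivity)] at h
    linarith
  rw [ramp, max_eq_left ((min_le_right _ _).trans this)]

/-- The point below which the ramps vanish stays at or above `1/2` for every `n`. Hence they vanish
at `0`, and their distance to the step function is dominated by `2|s|`. -/
theorem half_le_ramp_threshold (n : ℕ) : (1 / 2 : ℝ) ≤ (n + 1) / (n + 2) := by
  rw [div_le_div_iff₀ (by positivity) (by positivity)]
  have : (0 : ℝ) ≤ n := n.cast_nonneg
  linarith

theorem ramp_zero (n : ℕ) : ramp n 0 = 0 :=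
  ramp_of_le ((by norm_num : (0 : ℝ) ≤ 1 / 2).trans (half_le_ramp_threshold n))

theorem lipschitzWith_ramp (n : ℕ) : LipschitzWith (n + 2) (ramp n) := by
  have h : LipschitzWith (n + 2) fun s : ℝ => ((n : ℝ) + 2) * (s - 1) + 1 := by
    refine LipschitzWith.of_dist_le_mul fun a b => le_of_eq ?_
    rw [Real.dist_eq, Real.dist_eq, show ((n : ℝ) + 2) * (a - 1) + 1 - (((n : ℝ) + 2) * (b - 1) + 1)
      = ((n : ℝ) + 2) * (a - b) by ring, abs_mul, abs_of_nonneg (by positivity)]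
    simp
  exact (h.const_min 1).const_max 0

theorem tendsto_ramp (s : ℝ) :
    Tendsto (fun n => ramp n s) atTop (𝓝 (if 1 ≤ s then 1 else 0)) := by
  split_ifs with h
  · simp [ramp_of_one_le h]
  · refine tendsto_const_nhds.congr' ?_
    push Not at h
    obtain ⟨N, hN⟩ := exists_nat_gt (1 / (1 - s))
    filter_upwards [eventually_ge_atTop N] with n hn
    refine (ramp_of_le ?_).symm
    have h1 : 1 / (1 - s) < (n : ℝ) := hN.trans_le (by exact_mod_cast hn)
    rw [div_lt_iff₀ (by linarith)] at h1
    rw [le_div_iff₀ (by positivity)]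
    nlinarith

theorem abs_ramp_sub_le (n : ℕ) (s : ℝ) : |ramp n s - if 1 ≤ s then 1 else 0| ≤ 2 * |s| := by
  by_cases h : s ≤ 1 / 2
  · rw [ramp_of_le (h.trans (half_le_ramp_threshold n)), if_neg (by linarith)]
    simp
  · have h0 := ramp_nonneg n s
    have h1 := ramp_le_one n s
    have h2 := le_abs_self s
    rw [abs_le]
    split_ifs <;> constructor <;> linarith

end Level

/-! ### Measurability and size of slices -/

section Slice

variable {X : Type*} [MeasurableSpace X] {m : Measure X}

theorem coeFn_Slice (u : Lp ℝ 1 m) (t : ℝ) :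
    ((Slice (u, t) : Cut m) : Lp ℝ 1 m) =ᵐ[m] fun x => levelIndicator (u x) t := by
  classical
  have h : ((Slice (u, t) : Cut m) : Lp ℝ 1 m) =ᵐ[m] (sliceSet u t).indicator fun _ => (1 : ℝ) :=
    indicatorConstLp_coeFn (hs := measurableSet_sliceSet u t) (hμs := measure_sliceSet_ne_top u t)
  refine h.trans (Eventually.of_forall fun x => ?_)
  simp only [levelIndicator, one_le_div_iff_slice, sliceSet, indicator_apply, mem_ofPred_eq]

/-- `Slice (u, t)` as the limit of compositions of `u / t` with Lipschitz functions. -/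
theorem tendsto_compLp_ramp (u : Lp ℝ 1 m) (t : ℝ) :
    Tendsto (fun n => (lipschitzWith_ramp n).compLp (ramp_zero n) (t⁻¹ • u)) atTop
      (𝓝 ((Slice (u, t) : Cut m) : Lp ℝ 1 m)) := by
  rw [tendsto_iff_edist_tendsto_0]
  simp only [Lp.edist_def, eLpNorm_one_eq_lintegral_enorm]
  have hsm := Lp.coeFn_smul t⁻¹ u
  have h1 : ∀ n : ℕ, ∀ᵐ x ∂m,
      ((lipschitzWith_ramp n).compLp (ramp_zero n) (t⁻¹ • u) : X → ℝ) x = ramp n (u x / t) := by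
    intro n
    filter_upwards [(lipschitzWith_ramp n).coeFn_compLp (ramp_zero n) (t⁻¹ • u), hsm] with x h1 h2
    rw [h1, Function.comp_apply, h2, Pi.smul_apply, smul_eq_mul, div_eq_inv_mul]
  have h2 : Tendsto (fun n => ∫⁻ x, ‖ramp n (u x / t) - levelIndicator (u x) t‖ₑ ∂m) atTop
      (𝓝 (∫⁻ _, 0 ∂m)) := by
    have hu : Measurable (u : X → ℝ) := (Lp.stronglyMeasurable u).measurable
    refine tendsto_lintegral_of_dominated_convergence (fun x => 2 * ‖u x / t‖ₑ) ?_ ?_ ?_ ?_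
    · intro n
      have := (lipschitzWith_ramp n).continuous.measurable
      exact ((this.comp (hu.div_const t)).sub
        (measurable_levelIndicator.comp (hu.prodMk measurable_const))).enorm
    · refine fun n => ae_of_all _ fun x => ?_
      have := abs_ramp_sub_le n (u x / t)
      simp only [levelIndicator]
      rw [Real.enorm_eq_ofReal_abs, Real.enorm_eq_ofReal_abs, ← ENNReal.ofReal_ofNat,
        ← ENNReal.ofReal_mul (by norm_num)]
      exact ENNReal.ofReal_le_ofReal this
    · have : Integrable (fun x => u x / t) m := (L1.integrable_coeFn u).div_const t
      rw [lintegral_const_mul _ (hu.div_const t).enorm]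
      exact ENNReal.mul_ne_top (by simp) this.2.ne
    · refine ae_of_all _ fun x => ?_
      have := ((tendsto_ramp (u x / t)).sub_const (levelIndicator (u x) t)).enorm
      simpa [levelIndicator] using this
  rw [lintegral_zero] at h2
  refine h2.congr fun n => lintegral_congr_ae ?_
  filter_upwards [h1 n, coeFn_Slice u t] with x hx1 hx2
  rw [Pi.sub_apply, hx1, hx2]

theorem measurable_Slice_right (u : Lp ℝ 1 m) : Measurable fun t => (Slice (u, t) : Cut m) := by
  refine Measurable.subtype_mk (f := fun t => ((Slice (u, t) : Cut m) : Lp ℝ 1 m)) ?_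
  refine measurable_of_tendsto_metrizable (f := fun (n : ℕ) (t : ℝ) =>
    (lipschitzWith_ramp n).compLp (ramp_zero n) (t⁻¹ • u)) (fun n => ?_)
    (tendsto_pi_nhds.2 fun t => tendsto_compLp_ramp u t)
  have h : Continuous fun c : ℝ => (lipschitzWith_ramp n).compLp (ramp_zero n) (c • u) :=
    ((lipschitzWith_ramp n).continuous_compLp (ramp_zero n)).comp (by fun_prop)
  exact h.measurable.comp measurable_inv

/-- The slice map is obtained as a pointwise limit in `L¹` of measurable maps: compositions with a
fixed Lipschitz ramp are continuous in `(c, u) ↦ c • u`, and inversion of `t` is measurable. -/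
theorem measurable_Slice [SecondCountableTopology (Lp ℝ 1 m)] :
    Measurable (Slice : Lp ℝ 1 m × ℝ → Cut m) := by
  refine Measurable.subtype_mk (f := fun p : Lp ℝ 1 m × ℝ => ((Slice p : Cut m) : Lp ℝ 1 m)) ?_
  refine measurable_of_tendsto_metrizable (f := fun (n : ℕ) (p : Lp ℝ 1 m × ℝ) =>
    (lipschitzWith_ramp n).compLp (ramp_zero n) (p.2⁻¹ • p.1)) (fun n => ?_)
    (tendsto_pi_nhds.2 fun p => tendsto_compLp_ramp p.1 p.2)
  have h : Continuous fun p : ℝ × Lp ℝ 1 m =>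
      (lipschitzWith_ramp n).compLp (ramp_zero n) (p.1 • p.2) :=
    ((lipschitzWith_ramp n).continuous_compLp (ramp_zero n)).comp (by fun_prop)
  exact h.measurable.comp (measurable_snd.inv.prodMk measurable_fst)

theorem lintegral_enorm_Slice_le [SFinite m] (u : Lp ℝ 1 m) :
    ∫⁻ t, ‖((Slice (u, t) : Cut m) : Lp ℝ 1 m)‖ₑ ≤ ‖u‖ₑ := by
  have hu : Measurable (u : X → ℝ) := (Lp.stronglyMeasurable u).measurable
  calc ∫⁻ t, ‖((Slice (u, t) : Cut m) : Lp ℝ 1 m)‖ₑ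
      = ∫⁻ t, ∫⁻ x, ‖levelIndicator (u x) t‖ₑ ∂m := by
        refine lintegral_congr fun t => ?_
        rw [Lp.enorm_def, eLpNorm_congr_ae (coeFn_Slice u t), eLpNorm_one_eq_lintegral_enorm]
    _ = ∫⁻ x, (∫⁻ t, ‖levelIndicator (u x) t‖ₑ) ∂m := by
        refine lintegral_lintegral_swap (Measurable.aemeasurable ?_)
        exact (measurable_levelIndicator.comp
          ((hu.comp measurable_snd).prodMk measurable_fst)).enorm
    _ ≤ ∫⁻ x, ‖u x‖ₑ ∂m := lintegral_mono fun x => by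
        simpa using lintegral_levelIndicator_sub_le (u x) 0
    _ = ‖u‖ₑ := by rw [Lp.enorm_def, eLpNorm_one_eq_lintegral_enorm]

end Slice

/-! ### Coarea: the perimeters integrate to at most the variation -/

section CoareaLe

variable {X : Type*} [MetricSpace X] [MeasurableSpace X] {μ : Measure X} {U : Set X}

theorem PER_Slice (u : Lp ℝ 1 (μ.restrict U)) (t : ℝ) :
    PER μ U (Slice (u, t)) = VAR μ U fun x => levelIndicator (u x) t :=
  VAR_congr_ae (coeFn_Slice u t)

theorem measurable_PER [BorelSpace X] : Measurable (PER μ U) :=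
  lowerSemicontinuous_VAR.measurable.comp measurable_subtype_coe

theorem measurable_VAR_levelIndicator [BorelSpace X] {v : X → ℝ}
    (hv : MemLp v 1 (μ.restrict U)) : Measurable fun t => VAR μ U fun x => levelIndicator (v x) t := by
  have h := (measurable_PER (μ := μ) (U := U)).comp (measurable_Slice_right (hv.toLp v))
  convert h using 1
  funext t
  rw [Function.comp_apply, PER_Slice]
  refine VAR_congr_ae ?_
  filter_upwards [hv.coeFn_toLp] with x hx
  rw [hx]

/-- The density of heights `t` at which the ramp of slope `n + 2` at height `t` has nonzero
slope at a point where the function has the value `a`. -/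
noncomputable def rampWeight (n : ℕ) (a t : ℝ) : ℝ≥0∞ :=
  if ((n : ℝ) + 1) / (n + 2) ≤ a / t ∧ a / t ≤ 1 then ENNReal.ofReal ((n + 2) / |t|) else 0

theorem measurable_rampWeight (n : ℕ) : Measurable fun p : ℝ × ℝ => rampWeight n p.1 p.2 := by
  have h : Measurable fun p : ℝ × ℝ => p.1 / p.2 := measurable_fst.div measurable_snd
  refine Measurable.ite ((measurableSet_le measurable_const h).inter
    (measurableSet_le h measurable_const)) ?_ measurable_const
  have : Measurable fun p : ℝ × ℝ => ((n : ℝ) + 2) / |p.2| :=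
    measurable_const.div (continuous_abs.measurable.comp measurable_snd)
  exact this.ennreal_ofReal

/-- The heights with nonzero weight lie between `a` and `a (n + 2) / (n + 1)`, an interval of length
`|a| / (n + 1)`. There `|t| ≥ |a|`, so the weight is at most `(n + 2) / |a|`. -/
theorem lintegral_rampWeight_le (n : ℕ) (a : ℝ) :
    ∫⁻ t, rampWeight n a t ≤ ENNReal.ofReal ((n + 2) / (n + 1)) := by
  have hn : (0 : ℝ) ≤ n := n.cast_nonneg
  have hpos : (0 : ℝ) < ((n : ℝ) + 1) / (n + 2) := by positivity
  rcases eq_or_ne a 0 with rfl | ha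
  · simp [rampWeight, hpos.not_ge]
  have ha' : 0 < |a| := abs_pos.2 ha
  calc ∫⁻ t, rampWeight n a t
      ≤ ∫⁻ t, (uIcc a (a * ((n + 2) / (n + 1)))).indicator
          (fun _ => ENNReal.ofReal ((n + 2) / |a|)) t := by
        refine lintegral_mono fun t => ?_
        unfold rampWeight
        split_ifs with h
        · obtain ⟨h1, h2⟩ := h
          have ht0 : t ≠ 0 := by
            rintro rfl
            simp at h1
            linarith
          have hat : 0 < a / t := hpos.trans_le h1
          have hq : |a| / |t| = a / t := by rw [← abs_div, abs_of_pos hat]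
          have hat1 : |a| ≤ |t| := by
            rw [← div_le_one (abs_pos.2 ht0), hq]; exact h2
          have hle : t / a ≤ (n + 2) / (n + 1) := by
            have := inv_anti₀ hpos h1
            rwa [inv_div, inv_div] at this
          have hge : 1 ≤ t / a := by
            have := inv_anti₀ hat h2
            rwa [inv_div, inv_one] at this
          have hmem : t ∈ uIcc a (a * ((n + 2) / (n + 1))) := by
            rw [mem_uIcc]
            rcases ha.lt_or_gt with h | h
            · right
              rw [one_le_div_of_neg h] at hge
              rw [div_le_iff_of_neg h] at hle
              exact ⟨by linarith, hge⟩
            · left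
              rw [one_le_div h] at hge
              rw [div_le_iff₀ h] at hle
              exact ⟨hge, by linarith⟩
          rw [indicator_of_mem hmem]
          exact ENNReal.ofReal_le_ofReal (div_le_div_of_nonneg_left (by positivity) ha' hat1)
        · exact zero_le
    _ = ENNReal.ofReal ((n + 2) / |a|) * volume (uIcc a (a * ((n + 2) / (n + 1)))) := by
        rw [lintegral_indicator_const measurableSet_uIcc]
    _ = ENNReal.ofReal ((n + 2) / (n + 1)) := by
        rw [Real.volume_interval, ← ENNReal.ofReal_mul (by positivity)]
        congr 1
        have : a * ((n + 2) / (n + 1)) - a = a * (1 / (n + 1)) := by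
          field_simp; ring
        rw [this, abs_mul, abs_of_pos (a := 1 / ((n : ℝ) + 1)) (by positivity)]
        field_simp

/-- Outside the closed window of slopes the ramp of `v / t` is locally constant, by continuity of
`v`. Inside it, the Lipschitz constant of the ramp divided by `|t|` is the weight. -/
theorem pointwiseLip_ramp_le {X : Type*} [MetricSpace X] {v : X → ℝ} {x : X} (hv : ContinuousAt v x) (n : ℕ) (t : ℝ) :
    pointwiseLip (fun y => ramp n (v y / t)) x ≤ rampWeight n (v x) t * pointwiseLip v x := by
  have hc : ContinuousAt (fun y => v y / t) x := hv.div_const t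
  unfold rampWeight
  split_ifs with h
  · refine pointwiseLip_le_of_edist_le ENNReal.ofReal_ne_top (Eventually.of_forall fun y => ?_)
    refine (lipschitzWith_ramp n _ _).trans (le_of_eq ?_)
    rw [edist_dist, edist_dist, Real.dist_eq, Real.dist_eq, ← sub_div, abs_div,
      div_eq_mul_inv |v x - v y|, mul_comm |v x - v y|, ENNReal.ofReal_mul (by positivity),
      ← mul_assoc, div_eq_mul_inv, ENNReal.ofReal_mul (by positivity)]
    congr 2
    rw [ENNReal.ofReal_add (by positivity) (by norm_num)]
    simp
  · rw [zero_mul, nonpos_iff_eq_zero]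
    rw [not_and_or, not_le, not_le] at h
    refine pointwiseLip_eq_zero ?_
    rcases h with h | h
    · filter_upwards [hc.eventually (gt_mem_nhds h)] with y hy
      rw [ramp_of_le h.le, ramp_of_le hy.le]
    · filter_upwards [hc.eventually (lt_mem_nhds h)] with y hy
      rw [ramp_of_one_le h.le, ramp_of_one_le hy.le]

theorem isLipApprox_ramp {v : X → ℝ} (h1 : LocallyLipschitzOn U v)
    (h2 : MemLp v 1 (μ.restrict U)) (t : ℝ) :
    IsLipApprox μ U (fun x => levelIndicator (v x) t) fun n x => ramp n (v x / t) := by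
  have hdiv : LocallyLipschitzOn U fun x => v x / t := by
    refine h1.comp_lipschitz (φ := fun a : ℝ => a / t) (K := ‖t⁻¹‖₊)
      (LipschitzWith.of_dist_le_mul fun a b => le_of_eq ?_)
    rw [Real.dist_eq, Real.dist_eq, ← sub_div, div_eq_inv_mul, abs_mul]
    simp
  have hdm : MemLp (fun x => v x / t) 1 (μ.restrict U) := by
    simpa [div_eq_inv_mul] using h2.const_mul t⁻¹
  refine ⟨fun n => hdiv.comp_lipschitz (lipschitzWith_ramp n), fun n => ?_, ?_⟩
  · exact (lipschitzWith_ramp n).comp_memLp (ramp_zero n) hdm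
  · have key := tendsto_iff_edist_tendsto_0.1 (tendsto_compLp_ramp (h2.toLp v) t)
    refine key.congr fun n => ?_
    rw [Lp.edist_def]
    refine eLpNorm_congr_ae ?_
    filter_upwards [coeFn_Slice (h2.toLp v) t, h2.coeFn_toLp, Lp.coeFn_smul t⁻¹ (h2.toLp v),
      (lipschitzWith_ramp n).coeFn_compLp (ramp_zero n) (t⁻¹ • h2.toLp v)] with x a b c d
    rw [Pi.sub_apply, Pi.sub_apply, a, d, Function.comp_apply, c, Pi.smul_apply, b, smul_eq_mul,
      div_eq_inv_mul]

/-- Bound each slice by its ramps, apply Fatou's lemma in `n`, and exchange the integrals in `x` and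
`t`. The total weight over heights is then at most `(n + 2) / (n + 1)`, which tends to `1`. -/
theorem lintegral_VAR_levelIndicator_le_of_locallyLipschitzOn [BorelSpace X] [SFinite μ]
    (hU : IsOpen U) {v : X → ℝ} (h1 : LocallyLipschitzOn U v) (h2 : MemLp v 1 (μ.restrict U)) :
    ∫⁻ t, VAR μ U (fun x => levelIndicator (v x) t) ≤ ∫⁻ x in U, pointwiseLip v x ∂μ := by
  have hmeas : ∀ n, AEMeasurable (Function.uncurry fun (t : ℝ) (x : X) =>
      rampWeight n (v x) t * pointwiseLip v x) (volume.prod (μ.restrict U)) := fun n => by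
    have hv : AEMeasurable (fun p : ℝ × X => v p.2) (volume.prod (μ.restrict U)) :=
      h2.1.aemeasurable.comp_snd
    refine AEMeasurable.mul ?_ (aemeasurable_pointwiseLip hU h1.continuousOn μ).comp_snd
    exact (measurable_rampWeight n).comp_aemeasurable (hv.prodMk measurable_fst.aemeasurable)
  calc ∫⁻ t, VAR μ U (fun x => levelIndicator (v x) t)
      ≤ ∫⁻ t, liminf (fun n => ∫⁻ x in U, rampWeight n (v x) t * pointwiseLip v x ∂μ) atTop := by
        refine lintegral_mono fun t =>
          (VAR_le_liminf_of_isLipApprox (isLipApprox_ramp h1 h2 t)).trans ?_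
        refine liminf_le_liminf (Eventually.of_forall fun n => ?_)
        refine setLIntegral_mono' hU.measurableSet fun x hx => ?_
        exact pointwiseLip_ramp_le (h1.continuousOn.continuousAt (hU.mem_nhds hx)) n t
    _ ≤ liminf (fun n => ∫⁻ t, ∫⁻ x in U, rampWeight n (v x) t * pointwiseLip v x ∂μ) atTop :=
        lintegral_liminf_le' fun n => (hmeas n).lintegral_prod_right'
    _ ≤ liminf (fun n : ℕ => ENNReal.ofReal (((n : ℝ) + 2) / (n + 1)) *
          ∫⁻ x in U, pointwiseLip v x ∂μ) atTop := by
        refine liminf_le_liminf (Eventually.of_forall fun n => ?_)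
        rw [lintegral_lintegral_swap (hmeas n),
          ← lintegral_const_mul'' _ (aemeasurable_pointwiseLip hU h1.continuousOn μ)]
        refine lintegral_mono fun x => ?_
        have hw : Measurable fun t => rampWeight n (v x) t :=
          (measurable_rampWeight n).comp measurable_prodMk_left
        rw [lintegral_mul_const _ hw]
        gcongr
        exact lintegral_rampWeight_le n (v x)
    _ = ∫⁻ x in U, pointwiseLip v x ∂μ := by
        have h : Tendsto (fun n : ℕ => ((n : ℝ) + 2) / (n + 1)) atTop (𝓝 1) := by
          have h3 : Tendsto (fun n : ℕ => 1 + 1 / ((n : ℝ) + 1)) atTop (𝓝 (1 + 0)) :=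
            tendsto_const_nhds.add tendsto_one_div_add_atTop_nhds_zero_nat
          rw [add_zero] at h3
          refine h3.congr fun n => ?_
          field_simp
          ring
        have h4 := ENNReal.Tendsto.mul_const (b := ∫⁻ x in U, pointwiseLip v x ∂μ)
          (ENNReal.tendsto_ofReal h) (Or.inl (by simp))
        simpa using h4.liminf_eq

/-- For an optimal sequence `v n → u`, a subsequence has slices converging in `L¹` at almost every
height. Lower semicontinuity at each such height and Fatou's lemma transfer the locally Lipschitz
case. -/
theorem lintegral_VAR_levelIndicator_le [BorelSpace X] [SFinite μ] (hU : IsOpen U) {u : X → ℝ}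
    (hu : MemLp u 1 (μ.restrict U)) :
    ∫⁻ t, VAR μ U (fun x => levelIndicator (u x) t) ≤ VAR μ U u := by
  rcases eq_or_ne (VAR μ U u) ∞ with htop | htop
  · simp [htop]
  obtain ⟨v, hv, hlim⟩ := exists_isLipApprox_tendsto htop
  let F : ℕ → ℝ → ℝ≥0∞ := fun n t =>
    ∫⁻ x in U, ‖levelIndicator (v n x) t - levelIndicator (u x) t‖ₑ ∂μ
  have hF : ∀ n, AEMeasurable (Function.uncurry fun (t : ℝ) (x : X) =>
      ‖levelIndicator (v n x) t - levelIndicator (u x) t‖ₑ) (volume.prod (μ.restrict U)) := by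
    intro n
    have h1 : ∀ {w : X → ℝ}, MemLp w 1 (μ.restrict U) →
        AEMeasurable (fun p : ℝ × X => levelIndicator (w p.2) p.1)
          (volume.prod (μ.restrict U)) := fun hw =>
      measurable_levelIndicator.comp_aemeasurable
        (hw.1.aemeasurable.comp_snd.prodMk measurable_fst.aemeasurable)
    exact ((h1 (hv.memLp n)).sub (h1 hu)).enorm
  have hFint : ∀ n, ∫⁻ t, F n t ≤ eLpNorm (v n - u) 1 (μ.restrict U) := fun n => by
    simp only [F]
    rw [lintegral_lintegral_swap (hF n), eLpNorm_one_eq_lintegral_enorm]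
    exact lintegral_mono fun x => lintegral_levelIndicator_sub_le _ _
  obtain ⟨ns, hns, hae⟩ : ∃ ns : ℕ → ℕ, StrictMono ns ∧
      ∀ᵐ t, Tendsto (fun i => F (ns i) t) atTop (𝓝 0) := by
    have hFt : Tendsto (fun n => ∫⁻ t, F n t) atTop (𝓝 0) :=
      tendsto_of_tendsto_of_tendsto_of_le_of_le tendsto_const_nhds hv.tendsto
        (fun _ => zero_le) hFint
    exact exists_seq_tendsto_zero_ae (fun n => (hF n).lintegral_prod_right') hFt
  have hsub : ∀ᵐ t, VAR μ U (fun x => levelIndicator (u x) t) ≤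
      liminf (fun i => VAR μ U fun x => levelIndicator (v (ns i) x) t) atTop := by
    filter_upwards [hae] with t ht
    have h1 : ∀ {w : X → ℝ}, MemLp w 1 (μ.restrict U) →
        AEStronglyMeasurable (fun x => levelIndicator (w x) t) (μ.restrict U) := fun hw =>
      (measurable_levelIndicator.comp_aemeasurable
        (hw.1.aemeasurable.prodMk measurable_const.aemeasurable)).aestronglyMeasurable
    refine VAR_le_liminf (h1 hu) (fun i => h1 (hv.memLp _)) ?_
    simp only [eLpNorm_one_eq_lintegral_enorm]
    exact ht
  calc ∫⁻ t, VAR μ U (fun x => levelIndicator (u x) t)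
      ≤ ∫⁻ t, liminf (fun i => VAR μ U fun x => levelIndicator (v (ns i) x) t) atTop :=
        lintegral_mono_ae hsub
    _ ≤ liminf (fun i => ∫⁻ t, VAR μ U fun x => levelIndicator (v (ns i) x) t) atTop :=
        lintegral_liminf_le fun i => measurable_VAR_levelIndicator (hv.memLp _)
    _ ≤ liminf (fun i => ∫⁻ x in U, pointwiseLip (v (ns i)) x ∂μ) atTop :=
        liminf_le_liminf (Eventually.of_forall fun i =>
          lintegral_VAR_levelIndicator_le_of_locallyLipschitzOn hU (hv.locallyLipschitz _)
            (hv.memLp _))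
    _ = VAR μ U u := (hlim.comp hns.tendsto_atTop).liminf_eq

end CoareaLe

/-! ### Submodularity of the variation and addition of layers -/

section Submodularity

theorem ENNReal.liminf_add_liminf_le (u v : ℕ → ℝ≥0∞) :
    liminf u atTop + liminf v atTop ≤ liminf (fun n => u n + v n) atTop := by
  simp only [liminf_eq_iSup_iInf_of_nat]
  rw [ENNReal.iSup_add_iSup_of_monotone
    (fun _ _ h => biInf_mono fun _ hi => le_trans h hi)
    (fun _ _ h => biInf_mono fun _ hi => le_trans h hi)]
  exact iSup_mono fun n => le_iInf₂ fun i hi => add_le_add (iInf₂_le i hi) (iInf₂_le i hi)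

variable {X : Type*} [MetricSpace X] [MeasurableSpace X] {μ : Measure X} {U : Set X}

theorem pointwiseLip_add_const_le {X V : Type*} [MetricSpace X] [NormedAddCommGroup V]
    (v : X → V) (c : V) (x : X) : pointwiseLip (fun y => v y + c) x ≤ pointwiseLip v x :=
  pointwiseLip_le_of_edist_le' (Eventually.of_forall fun y => by simp)

/-- At a point where `v + m` and the truncation `(c - η)⁺` are locally ordered, the pointwise
Lipschitz constants of their maximum and their minimum add up to at most those of `v` and `c`. -/
theorem pointwiseLip_max_add_pointwiseLip_min_le {X : Type*} [MetricSpace X] {v c : X → ℝ} {x : X}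
    (hv : ContinuousAt v x) (hc : ContinuousAt c x) {m η : ℝ} (hvm : ∀ y, -m ≤ v y)
    (h1 : c x ≠ η) (h2 : c x - v x - m ≠ η) :
    pointwiseLip (fun y => max (v y + m) (max (c y - η) 0) - m) x +
      pointwiseLip (fun y => min (v y + m) (max (c y - η) 0)) x ≤
        pointwiseLip v x + pointwiseLip c x := by
  have hv0 : ∀ y, 0 ≤ v y + m := fun y => by linarith [hvm y]
  rcases h1.lt_or_gt with h | h
  · have hev : ∀ᶠ y in 𝓝 x, max (c y - η) 0 = 0 := by
      filter_upwards [hc.eventually (gt_mem_nhds h)] with y hy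
      exact max_eq_right (by linarith)
    have e1 : (fun y => max (v y + m) (max (c y - η) 0) - m) =ᶠ[𝓝 x] v := by
      filter_upwards [hev] with y hy
      rw [hy, max_eq_left (hv0 y), add_sub_cancel_right]
    have e2 : (fun y => min (v y + m) (max (c y - η) 0)) =ᶠ[𝓝 x] fun _ => 0 := by
      filter_upwards [hev] with y hy
      rw [hy, min_eq_right (hv0 y)]
    rw [pointwiseLip_congr e1, pointwiseLip_congr e2,
      pointwiseLip_eq_zero (f := fun _ : X => (0 : ℝ)) (Eventually.of_forall fun _ => rfl), add_zero]
    exact le_self_add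
  · have hev : ∀ᶠ y in 𝓝 x, max (c y - η) 0 = c y - η := by
      filter_upwards [hc.eventually (lt_mem_nhds h)] with y hy
      exact max_eq_left (by linarith)
    rcases h2.lt_or_gt with h' | h'
    · have hlt : ∀ᶠ y in 𝓝 x, c y - v y - m < η :=
        (((hc.sub hv).sub_const m).eventually (gt_mem_nhds h'))
      have e1 : (fun y => max (v y + m) (max (c y - η) 0) - m) =ᶠ[𝓝 x] v := by
        filter_upwards [hev, hlt] with y hy hy'
        rw [hy, max_eq_left (by linarith), add_sub_cancel_right]
      have e2 : (fun y => min (v y + m) (max (c y - η) 0)) =ᶠ[𝓝 x] fun y => c y + -η := by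
        filter_upwards [hev, hlt] with y hy hy'
        rw [hy, min_eq_right (by linarith), sub_eq_add_neg]
      rw [pointwiseLip_congr e1, pointwiseLip_congr e2]
      gcongr
      exact pointwiseLip_add_const_le _ _ _
    · have hlt : ∀ᶠ y in 𝓝 x, η < c y - v y - m :=
        (((hc.sub hv).sub_const m).eventually (lt_mem_nhds h'))
      have e1 : (fun y => max (v y + m) (max (c y - η) 0) - m) =ᶠ[𝓝 x] fun y => c y + (-η - m) := by
        filter_upwards [hev, hlt] with y hy hy'
        rw [hy, max_eq_right (by linarith)]
        ring
      have e2 : (fun y => min (v y + m) (max (c y - η) 0)) =ᶠ[𝓝 x] fun y => v y + m := by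
        filter_upwards [hev, hlt] with y hy hy'
        rw [hy, min_eq_left (by linarith)]
      rw [pointwiseLip_congr e1, pointwiseLip_congr e2, add_comm]
      gcongr
      · exact pointwiseLip_add_const_le _ _ _
      · exact pointwiseLip_add_const_le _ _ _

/-- Local ordering can fail only on the tie sets `c = η` and `c - v - m = η`, and a small generic
`η` makes both null. Replacing `c` by `(c - η)⁺`, and not by `c - η`, keeps the function in `L¹`
even when `U` has infinite measure. -/
theorem exists_generic_truncation [BorelSpace X] [SFinite μ] (hU : IsOpen U) {v c : X → ℝ}
    (hv : LocallyLipschitzOn U v) (hc : LocallyLipschitzOn U c)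
    (hc1 : MemLp c 1 (μ.restrict U)) {m : ℝ} (hvm : ∀ y, -m ≤ v y) {ε : ℝ≥0∞} (hε : 0 < ε) :
    ∃ η : ℝ, 0 < η ∧
      eLpNorm (fun x => max (c x - η) 0 - max (c x) 0) 1 (μ.restrict U) ≤ ε ∧
      ∫⁻ x in U, pointwiseLip (fun y => max (v y + m) (max (c y - η) 0) - m) x ∂μ +
        ∫⁻ x in U, pointwiseLip (fun y => min (v y + m) (max (c y - η) 0)) x ∂μ ≤
          ∫⁻ x in U, pointwiseLip v x ∂μ + ∫⁻ x in U, pointwiseLip c x ∂μ := by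
  have hlim : Tendsto (fun η : ℝ => eLpNorm (fun x => max (c x - η) 0 - max (c x) 0) 1
      (μ.restrict U)) (𝓝[>] 0) (𝓝 0) := by
    simp only [eLpNorm_one_eq_lintegral_enorm]
    have hcm := hc1.1.aemeasurable
    have := tendsto_lintegral_filter_of_dominated_convergence' (μ := μ.restrict U)
      (l := 𝓝[>] (0 : ℝ)) (F := fun η x => ‖max (c x - η) 0 - max (c x) 0‖ₑ) (f := fun _ => 0)
      (fun x => ‖c x‖ₑ) (Eventually.of_forall fun η => ?_) ?_ ?_ ?_
    · simpa using this
    · exact (((hcm.sub_const η).max aemeasurable_const).sub (hcm.max aemeasurable_const)).enorm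
    · filter_upwards [self_mem_nhdsWithin] with η hη
      have hη' : 0 < η := hη
      refine ae_of_all _ fun x => ?_
      rw [Real.enorm_eq_ofReal_abs, Real.enorm_eq_ofReal_abs]
      refine ENNReal.ofReal_le_ofReal ?_
      grind
    · exact (eLpNorm_one_eq_lintegral_enorm (f := c) (μ := μ.restrict U) ▸ hc1.2).ne
    · refine ae_of_all _ fun x => ?_
      have hcont : Continuous fun η : ℝ => ‖max (c x - η) 0 - max (c x) 0‖ₑ := by fun_prop
      have := hcont.tendsto 0
      simp only [sub_zero, sub_self, enorm_zero] at this
      exact this.mono_left nhdsWithin_le_nhds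
  obtain ⟨δ, hδ, hδ'⟩ : ∃ δ > (0 : ℝ), ∀ η ∈ Ioo 0 δ,
      eLpNorm (fun x => max (c x - η) 0 - max (c x) 0) 1 (μ.restrict U) ≤ ε := by
    obtain ⟨δ, hδ, h⟩ := mem_nhdsGT_iff_exists_Ioo_subset.1 (hlim.eventually (ge_mem_nhds hε))
    exact ⟨δ, hδ, fun η hη => h hη⟩
  have hvc := hv.continuousOn
  have hcc := hc.continuousOn
  have hvm' : AEMeasurable v (μ.restrict U) := hvc.aemeasurable hU.measurableSet
  have hcm' : AEMeasurable c (μ.restrict U) := hcc.aemeasurable hU.measurableSet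
  -- Only countably many values of a measurable function have level sets of positive measure, so
  -- `(0, δ)` contains an `η` avoiding the bad values of both functions.
  have c1 := Measure.countable_meas_level_set_pos₀ hcm'.nullMeasurable
  have c2 := Measure.countable_meas_level_set_pos₀ ((hcm'.sub hvm').sub_const m).nullMeasurable
  obtain ⟨η, hη, hηmem⟩ := ((c1.union c2).dense_compl ℝ).exists_mem_open isOpen_Ioo
    (nonempty_Ioo.2 hδ)
  rw [mem_compl_iff, mem_union, not_or] at hη
  obtain ⟨n1, n2⟩ := hη
  have z1 : ∀ᵐ x ∂μ.restrict U, c x ≠ η := by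
    rw [ae_iff]; simpa using n1
  have z2 : ∀ᵐ x ∂μ.restrict U, c x - v x - m ≠ η := by
    rw [ae_iff]; simpa using n2
  refine ⟨η, hηmem.1, hδ' η hηmem, ?_⟩
  have hcont1 : ContinuousOn (fun y => max (v y + m) (max (c y - η) 0) - m) U := by fun_prop
  rw [← lintegral_add_left' (aemeasurable_pointwiseLip hU hcont1 μ),
    ← lintegral_add_left' (aemeasurable_pointwiseLip hU hvc μ)]
  refine lintegral_mono_ae ?_
  filter_upwards [z1, z2, ae_restrict_mem hU.measurableSet] with x h1 h2 hx
  exact pointwiseLip_max_add_pointwiseLip_min_le (hvc.continuousAt (hU.mem_nhds hx))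
    (hcc.continuousAt (hU.mem_nhds hx)) hvm h1 h2

theorem LocallyLipschitzOn.max_real {X : Type*} [MetricSpace X] {U : Set X} {f g : X → ℝ}
    (hf : LocallyLipschitzOn U f) (hg : LocallyLipschitzOn U g) :
    LocallyLipschitzOn U fun x => max (f x) (g x) := fun x hx => by
  obtain ⟨K, s, hs, hK⟩ := hf hx
  obtain ⟨L, t, ht, hL⟩ := hg hx
  exact ⟨max K L, s ∩ t, inter_mem hs ht, by
    have := (hK.mono inter_subset_left).to_restrict.max (hL.mono inter_subset_right).to_restrict
    exact lipschitzOnWith_iff_restrict.2 this⟩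

theorem LocallyLipschitzOn.min_real {X : Type*} [MetricSpace X] {U : Set X} {f g : X → ℝ}
    (hf : LocallyLipschitzOn U f) (hg : LocallyLipschitzOn U g) :
    LocallyLipschitzOn U fun x => min (f x) (g x) := fun x hx => by
  obtain ⟨K, s, hs, hK⟩ := hf hx
  obtain ⟨L, t, ht, hL⟩ := hg hx
  exact ⟨max K L, s ∩ t, inter_mem hs ht, by
    have := (hK.mono inter_subset_left).to_restrict.min (hL.mono inter_subset_right).to_restrict
    exact lipschitzOnWith_iff_restrict.2 this⟩

theorem LocallyLipschitzOn.add_const_real {X : Type*} [MetricSpace X] {U : Set X} {f : X → ℝ}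
    (hf : LocallyLipschitzOn U f) (c : ℝ) : LocallyLipschitzOn U fun x => f x + c :=
  hf.comp_lipschitz (φ := fun a : ℝ => a + c) (K := 1)
    (LipschitzWith.of_dist_le_mul fun a b => by simp)

theorem eLpNorm_one_le_add {Ω : Type*} [MeasurableSpace Ω] {ν : Measure Ω} {f g h : Ω → ℝ}
    (hg : AEStronglyMeasurable g ν) (hfgh : ∀ x, |f x| ≤ |g x| + |h x|) :
    eLpNorm f 1 ν ≤ eLpNorm g 1 ν + eLpNorm h 1 ν := by
  simp only [eLpNorm_one_eq_lintegral_enorm]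
  rw [← lintegral_add_left' hg.enorm]
  refine lintegral_mono fun x => ?_
  simp only [Real.enorm_eq_ofReal_abs]
  rw [← ENNReal.ofReal_add (abs_nonneg _) (abs_nonneg _)]
  exact ENNReal.ofReal_le_ofReal (hfgh x)

theorem memLp_one_of_abs_le {Ω : Type*} [MeasurableSpace Ω] {ν : Measure Ω} {f g h : Ω → ℝ}
    (hf : AEStronglyMeasurable f ν) (hg : MemLp g 1 ν) (hh : MemLp h 1 ν)
    (hfgh : ∀ x, |f x| ≤ |g x| + |h x|) : MemLp f 1 ν :=
  ⟨hf, (eLpNorm_one_le_add hg.1 hfgh).trans_lt (ENNReal.add_lt_top.2 ⟨hg.2, hh.2⟩)⟩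

/-- Integrate the pointwise submodularity of the Lipschitz constant along optimal approximations of
`w` and `b`. The shift by `m` makes both functions nonnegative. As `w + m` need not be integrable,
`m` is subtracted again from the maximum, while the minimum lies between `0` and `b`. -/
theorem VAR_max_add_VAR_min_le [BorelSpace X] [SFinite μ] (hU : IsOpen U) {w b : X → ℝ}
    (hw : AEStronglyMeasurable w (μ.restrict U)) {m : ℝ} (hm : 0 ≤ m) (hwm : ∀ x, -m ≤ w x)
    (hb0 : ∀ x, 0 ≤ b x) :
    VAR μ U (fun x => max (w x + m) (b x) - m) + VAR μ U (fun x => min (w x + m) (b x)) ≤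
      VAR μ U w + VAR μ U b := by
  rcases eq_or_ne (VAR μ U w) ∞ with hwt | hwt
  · simp [hwt]
  rcases eq_or_ne (VAR μ U b) ∞ with hbt | hbt
  · simp [hbt]
  obtain ⟨v', hv', hvlim⟩ := exists_isLipApprox_tendsto hwt
  obtain ⟨c, hc, hclim⟩ := exists_isLipApprox_tendsto hbt
  -- Cutting off below at the lower bound `-m` of `w` increases neither the distance to `w` nor the
  -- Lipschitz constant.
  let v : ℕ → X → ℝ := fun n x => max (v' n x) (-m)
  have hvlip : ∀ n, LocallyLipschitzOn U (v n) := fun n =>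
    (hv'.locallyLipschitz n).max_real (LocallyLipschitz.const (-m)).locallyLipschitzOn
  have hvmem : ∀ n, MemLp (v n) 1 (μ.restrict U) := fun n => by
    refine memLp_one_of_abs_le (h := fun _ => 0)
      (((hv'.memLp n).1.aemeasurable.max aemeasurable_const).aestronglyMeasurable)
      (hv'.memLp n) MemLp.zero fun x => ?_
    simp only [v]
    grind
  have hvle : ∀ n x, |v n x - w x| ≤ |v' n x - w x| := fun n x => by
    have := hwm x
    simp only [v]
    grind
  have hpos : ∀ n : ℕ, (0 : ℝ≥0∞) < ((n : ℝ≥0∞) + 1)⁻¹ := fun n => by simp [ENNReal.inv_pos]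
  have hlim0 : Tendsto (fun n : ℕ => ((n : ℝ≥0∞) + 1)⁻¹) atTop (𝓝 0) := by
    have := (tendsto_add_atTop_iff_nat 1).2 ENNReal.tendsto_inv_nat_nhds_zero
    simpa using this
  choose η hη0 hη1 hη2 using fun n : ℕ => exists_generic_truncation hU (hvlip n)
    (hc.locallyLipschitz n) (hc.memLp n) (m := m) (fun y => le_max_right _ _) (hpos n)
  let B : ℕ → X → ℝ := fun n x => max (c n x - η n) 0
  have hBlip : ∀ n, LocallyLipschitzOn U (B n) := fun n => by
    simp only [B, sub_eq_add_neg]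
    exact ((hc.locallyLipschitz n).add_const_real _).max_real
      (LocallyLipschitz.const 0).locallyLipschitzOn
  have hBmem : ∀ n, MemLp (B n) 1 (μ.restrict U) := fun n => by
    refine memLp_one_of_abs_le (h := fun _ => 0)
      ((((hc.memLp n).1.aemeasurable.sub_const _).max aemeasurable_const).aestronglyMeasurable)
      (hc.memLp n) MemLp.zero fun x => ?_
    have := hη0 n
    simp only [B]
    grind
  have hBdist : ∀ n, eLpNorm (fun x => B n x - b x) 1 (μ.restrict U) ≤
      ((n : ℝ≥0∞) + 1)⁻¹ + eLpNorm (c n - b) 1 (μ.restrict U) := fun n => by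
    refine (eLpNorm_one_le_add (g := fun x => max (c n x - η n) 0 - max (c n x) 0)
      (h := c n - b) ?_ fun x => ?_).trans (add_le_add_left (hη1 n) _)
    · have hcm := (hc.memLp n).1.aemeasurable
      exact (((hcm.sub_const _).max aemeasurable_const).sub
        (hcm.max aemeasurable_const)).aestronglyMeasurable
    · have := hb0 x
      simp only [B, Pi.sub_apply]
      grind
  have hvdist : ∀ n, eLpNorm (fun x => v n x - w x) 1 (μ.restrict U) ≤
      eLpNorm (v' n - w) 1 (μ.restrict U) := fun n =>
    eLpNorm_mono fun x => by simpa using hvle n x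
  have hsum : Tendsto (fun n => eLpNorm (fun x => v n x - w x) 1 (μ.restrict U) +
      eLpNorm (fun x => B n x - b x) 1 (μ.restrict U)) atTop (𝓝 0) := by
    refine tendsto_of_tendsto_of_tendsto_of_le_of_le tendsto_const_nhds ?_ (fun _ => zero_le)
      (fun n => add_le_add (hvdist n) (hBdist n))
    simpa using hv'.tendsto.add (hlim0.add hc.tendsto)
  have hvw : ∀ n, AEStronglyMeasurable (fun x => v n x - w x) (μ.restrict U) := fun n =>
    (hvmem n).1.sub hw
  have hP : IsLipApprox μ U (fun x => max (w x + m) (b x) - m)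
      fun n x => max (v n x + m) (B n x) - m := by
    have hl : ∀ n, LocallyLipschitzOn U fun x => max (v n x + m) (B n x) - m := fun n => by
      simp only [sub_eq_add_neg]
      exact (((hvlip n).add_const_real m).max_real (hBlip n)).add_const_real _
    refine ⟨hl, fun n => ?_, ?_⟩
    · refine memLp_one_of_abs_le ((hl n).continuousOn.aestronglyMeasurable hU.measurableSet)
        (hvmem n) (hBmem n) fun x => ?_
      grind
    · refine tendsto_of_tendsto_of_tendsto_of_le_of_le tendsto_const_nhds hsum
        (fun _ => zero_le) fun n => eLpNorm_one_le_add (hvw n) fun x => ?_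
      simp only [Pi.sub_apply]
      grind
  have hQ : IsLipApprox μ U (fun x => min (w x + m) (b x))
      fun n x => min (v n x + m) (B n x) := by
    have hl : ∀ n, LocallyLipschitzOn U fun x => min (v n x + m) (B n x) := fun n =>
      ((hvlip n).add_const_real m).min_real (hBlip n)
    refine ⟨hl, fun n => ?_, ?_⟩
    · refine memLp_one_of_abs_le ((hl n).continuousOn.aestronglyMeasurable hU.measurableSet)
        (hvmem n) (hBmem n) fun x => ?_
      have h1 : -m ≤ v n x := le_max_right _ _
      have h2 : 0 ≤ B n x := le_max_right _ _
      grind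
    · refine tendsto_of_tendsto_of_tendsto_of_le_of_le tendsto_const_nhds hsum
        (fun _ => zero_le) fun n => eLpNorm_one_le_add (hvw n) fun x => ?_
      simp only [Pi.sub_apply]
      grind
  rw [← (hvlim.add hclim).liminf_eq]
  refine (add_le_add (VAR_le_liminf_of_isLipApprox hP) (VAR_le_liminf_of_isLipApprox hQ)).trans
    ((ENNReal.liminf_add_liminf_le _ _).trans (liminf_le_liminf (Eventually.of_forall fun n =>
      (hη2 n).trans ?_)))
  gcongr with x
  refine pointwiseLip_le_of_edist_le' (Eventually.of_forall fun y => ?_)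
  exact (((LipschitzWith.id (α := ℝ)).max_const (-m)) _ _).trans (by simp)

theorem VAR_const_mul_le {h : X → ℝ} (c : ℝ) :
    VAR μ U (fun x => c * h x) ≤ ENNReal.ofReal |c| * VAR μ U h := by
  rcases eq_or_ne c 0 with rfl | hc
  · simp only [zero_mul]
    exact (VAR_zero (μ := μ) (U := U) (V := ℝ)).trans_le zero_le
  rcases eq_or_ne (VAR μ U h) ∞ with ht | ht
  · simp [ht, ENNReal.mul_top, hc]
  obtain ⟨u, hu, hlim⟩ := exists_isLipApprox_tendsto ht
  have hL : IsLipApprox μ U (fun x => c * h x) fun n x => c * u n x := by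
    refine ⟨fun n => (hu.locallyLipschitz n).comp_lipschitz (φ := fun a : ℝ => c * a) (K := ‖c‖₊)
      (LipschitzWith.of_dist_le_mul fun a b => ?_), fun n => (hu.memLp n).const_mul c, ?_⟩
    · rw [Real.dist_eq, Real.dist_eq, ← mul_sub, abs_mul]; simp
    · have := ENNReal.Tendsto.const_mul (a := ‖c‖ₑ) hu.tendsto (Or.inr (by simp))
      rw [mul_zero] at this
      refine this.congr fun n => ?_
      rw [← eLpNorm_const_smul]
      congr 1
      funext x
      simp [mul_sub]
  refine (VAR_le_liminf_of_isLipApprox hL).trans ?_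
  have hlim' := ENNReal.Tendsto.const_mul (a := ENNReal.ofReal |c|) hlim (Or.inr (by simp))
  rw [← hlim'.liminf_eq]
  refine liminf_le_liminf (Eventually.of_forall fun n => ?_)
  rw [← lintegral_const_mul' _ _ ENNReal.ofReal_ne_top]
  refine lintegral_mono fun x => pointwiseLip_le_of_edist_le ENNReal.ofReal_ne_top
    (Eventually.of_forall fun y => le_of_eq ?_)
  rw [edist_dist, edist_dist, Real.dist_eq, Real.dist_eq, ← mul_sub, abs_mul,
    ENNReal.ofReal_mul (abs_nonneg _)]

theorem VAR_const_mul {h : X → ℝ} {c : ℝ} (hc : c ≠ 0) :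
    VAR μ U (fun x => c * h x) = ENNReal.ofReal |c| * VAR μ U h := by
  refine le_antisymm (VAR_const_mul_le c) ?_
  have h1 := VAR_const_mul_le (μ := μ) (U := U) (h := fun x => c * h x) c⁻¹
  simp only [inv_mul_cancel_left₀ hc] at h1
  calc ENNReal.ofReal |c| * VAR μ U h
      ≤ ENNReal.ofReal |c| * (ENNReal.ofReal |c⁻¹| * VAR μ U fun x => c * h x) := by gcongr
    _ = _ := by
      rw [← mul_assoc, ← ENNReal.ofReal_mul (abs_nonneg _), ← abs_mul, mul_inv_cancel₀ hc]
      simp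

/-- Adding a multiple of the characteristic function of a subset of the set where `w` attains its
maximum increases the variation by at most the corresponding multiple of the perimeter. -/
theorem VAR_add_const_mul_le [BorelSpace X] [SFinite μ] (hU : IsOpen U) {w e : X → ℝ}
    (hw : AEStronglyMeasurable w (μ.restrict U)) {m M h : ℝ} (hm : 0 ≤ m) (hM : 0 ≤ M) (hh : 0 < h)
    (hwm : ∀ x, -m ≤ w x)
    (hew : ∀ x, e x = 0 ∨ e x = 1 ∧ w x = M) :
    VAR μ U (fun x => w x + h * e x) ≤ VAR μ U w + ENNReal.ofReal h * VAR μ U e := by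
  rcases eq_or_ne (VAR μ U e) ∞ with ht | ht
  · simp [ht, ENNReal.mul_top, hh]
  have hpos : 0 < M + m + h := by linarith
  -- This height is chosen so that on `e = 1` the maximum, shifted back by `m`, is `M + h`, and the
  -- minimum is `M + m`. Submodularity then reads `VAR (w + h e) + (M + m) VAR e ≤ VAR w + (M + m +
  -- h) VAR e`, from which `(M + m) VAR e` is cancelled.
  have key := VAR_max_add_VAR_min_le hU hw hm hwm (b := fun x => (M + m + h) * e x)
    fun x => by
      rcases hew x with hx | ⟨hx, -⟩ <;> rw [hx]
      · simp
      · linarith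
  have e1 : (fun x => max (w x + m) ((M + m + h) * e x) - m) = fun x => w x + h * e x := by
    funext x
    rcases hew x with hx | ⟨hx, hx'⟩
    · rw [hx, mul_zero, max_eq_left (by linarith [hwm x])]; ring
    · rw [hx, hx', max_eq_right (by linarith)]; ring
  have e2 : (fun x => min (w x + m) ((M + m + h) * e x)) = fun x => (M + m) * e x := by
    funext x
    rcases hew x with hx | ⟨hx, hx'⟩
    · rw [hx, mul_zero, mul_zero, min_eq_right (by linarith [hwm x])]
    · rw [hx, hx', min_eq_left (by linarith)]; ring
  rw [e1, e2, VAR_const_mul hpos.ne', abs_of_pos hpos,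
    ENNReal.ofReal_add (add_nonneg hM hm) hh.le, add_mul] at key
  rcases eq_or_lt_of_le (add_nonneg hM hm) with h0 | h0
  · rw [← h0] at key
    simp only [ENNReal.ofReal_zero, zero_mul, zero_add] at key
    exact le_self_add.trans key
  · rw [VAR_const_mul h0.ne', abs_of_pos h0, ← add_assoc,
      add_right_comm] at key
    exact (ENNReal.add_le_add_iff_right (ENNReal.mul_ne_top ENNReal.ofReal_ne_top ht)).1 key

theorem VAR_add_sum_le [BorelSpace X] [SFinite μ] (hU : IsOpen U) {w : X → ℝ} {e : ℕ → X → ℝ}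
    (hw : AEStronglyMeasurable w (μ.restrict U)) {m h : ℝ} (hm : 0 ≤ m) (hh : 0 < h)
    (hwm : ∀ x, -m ≤ w x) (he : ∀ k, AEStronglyMeasurable (e k) (μ.restrict U))
    (he01 : ∀ k x, e k x = 0 ∨ e k x = 1)
    (hew : ∀ k x, e k x = 1 → w x = 0 ∧ ∀ j < k, e j x = 1) (n : ℕ) :
    VAR μ U (fun x => w x + ∑ k ∈ Finset.range n, h * e k x) ≤
      VAR μ U w + ∑ k ∈ Finset.range n, ENNReal.ofReal h * VAR μ U (e k) := by
  induction n with
  | zero => simp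
  | succ n ih =>
    simp only [Finset.sum_range_succ, ← add_assoc]
    -- The layers are nested and `w` vanishes on them, so on layer `n` the partial sum has the
    -- constant value `n * h`.
    refine (VAR_add_const_mul_le hU (M := n * h) ?_ hm (by positivity) hh ?_ ?_).trans
      (add_le_add_left ih _)
    · exact hw.add (Finset.aestronglyMeasurable_fun_sum _ fun k _ => (he k).const_mul h)
    · intro x
      have : 0 ≤ ∑ k ∈ Finset.range n, h * e k x := Finset.sum_nonneg fun k _ => by
        rcases he01 k x with hx | hx <;> rw [hx] <;> linarith
      linarith [hwm x]
    · intro x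
      refine (he01 n x).imp_right fun hx => ⟨hx, ?_⟩
      obtain ⟨h1, h2⟩ := hew n x hx
      rw [h1, zero_add, Finset.sum_congr rfl fun k hk => by rw [h2 k (Finset.mem_range.1 hk)]]
      simp

end Submodularity

/-! ### Layer sums and translated Riemann sums -/

section RiemannSum

theorem levelIndicator_neg (a t : ℝ) : levelIndicator a (-t) = levelIndicator (-a) t := by
  simp only [levelIndicator, div_neg, neg_div]

theorem levelIndicator_eq_zero_or_one (a t : ℝ) : levelIndicator a t = 0 ∨ levelIndicator a t = 1 := by
  unfold levelIndicator; split_ifs <;> simp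

theorem levelIndicator_eq_one_iff {a t : ℝ} (ht : 0 < t) : levelIndicator a t = 1 ↔ t ≤ a := by
  rw [← one_le_div ht]
  unfold levelIndicator
  split_ifs with h <;> simp [h]

/-- Layer sum of the positive part of `a` with `(n + 1)²` layers of height `1 / (n + 1)`. -/
noncomputable def layerSum (n : ℕ) (s a : ℝ) : ℝ :=
  ∑ k ∈ Finset.range ((n + 1) ^ 2), 1 / ((n : ℝ) + 1) * levelIndicator a ((k + 1 + s) / (n + 1))

/-- The sum counts the sample heights `(k + 1 + s) / (n + 1)` that do not exceed `a`, which a floor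
computes. Starting at `k + 1` keeps every height positive, so the layer sum stays below the positive
part of `a`. -/
theorem layerSum_eq (n : ℕ) {s : ℝ} (hs : 0 ≤ s) (a : ℝ) :
    layerSum n s a = (min ((n + 1) ^ 2) ⌊(n + 1) * a - s⌋₊ : ℕ) / ((n : ℝ) + 1) := by
  have hn : (0 : ℝ) < (n : ℝ) + 1 := by positivity
  have h : ∀ k : ℕ, levelIndicator a ((k + 1 + s) / (n + 1)) =
      if k < ⌊(n + 1) * a - s⌋₊ then 1 else 0 := fun k => by
    have hpos : (0 : ℝ) < (k + 1 + s) / (n + 1) := by positivity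
    have hiff : k < ⌊(n + 1) * a - s⌋₊ ↔ (k + 1 + s) / (n + 1) ≤ a := by
      rw [← Nat.succ_le_iff, Nat.le_floor_iff' (Nat.succ_ne_zero k), div_le_iff₀ hn]
      push_cast
      constructor <;> intro h <;> linarith
    split_ifs with hk
    · exact (levelIndicator_eq_one_iff hpos).2 (hiff.1 hk)
    · exact (levelIndicator_eq_zero_or_one _ _).resolve_right fun h1 =>
        hk (hiff.2 ((levelIndicator_eq_one_iff hpos).1 h1))
  simp only [layerSum, h]
  rw [← Finset.mul_sum, Finset.sum_boole]
  have : Finset.filter (fun k => k < ⌊(n + 1) * a - s⌋₊) (Finset.range ((n + 1) ^ 2)) =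
      Finset.range (min ((n + 1) ^ 2) ⌊(n + 1) * a - s⌋₊) := by
    ext k; simp
  rw [this, Finset.card_range]
  ring

theorem layerSum_nonneg (n : ℕ) {s : ℝ} (hs : 0 ≤ s) (a : ℝ) : 0 ≤ layerSum n s a := by
  rw [layerSum_eq n hs]; positivity

theorem layerSum_le (n : ℕ) {s : ℝ} (hs : 0 ≤ s) (a : ℝ) : layerSum n s a ≤ max a 0 := by
  have hn : (0 : ℝ) < (n : ℝ) + 1 := by positivity
  rw [layerSum_eq n hs, div_le_iff₀ hn]
  rcases le_total 0 ((n + 1) * a - s) with h | h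
  · calc ((min ((n + 1) ^ 2) ⌊(n + 1) * a - s⌋₊ : ℕ) : ℝ) ≤ ⌊(n + 1) * a - s⌋₊ := by
          exact_mod_cast min_le_right _ _
      _ ≤ (n + 1) * a - s := Nat.floor_le h
      _ ≤ a * (n + 1) := by linarith
      _ ≤ max a 0 * (n + 1) := by gcongr; exact le_max_left _ _
  · rw [Nat.floor_of_nonpos h]
    simp only [zero_le, inf_of_le_right, CharP.cast_eq_zero]
    positivity

theorem layerSum_le_card (n : ℕ) {s : ℝ} (hs : 0 ≤ s) (a : ℝ) : layerSum n s a ≤ n + 1 := by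
  have hn : (0 : ℝ) < (n : ℝ) + 1 := by positivity
  rw [layerSum_eq n hs, div_le_iff₀ hn]
  calc ((min ((n + 1) ^ 2) ⌊(n + 1) * a - s⌋₊ : ℕ) : ℝ) ≤ ((n + 1) ^ 2 : ℕ) := by
        exact_mod_cast min_le_left _ _
    _ = _ := by push_cast; ring

/-- With `(n + 1)²` layers the heights reach `n + 1`, so no truncation occurs for such `a`. Of the
error, one `1 / (n + 1)` comes from the floor and one from the translation `s ≤ 1`. -/
theorem sub_le_layerSum {n : ℕ} {s : ℝ} (hs : 0 ≤ s) (hs1 : s ≤ 1) {a : ℝ} (ha : a ≤ n + 1) :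
    a - 2 / ((n : ℝ) + 1) ≤ layerSum n s a := by
  have hn : (0 : ℝ) < (n : ℝ) + 1 := by positivity
  have hfl : ⌊(n + 1) * a - s⌋₊ ≤ (n + 1) ^ 2 := by
    refine Nat.floor_le_of_le ?_
    push_cast
    nlinarith
  rw [layerSum_eq n hs, min_eq_right hfl, le_div_iff₀ hn, sub_mul, div_mul_cancel₀ _ hn.ne']
  have := Nat.lt_floor_add_one ((n + 1) * a - s)
  linarith

theorem abs_layerSum_sub_le (n : ℕ) {s : ℝ} (hs : 0 ≤ s) (a : ℝ) :
    |layerSum n s a - layerSum n s (-a)| ≤ |a| := by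
  have h1 := layerSum_nonneg n hs a
  have h2 := layerSum_nonneg n hs (-a)
  have h3 := layerSum_le n hs a
  have h4 := layerSum_le n hs (-a)
  grind

theorem tendsto_layerSum_sub {s : ℕ → ℝ} (hs : ∀ n, s n ∈ Icc (0 : ℝ) 1) (a : ℝ) :
    Tendsto (fun n => layerSum n (s n) a - layerSum n (s n) (-a)) atTop (𝓝 a) := by
  have hlim : Tendsto (fun n : ℕ => 2 * (1 / ((n : ℝ) + 1))) atTop (𝓝 0) := by
    simpa using tendsto_one_div_add_atTop_nhds_zero_nat.const_mul (2 : ℝ)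
  refine tendsto_iff_dist_tendsto_zero.2 (squeeze_zero' (Eventually.of_forall fun _ => dist_nonneg)
    ?_ hlim)
  obtain ⟨N, hN⟩ := exists_nat_gt |a|
  filter_upwards [eventually_ge_atTop N] with n hn
  have hnN : |a| ≤ (n : ℝ) + 1 := by
    have : (N : ℝ) ≤ n := by exact_mod_cast hn
    linarith
  have e : 2 * (1 / ((n : ℝ) + 1)) = 2 / ((n : ℝ) + 1) := by ring
  have hp : 0 < 2 / ((n : ℝ) + 1) := by positivity
  rw [Real.dist_eq, e]
  have h1 := layerSum_nonneg n (hs n).1 a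
  have h2 := layerSum_nonneg n (hs n).1 (-a)
  have h3 := layerSum_le n (hs n).1 a
  have h4 := layerSum_le n (hs n).1 (-a)
  have h5 := sub_le_layerSum (n := n) (hs n).1 (hs n).2 (a := a) ((le_abs_self a).trans hnN)
  have h6 := sub_le_layerSum (n := n) (hs n).1 (hs n).2 (a := -a) ((neg_le_abs a).trans hnN)
  rcases le_total 0 a with h | h
  · rw [max_eq_left h] at h3
    rw [max_eq_right (by linarith)] at h4
    rw [abs_le]; constructor <;> linarith
  · rw [max_eq_right h] at h3
    rw [max_eq_left (by linarith)] at h4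
    rw [abs_le]; constructor <;> linarith

/-- The unit intervals shifted by `k + 1` are disjoint subsets of the positive half-line. -/
theorem sum_lintegral_Ioc_le (F : ℝ → ℝ≥0∞) (N : ℕ) :
    ∑ k ∈ Finset.range N, ∫⁻ s in Ioc (0 : ℝ) 1, F (k + 1 + s) ≤ ∫⁻ s in Ioi 0, F s := by
  have h : ∀ k : ℕ, ∫⁻ s in Ioc (0 : ℝ) 1, F (k + 1 + s) =
      ∫⁻ s in Ioc ((k : ℝ) + 1) (k + 1 + 1), F s := fun k => by
    rw [← lintegral_indicator measurableSet_Ioc, ← lintegral_indicator measurableSet_Ioc,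
      ← lintegral_add_left_eq_self (μ := volume) ((Ioc ((k : ℝ) + 1) (k + 1 + 1)).indicator F)
        ((k : ℝ) + 1)]
    refine lintegral_congr fun s => ?_
    simp only [indicator_apply, mem_Ioc, lt_add_iff_pos_right, add_le_add_iff_left]
  have hmono : Monotone fun k : ℕ => (k : ℝ) + 1 := fun a b hab => by
    simpa using hab
  simp only [h]
  have hdisj := hmono.pairwise_disjoint_on_Ioc_succ
  rw [← lintegral_biUnion_finset (t := fun k : ℕ => Ioc ((k : ℝ) + 1) (k + 1 + 1))]
  · refine lintegral_mono_set (iUnion₂_subset fun k _ t ht => ?_)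
    have : (0 : ℝ) ≤ k := k.cast_nonneg
    exact lt_of_le_of_lt (by linarith) ht.1
  · intro i _ j _ hij
    have := hdisj hij
    simpa [Function.onFun, Nat.succ_eq_add_one] using this
  · exact fun _ _ => measurableSet_Ioc

theorem lintegral_comp_div_real {F : ℝ → ℝ≥0∞} (hF : Measurable F) {c : ℝ} (hc : 0 < c) :
    ∫⁻ s, F (s / c) = ENNReal.ofReal c * ∫⁻ s, F s := by
  have h := Real.map_volume_mul_left (a := c⁻¹) (inv_ne_zero hc.ne')
  rw [inv_inv, abs_of_pos hc] at h
  calc ∫⁻ s, F (s / c) = ∫⁻ s, F (c⁻¹ * s) := by simp only [div_eq_inv_mul]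
    _ = ∫⁻ s, F s ∂(volume.map (c⁻¹ * ·)) := (lintegral_map hF (measurable_const_mul _)).symm
    _ = _ := by rw [h, lintegral_smul_measure, smul_eq_mul]

/-- Some translate of a Riemann sum is at most the integral. -/
theorem exists_riemannSum_le {F : ℝ → ℝ≥0∞} (hF : Measurable F) (n N : ℕ) :
    ∃ s ∈ Icc (0 : ℝ) 1, ∑ k ∈ Finset.range N, ENNReal.ofReal (1 / ((n : ℝ) + 1)) *
      (F ((k + 1 + s) / (n + 1)) + F (-((k + 1 + s) / (n + 1)))) ≤ ∫⁻ t, F t := by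
  have hn : (0 : ℝ) < (n : ℝ) + 1 := by positivity
  let Φ : ℝ → ℝ≥0∞ := fun s => F (s / (n + 1)) + F (-(s / (n + 1)))
  have hΦ : Measurable Φ := by fun_prop
  let G : ℝ → ℝ≥0∞ := fun s =>
    ∑ k ∈ Finset.range N, ENNReal.ofReal (1 / ((n : ℝ) + 1)) * Φ (k + 1 + s)
  have hG : Measurable G := by fun_prop
  have : IsProbabilityMeasure ((volume : Measure ℝ).restrict (Ioc 0 1)) := ⟨by simp⟩
  -- Average over the translation: on the probability space `(0, 1]` some value of `G` is at most
  -- its mean. Excluding the null complement puts `s` in the interval.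
  obtain ⟨s, hs, hle⟩ := exists_notMem_null_le_lintegral
    (μ := (volume : Measure ℝ).restrict (Ioc 0 1)) (N := (Ioc 0 1)ᶜ) hG.aemeasurable
    (by rw [Measure.restrict_apply measurableSet_Ioc.compl]; simp)
  rw [notMem_compl_iff] at hs
  refine ⟨s, Ioc_subset_Icc_self hs, hle.trans ?_⟩
  have hneg : ∫⁻ s in Ioi (0 : ℝ), F (-(s / (n + 1))) = ∫⁻ s in Iio (0 : ℝ), F (s / (n + 1)) := by
    rw [← lintegral_indicator measurableSet_Ioi, ← lintegral_indicator measurableSet_Iio,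
      ← lintegral_neg_eq_self]
    refine lintegral_congr fun s => ?_
    simp only [indicator_apply, mem_Ioi, mem_Iio, Left.neg_pos_iff, neg_div, neg_neg]
  calc ∫⁻ s in Ioc 0 1, G s
      = ENNReal.ofReal (1 / ((n : ℝ) + 1)) *
          ∑ k ∈ Finset.range N, ∫⁻ s in Ioc (0 : ℝ) 1, Φ (k + 1 + s) := by
        simp only [G]
        rw [lintegral_finsetSum _ fun k _ => by fun_prop, Finset.mul_sum]
        refine Finset.sum_congr rfl fun k _ => ?_
        rw [lintegral_const_mul _ (by fun_prop)]
    _ ≤ ENNReal.ofReal (1 / ((n : ℝ) + 1)) * ∫⁻ s in Ioi 0, Φ s := by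
        gcongr; exact sum_lintegral_Ioc_le Φ N
    _ ≤ ENNReal.ofReal (1 / ((n : ℝ) + 1)) * ∫⁻ s, F (s / (n + 1)) := by
        gcongr ENNReal.ofReal (1 / ((n : ℝ) + 1)) * ?_
        rw [lintegral_add_left (by fun_prop), hneg, ← lintegral_union measurableSet_Iio]
        · exact setLIntegral_le_lintegral _ _
        · exact disjoint_left.2 fun x hx hx' => lt_asymm (mem_Ioi.1 hx) (mem_Iio.1 hx')
    _ = ∫⁻ t, F t := by
        rw [lintegral_comp_div_real hF hn, ← mul_assoc, ← ENNReal.ofReal_mul (by positivity),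
          one_div_mul_cancel hn.ne', ENNReal.ofReal_one, one_mul]

end RiemannSum

/-! ### Coarea: the variation is at most the integral of the perimeters -/

section CoareaGe

variable {X : Type*} [MetricSpace X] [MeasurableSpace X] {μ : Measure X} {U : Set X}

theorem VAR_layerSum_sub_le [BorelSpace X] [SFinite μ] (hU : IsOpen U) {u : X → ℝ}
    (hu : AEStronglyMeasurable u (μ.restrict U)) (n : ℕ) {s : ℝ} (hs : 0 ≤ s) :
    VAR μ U (fun x => layerSum n s (u x) - layerSum n s (-u x)) ≤
      ∑ k ∈ Finset.range ((n + 1) ^ 2), ENNReal.ofReal (1 / ((n : ℝ) + 1)) *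
        (VAR μ U (fun x => levelIndicator (u x) ((k + 1 + s) / (n + 1))) +
          VAR μ U (fun x => levelIndicator (u x) (-((k + 1 + s) / (n + 1))))) := by
  have hn : (0 : ℝ) < (n : ℝ) + 1 := by positivity
  have hh : 0 < 1 / ((n : ℝ) + 1) := by positivity
  have hpos : ∀ k : ℕ, (0 : ℝ) < (k + 1 + s) / (n + 1) := fun k => by positivity
  have hmeas : ∀ t, AEStronglyMeasurable (fun x => levelIndicator (u x) t) (μ.restrict U) :=
    fun t => (measurable_levelIndicator.comp_aemeasurable
      (hu.aemeasurable.prodMk measurable_const.aemeasurable)).aestronglyMeasurable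
  have hmono : ∀ (a : ℝ) (k : ℕ), levelIndicator a ((k + 1 + s) / (n + 1)) = 1 →
      0 ≤ a ∧ ∀ j < k, levelIndicator a ((j + 1 + s) / (n + 1)) = 1 := fun a k hk => by
    rw [levelIndicator_eq_one_iff (hpos k)] at hk
    refine ⟨(hpos k).le.trans hk, fun j hj => (levelIndicator_eq_one_iff (hpos j)).2 (le_trans ?_ hk)⟩
    have : (j : ℝ) ≤ k := by exact_mod_cast hj.le
    gcongr
  have hz : ∀ a : ℝ, 0 ≤ a → layerSum n s (-a) = 0 := fun a ha =>
    le_antisymm ((layerSum_le n hs (-a)).trans (by simp [ha])) (layerSum_nonneg n hs _)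
  have hlm : AEStronglyMeasurable (fun x => layerSum n s (u x)) (μ.restrict U) :=
    Finset.aestronglyMeasurable_fun_sum _ fun k _ => (hmeas _).const_mul _
  have h1 := VAR_add_sum_le hU (w := fun _ : X => (0 : ℝ)) (m := 0)
    (e := fun (k : ℕ) x => levelIndicator (u x) ((k + 1 + s) / (n + 1)))
    aestronglyMeasurable_const le_rfl hh (by simp) (fun k => hmeas _)
    (fun k x => levelIndicator_eq_zero_or_one _ _)
    (fun k x hx => ⟨rfl, (hmono _ _ hx).2⟩) ((n + 1) ^ 2)
  -- The negated positive layers serve as a base, bounded below by `-(n + 1)` because there are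
  -- finitely many of them. The layers of `-u` are added on top: they live where `u < 0`, and there
  -- the base vanishes. The overall sign is harmless as `VAR` is even.
  have h2 := VAR_add_sum_le hU (w := fun x => -layerSum n s (u x)) (m := n + 1)
    (e := fun (k : ℕ) x => levelIndicator (u x) (-((k + 1 + s) / (n + 1))))
    hlm.neg hn.le hh (fun x => neg_le_neg (layerSum_le_card n hs _)) (fun k => hmeas _)
    (fun k x => levelIndicator_eq_zero_or_one _ _)
    (fun k x hx => by
      simp only [levelIndicator_neg] at hx ⊢
      refine ⟨?_, (hmono _ _ hx).2⟩
      have := hz _ (hmono _ _ hx).1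
      rw [neg_neg] at this
      rw [this, neg_zero]) ((n + 1) ^ 2)
  have hV0 : VAR μ U (fun _ : X => (0 : ℝ)) = 0 := VAR_zero
  simp only [zero_add, hV0] at h1
  have e1 : VAR μ U (fun x => -layerSum n s (u x)) = VAR μ U fun x => layerSum n s (u x) :=
    VAR_neg _
  have e2 : VAR μ U (fun x => layerSum n s (u x) - layerSum n s (-u x)) =
      VAR μ U fun x => -layerSum n s (u x) + layerSum n s (-u x) := by
    rw [← VAR_neg]
    congr 1
    funext x
    simp only [Pi.neg_apply]
    ring
  rw [e1] at h2
  rw [e2]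
  simp only [mul_add, Finset.sum_add_distrib]
  simp only [levelIndicator_neg] at h2 ⊢
  exact h2.trans (add_le_add_left h1 _)

/-- For each `n` the translation `s n` is chosen so that the Riemann sum of perimeters is at most
the integral. The layer sums converge to `u` in `L¹` by dominated convergence, and lower
semicontinuity concludes. -/
theorem VAR_le_lintegral_VAR_levelIndicator [BorelSpace X] [SFinite μ] (hU : IsOpen U) {u : X → ℝ}
    (hu : MemLp u 1 (μ.restrict U)) :
    VAR μ U u ≤ ∫⁻ t, VAR μ U (fun x => levelIndicator (u x) t) := by
  choose s hs hle using fun n : ℕ =>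
    exists_riemannSum_le (measurable_VAR_levelIndicator hu) n ((n + 1) ^ 2)
  have hum := hu.1.aemeasurable
  have hlm : ∀ (n : ℕ), AEMeasurable (fun x => layerSum n (s n) (u x) - layerSum n (s n) (-u x))
      (μ.restrict U) := fun n => by
    have : Measurable (layerSum n (s n)) := Finset.measurable_fun_sum _ fun k _ =>
      (measurable_levelIndicator.comp (measurable_id.prodMk measurable_const)).const_mul _
    exact (this.comp_aemeasurable hum).sub (this.comp_aemeasurable hum.neg)
  have hlim : Tendsto (fun n => eLpNorm
      ((fun x => layerSum n (s n) (u x) - layerSum n (s n) (-u x)) - u) 1 (μ.restrict U))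
      atTop (𝓝 0) := by
    simp only [eLpNorm_one_eq_lintegral_enorm]
    have := tendsto_lintegral_of_dominated_convergence' (μ := μ.restrict U)
      (F := fun n x => ‖layerSum n (s n) (u x) - layerSum n (s n) (-u x) - u x‖ₑ)
      (f := fun _ => 0) (fun x => 2 * ‖u x‖ₑ) (fun n => ((hlm n).sub hum).enorm) ?_ ?_ ?_
    · simpa using this
    · refine fun n => ae_of_all _ fun x => ?_
      simp only [Real.enorm_eq_ofReal_abs]
      rw [← ENNReal.ofReal_ofNat, ← ENNReal.ofReal_mul (by norm_num)]
      refine ENNReal.ofReal_le_ofReal ((abs_sub _ _).trans ?_)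
      linarith [abs_layerSum_sub_le n (hs n).1 (u x)]
    · rw [lintegral_const_mul'' _ hum.enorm, ← eLpNorm_one_eq_lintegral_enorm]
      exact ENNReal.mul_ne_top (by simp) hu.2.ne
    · refine ae_of_all _ fun x => ?_
      have := ((tendsto_layerSum_sub hs (u x)).sub_const (u x)).enorm
      simpa using this
  refine (VAR_le_liminf hu.1 (fun n => (hlm n).aestronglyMeasurable) hlim).trans ?_
  refine liminf_le_of_frequently_le' (Eventually.frequently (Eventually.of_forall fun n => ?_))
  exact (VAR_layerSum_sub_le hU hu.1 n (hs n).1).trans (hle n)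

/-- The coarea formula. -/
theorem lintegral_PER_Slice [BorelSpace X] [SFinite μ] (hU : IsOpen U)
    (u : Lp ℝ 1 (μ.restrict U)) : ∫⁻ t, PER μ U (Slice (u, t)) = VAR μ U u := by
  simp only [PER_Slice]
  exact le_antisymm (lintegral_VAR_levelIndicator_le hU (Lp.memLp u))
    (VAR_le_lintegral_VAR_levelIndicator hU (Lp.memLp u))

end CoareaGe

/-! ### Upper gradients of distance functions of vector-valued maps -/

section UpperGradient

variable {X V : Type*} [MetricSpace X] [NormedAddCommGroup V]

theorem HasUnitSpeedOn.lipschitzOnWith {c : ℝ → X} {s : Set ℝ} (hc : HasUnitSpeedOn c s) :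
    LipschitzOnWith 1 c s := by
  have key : ∀ a ∈ s, ∀ b ∈ s, a ≤ b → edist (c a) (c b) ≤ edist a b := by
    intro a ha b hb hab
    have h := hc ha hb
    have h2 : edist (c a) (c b) ≤ eVariationOn c (s ∩ Icc a b) :=
      eVariationOn.edist_le c ⟨ha, left_mem_Icc.2 hab⟩ ⟨hb, right_mem_Icc.2 hab⟩
    rw [h] at h2
    refine h2.trans (le_of_eq ?_)
    rw [edist_comm, edist_dist, Real.dist_eq, abs_of_nonneg (by linarith)]
    simp
  intro a ha b hb
  rw [ENNReal.coe_one, one_mul]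
  rcases le_total a b with h | h
  · exact key a ha b hb h
  · rw [edist_comm, edist_comm a]; exact key b hb a ha h

/-- For `θ < 1` the point `c (t + θ r)` lies in the open ball of radius `r` about `c t`, so the
supremum at radius `r` dominates a quotient tending to `θ |h' t|`. This limit exists along all `r →
0`, hence bounds the liminf; then let `θ → 1`. -/
theorem enorm_deriv_le_pointwiseLip {f : X → V} {p : V} {c : ℝ → X} {s : Set ℝ} {t : ℝ}
    (hs : s ∈ 𝓝 t) (hc : LipschitzOnWith 1 c s) :
    ‖deriv (fun t => ‖f (c t) - p‖) t‖ₑ ≤ pointwiseLip f (c t) := by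
  by_cases hd : DifferentiableAt ℝ (fun t => ‖f (c t) - p‖) t
  swap
  · simp [deriv_zero_of_not_differentiableAt hd]
  set h := fun t => ‖f (c t) - p‖ with hh
  have key : ∀ θ : ℝ, 0 < θ → θ < 1 → ENNReal.ofReal θ * ‖deriv h t‖ₑ ≤ pointwiseLip f (c t) := by
    intro θ hθ0 hθ1
    have hder : Tendsto (fun r : ℝ => ‖h (t + θ * r) - h t‖ₑ / ENNReal.ofReal r) (𝓝[>] 0)
        (𝓝 (ENNReal.ofReal θ * ‖deriv h t‖ₑ)) := by
      have h1 : HasDerivAt (fun r : ℝ => h (t + θ * r)) (deriv h t * θ) 0 := by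
        have h2 : HasDerivAt (fun r : ℝ => t + θ * r) θ 0 := by
          simpa using ((hasDerivAt_id (0 : ℝ)).const_mul θ).const_add t
        have h3 : HasDerivAt h (deriv h t) (t + θ * 0) := by simpa using hd.hasDerivAt
        exact h3.comp (0 : ℝ) h2
      have h4 := (hasDerivAt_iff_tendsto_slope.1 h1).mono_left
        (nhdsWithin_mono (0 : ℝ) (fun r (hr : 0 < r) => hr.ne'))
      have h5 := h4.enorm
      rw [enorm_mul, mul_comm, Real.enorm_of_nonneg hθ0.le] at h5
      refine h5.congr' ?_
      filter_upwards [self_mem_nhdsWithin] with r hr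
      have hr' : 0 < r := hr
      rw [slope_def_field, sub_zero, mul_zero, add_zero, div_eq_mul_inv, enorm_mul,
        enorm_inv hr'.ne', Real.enorm_of_nonneg hr'.le, div_eq_mul_inv]
    rw [← hder.liminf_eq]
    refine liminf_le_liminf ?_
    have hev : ∀ᶠ r : ℝ in 𝓝[>] 0, t + θ * r ∈ s := by
      have hcont : ContinuousAt (fun r : ℝ => t + θ * r) 0 := by fun_prop
      exact nhdsWithin_le_nhds (hcont.eventually_mem (by simpa using hs))
    filter_upwards [hev, self_mem_nhdsWithin] with r hr hr0
    have hr0' : 0 < r := hr0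
    have hmem : c (t + θ * r) ∈ Metric.ball (c t) r := by
      have := hc.dist_le_mul _ hr _ (mem_of_mem_nhds hs)
      rw [Metric.mem_ball]
      refine this.trans_lt ?_
      rw [Real.dist_eq, add_sub_cancel_left, abs_of_pos (by positivity)]
      simp only [NNReal.coe_one, one_mul]
      nlinarith
    refine le_iSup₂_of_le _ hmem ?_
    gcongr
    rw [edist_comm, edist_eq_enorm_sub, ← ofReal_norm, ← ofReal_norm]
    refine ENNReal.ofReal_le_ofReal ?_
    rw [Real.norm_eq_abs]
    refine (abs_norm_sub_norm_le _ _).trans ?_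
    simp
  have hlim : Tendsto (fun θ : ℝ => ENNReal.ofReal θ * ‖deriv h t‖ₑ) (𝓝[<] 1)
      (𝓝 (ENNReal.ofReal 1 * ‖deriv h t‖ₑ)) :=
    ENNReal.Tendsto.mul_const ((ENNReal.continuous_ofReal.tendsto 1).mono_left nhdsWithin_le_nhds)
      (Or.inl (by simp))
  rw [ENNReal.ofReal_one, one_mul] at hlim
  refine le_of_tendsto hlim ?_
  filter_upwards [Ioo_mem_nhdsLT (zero_lt_one (α := ℝ))] with θ hθ
  exact key θ hθ.1 hθ.2

/-- The function must be extended from a ball in `U` to all of `X`. With gradient `∞` off the open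
ball, a curve spending positive time there satisfies the inequality trivially. Any other curve of
positive length stays in the closed ball by continuity, where the function along it is Lipschitz,
hence absolutely continuous. -/
theorem isUpperGradient_norm_sub [MeasurableSpace X] [BorelSpace X] {U : Set X}
    {f : X → V} (hf : LocallyLipschitzOn U f) (p : V) {G : X → ℝ≥0∞} (hG : Measurable G)
    (hfG : EqOn (pointwiseLip f) G U) {x : X} {s : ℝ} (hs : Metric.closedBall x s ⊆ U) :
    open scoped Classical in
    IsUpperGradient ((Metric.closedBall x s).indicator fun z => ‖f z - p‖)
      (fun z => if z ∈ Metric.ball x s then G z else ∞) := by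
  classical
  set ρ : X → ℝ≥0∞ := fun z => if z ∈ Metric.ball x s then G z else ∞ with hρ
  have hρm : Measurable ρ := Measurable.ite measurableSet_ball hG measurable_const
  refine ⟨by convert! hρm, fun l c hl hc => ?_⟩
  have hc1 := hc.lipschitzOnWith
  have hcm : AEMeasurable c (volume.restrict (Icc 0 l)) :=
    hc1.continuousOn.aemeasurable measurableSet_Icc
  have hint : (∫⁻ t in Icc 0 l, ρ (c t)) = ∞ ∨ (∫⁻ t in Icc 0 l, ρ (c t)) ≠ ∞ := eq_or_ne _ _
  suffices ENNReal.ofReal |((Metric.closedBall x s).indicator fun z => ‖f z - p‖) (c l) -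
      ((Metric.closedBall x s).indicator fun z => ‖f z - p‖) (c 0)| ≤
      ∫⁻ t in Icc 0 l, ρ (c t) by convert! this
  rcases hint with htop | htop
  · rw [htop]; exact le_top
  rcases hl.eq_or_lt with rfl | hl
  · simp
  have hae : ∀ᵐ t ∂volume.restrict (Icc 0 l), c t ∈ Metric.ball x s := by
    filter_upwards [ae_lt_top' (hρm.comp_aemeasurable hcm) htop] with t ht
    by_contra hn
    simp only [hρ, Function.comp_apply, hn, if_false, lt_self_iff_false] at ht
  have hcl : ∀ t ∈ Icc 0 l, c t ∈ Metric.closedBall x s := by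
    intro t ht
    by_contra hn
    obtain ⟨W, hW, hWc⟩ := mem_nhdsWithin_iff_exists_mem_nhds_inter.1
      (hc1.continuousOn t ht (Metric.isClosed_closedBall.isOpen_compl.mem_nhds hn))
    obtain ⟨δ, hδ, hb⟩ := Metric.mem_nhds_iff.1 hW
    have hlt : max 0 (t - δ) < min l (t + δ) := by
      rw [max_lt_iff, lt_min_iff, lt_min_iff]
      exact ⟨⟨hl, by linarith [ht.1]⟩, by linarith [ht.2], by linarith⟩
    have hnull := ae_iff.1 hae
    -- A single time outside the closed ball would force a whole interval of times outside the open
    -- ball, contradicting that such times form a null set.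
    have hsub : Ioo (max 0 (t - δ)) (min l (t + δ)) ⊆ {a | ¬c a ∈ Metric.ball x s} ∩ Icc 0 l := by
      intro a ha
      have h1 := max_lt_iff.1 ha.1
      have h2 := lt_min_iff.1 ha.2
      have haI : a ∈ Icc 0 l := ⟨h1.1.le, h2.1.le⟩
      refine ⟨fun hmem => ?_, haI⟩
      have haW : a ∈ W := hb (by
        rw [Metric.mem_ball, Real.dist_eq, abs_lt]; constructor <;> linarith)
      exact hWc ⟨haW, haI⟩ (Metric.ball_subset_closedBall hmem)
    rw [Measure.restrict_apply₀' measurableSet_Icc.nullMeasurableSet] at hnull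
    have := measure_mono_null hsub hnull
    rw [Real.volume_Ioo, ENNReal.ofReal_eq_zero] at this
    linarith
  have hlipc : LocallyLipschitzOn (Icc 0 l) fun t => ‖f (c t) - p‖ := by
    intro t ht
    obtain ⟨K, N, hN, hK⟩ := hf (hs (hcl t ht))
    refine ⟨1 * (K * 1), Icc 0 l ∩ c ⁻¹' N, ?_, ?_⟩
    · refine inter_mem self_mem_nhdsWithin ?_
      exact tendsto_nhdsWithin_of_tendsto_nhds_of_eventually_within c (hc1.continuousOn t ht)
        (eventually_of_mem self_mem_nhdsWithin fun a ha => hs (hcl a ha)) hN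
    · have h1 : LipschitzOnWith (K * 1) (fun t => f (c t)) (Icc 0 l ∩ c ⁻¹' N) :=
        hK.comp (hc1.mono inter_subset_left) fun a ha => ha.2
      have h2 : LipschitzWith 1 fun v : V => ‖v - p‖ :=
        LipschitzWith.of_dist_le_mul fun a b => by
          rw [Real.dist_eq, NNReal.coe_one, one_mul, dist_eq_norm]
          refine (abs_norm_sub_norm_le _ _).trans (by simp)
      exact h2.comp_lipschitzOnWith h1
  obtain ⟨K, hK⟩ := hlipc.exists_lipschitzOnWith_of_compact isCompact_Icc
  have hac : AbsolutelyContinuousOnInterval (fun t => ‖f (c t) - p‖) 0 l :=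
    (by rwa [uIcc_of_le hl.le] : LipschitzOnWith K _ (uIcc 0 l)).absolutelyContinuousOnInterval
  rw [indicator_of_mem (hcl l (right_mem_Icc.2 hl.le)), indicator_of_mem
    (hcl 0 (left_mem_Icc.2 hl.le)), ← hac.integral_deriv_eq_sub,
    intervalIntegral.integral_of_le hl.le, ← Real.enorm_eq_ofReal_abs]
  refine (enorm_integral_le_lintegral_enorm _).trans ?_
  rw [← restrict_Ioo_eq_restrict_Ioc, restrict_Ioo_eq_restrict_Icc]
  have hIoo : ∀ᵐ t ∂volume.restrict (Icc 0 l), t ∈ Ioo 0 l := by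
    rw [← restrict_Ioo_eq_restrict_Icc]; exact ae_restrict_mem measurableSet_Ioo
  refine lintegral_mono_ae ?_
  filter_upwards [hae, hIoo] with t ht htI
  simp only [hρ, ht, if_true]
  rw [← hfG (hs (Metric.ball_subset_closedBall ht))]
  exact enorm_deriv_le_pointwiseLip (Icc_mem_nhds htI.1 htI.2) hc1

end UpperGradient

/-! ### Uniform constants and scale functions -/

section Constants

/-- Uniform constants for the doubling condition and the Poincaré inequality on bounded scales. -/
structure PIConstants {X : Type*} [MetricSpace X] [MeasurableSpace X] (μ : Measure X)
    (Λ : ℝ) (m : ℕ) (β τ : ℝ≥0) : Prop where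
  one_le : 1 ≤ Λ
  le_two_pow : 4 * Λ ≤ 2 ^ m
  ball_pos : ∀ (x : X) (r : ℝ), 0 < r → 0 < μ (Metric.ball x r)
  ball_lt_top : ∀ (x : X) (r : ℝ), μ (Metric.ball x r) < ∞
  doubling : ∀ (x : X) (r : ℝ), 0 < r → r ≤ 2 ^ (m + 1) →
    μ (Metric.ball x (2 * r)) ≤ β * μ (Metric.ball x r)
  poincare : ∀ (f : X → ℝ) (g : X → ℝ≥0∞), LocallyIntegrable f μ → IsUpperGradient f g →
    ∀ (x : X) (r : ℝ), 0 < r → r ≤ 2 →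
      ∫⁻ z in Metric.ball x r, ENNReal.ofReal |f z - ⨍ w in Metric.ball x r, f w ∂μ| ∂μ ≤
        ENNReal.ofReal r * τ * ∫⁻ z in Metric.ball x (Λ * r), g z ∂μ

theorem IsPISpace.exists_constants {X : Type*} [MetricSpace X] [MeasurableSpace X] {μ : Measure X}
    (hμ : IsPISpace μ) : ∃ (Λ : ℝ) (m : ℕ) (β τ : ℝ≥0), PIConstants μ Λ m β τ := by
  obtain ⟨Λ, hΛ, hP⟩ := hμ.poincare
  obtain ⟨m, hm⟩ := pow_unbounded_of_one_lt (4 * Λ) one_lt_two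
  obtain ⟨β, hβ⟩ := hμ.doubling (2 ^ (m + 1)) (by positivity)
  obtain ⟨τ, hτ⟩ := hP 2 two_pos
  exact ⟨Λ, m, β, τ, hΛ, hm.le, hμ.ball_pos, hμ.ball_lt_top, hβ, hτ⟩

theorem PIConstants.ball_two_pow_le {X : Type*} [MetricSpace X] [MeasurableSpace X] {μ : Measure X}
    {Λ : ℝ} {m : ℕ} {β τ : ℝ≥0} (h : PIConstants μ Λ m β τ) (x : X) {r : ℝ} (hr : 0 < r)
    (hr2 : r ≤ 2) {k : ℕ} (hk : k ≤ m) :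
    μ (Metric.ball x (2 ^ k * r)) ≤ β ^ k * μ (Metric.ball x r) := by
  induction k with
  | zero => simp
  | succ k ih =>
    have h1 : (2 : ℝ) ^ k * r ≤ 2 ^ (m + 1) := by
      have : (2 : ℝ) ^ k ≤ 2 ^ m := pow_le_pow_right₀ one_le_two (by omega)
      rw [pow_succ]
      gcongr
    calc μ (Metric.ball x (2 ^ (k + 1) * r)) = μ (Metric.ball x (2 * (2 ^ k * r))) := by
          rw [pow_succ']; ring_nf
      _ ≤ β * μ (Metric.ball x (2 ^ k * r)) := h.doubling x _ (by positivity) h1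
      _ ≤ β * (β ^ k * μ (Metric.ball x r)) := by gcongr; exact ih (by omega)
      _ = _ := by rw [pow_succ']; ring

/-- A positive function on `U`, slowly varying and small compared with the distance to the
complement of `U`. -/
structure IsScale {X : Type*} [MetricSpace X] (U : Set X) (Λ ε : ℝ) (r : X → ℝ) : Prop where
  pos : ∀ x ∈ U, 0 < r x
  le : ∀ x, r x ≤ ε
  le_one : ∀ x, r x ≤ 1
  lipschitz : ∀ x y, |r x - r y| ≤ dist x y / (8 * Λ)
  closedBall_subset : ∀ x ∈ U, Metric.closedBall x (4 * Λ * r x) ⊆ U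

/-- Take the minimum of `ε`, `1` and `1 / (8Λ)` times the distance to the complement. The last term
gives the slow variation and keeps balls of radius `4Λ r x` inside `U`. -/
theorem exists_isScale {X : Type*} [MetricSpace X] {U : Set X} (hU : IsOpen U) {Λ ε : ℝ}
    (hΛ : 1 ≤ Λ) (hε : 0 < ε) : ∃ r, IsScale U Λ ε r := by
  have hΛ0 : 0 < Λ := by linarith
  -- The case `U = univ` is separate because `Metric.infDist` to the empty set is `0` by convention.
  rcases eq_or_ne U univ with rfl | hne
  · refine ⟨fun _ => min ε 1, fun _ _ => by positivity, fun _ => min_le_left _ _,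
      fun _ => min_le_right _ _, fun x y => ?_, fun _ _ => subset_univ _⟩
    rw [sub_self, abs_zero]; positivity
  have hne' : (Uᶜ).Nonempty := nonempty_compl.2 hne
  refine ⟨fun x => min (min ε 1) (Metric.infDist x Uᶜ / (8 * Λ)), fun x hx => ?_,
    fun _ => (min_le_left _ _).trans (min_le_left _ _),
    fun _ => (min_le_left _ _).trans (min_le_right _ _), fun x y => ?_, fun x hx y hy => ?_⟩
  · have : 0 < Metric.infDist x Uᶜ :=
      (hU.isClosed_compl.notMem_iff_infDist_pos hne').1 (by simpa using hx)
    positivity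
  · have h1 : LipschitzWith 1 fun x => Metric.infDist x Uᶜ := Metric.lipschitz_infDist_pt _
    have h2 := h1.dist_le_mul x y
    rw [Real.dist_eq, NNReal.coe_one, one_mul] at h2
    refine (abs_min_sub_min_le_max _ _ _ _).trans ?_
    rw [sub_self, abs_zero, ← sub_div, abs_div, abs_of_pos (a := 8 * Λ) (by positivity)]
    refine max_le (by positivity) ?_
    gcongr
  · by_contra hn
    have h1 : Metric.infDist x Uᶜ ≤ dist x y := Metric.infDist_le_dist_of_mem hn
    have h2 : min (min ε 1) (Metric.infDist x Uᶜ / (8 * Λ)) ≤ Metric.infDist x Uᶜ / (8 * Λ) :=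
      min_le_right _ _
    have h4 : 0 < Metric.infDist x Uᶜ :=
      (hU.isClosed_compl.notMem_iff_infDist_pos hne').1 (by simpa using hx)
    have h3 : 4 * Λ * (min (min ε 1) (Metric.infDist x Uᶜ / (8 * Λ))) ≤ Metric.infDist x Uᶜ / 2 := by
      calc _ ≤ 4 * Λ * (Metric.infDist x Uᶜ / (8 * Λ)) := by gcongr
        _ = _ := by field_simp; norm_num
    have h5 := Metric.mem_closedBall'.1 hy
    linarith

theorem IsScale.continuous {X : Type*} [MetricSpace X] {U : Set X} {Λ ε : ℝ} {r : X → ℝ}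
    (hr : IsScale U Λ ε r) (hΛ : 1 ≤ Λ) : Continuous r := by
  have : LipschitzWith 1 r := LipschitzWith.of_dist_le_mul fun x y => by
    rw [Real.dist_eq, NNReal.coe_one, one_mul]
    refine (hr.lipschitz x y).trans (div_le_self dist_nonneg (by linarith))
  exact this.continuous

end Constants

/-! ### Poincaré inequality for vector-valued maps and telescoping -/

section Telescoping

variable {X V : Type*} [MetricSpace X] [MeasurableSpace X] [BorelSpace X] [NormedAddCommGroup V]
  {μ : Measure X} {U : Set X} {Λ : ℝ} {m : ℕ} {β τ : ℝ≥0}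

/-- Only the scalar Poincaré inequality is assumed, so it is applied to `‖f - f x‖`, whose upper
gradient on the ball is the pointwise Lipschitz constant of `f`. The number `a` is the mean of this
function. -/
theorem PIConstants.poincare_norm_sub (h : PIConstants μ Λ m β τ) (hU : IsOpen U) {f : X → V}
    (hf : LocallyLipschitzOn U f) (hf1 : MemLp f 1 (μ.restrict U)) {x : X} {s : ℝ} (hs0 : 0 < s)
    (hs2 : s ≤ 2) (hsU : Metric.closedBall x (Λ * s) ⊆ U) :
    ∃ a : ℝ, 0 ≤ a ∧
      ENNReal.ofReal a * μ (Metric.ball x s) = ∫⁻ z in Metric.ball x s, ‖f z - f x‖ₑ ∂μ ∧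
      ∫⁻ z in Metric.ball x s, ENNReal.ofReal |‖f z - f x‖ - a| ∂μ ≤
        ENNReal.ofReal s * τ * ∫⁻ z in Metric.ball x (Λ * s), pointwiseLip f z ∂μ := by
  classical
  obtain ⟨G, hG, hfG⟩ := exists_measurable_eqOn_pointwiseLip hU hf.continuousOn
  have hΛ0 : 0 < Λ := by linarith [h.one_le]
  have hle : s ≤ Λ * s := le_mul_of_one_le_left hs0.le h.one_le
  set B := Metric.closedBall x (Λ * s) with hB
  have hBfin : μ B < ∞ := (measure_mono (Metric.closedBall_subset_ball
    (show Λ * s < Λ * s + 1 by linarith))).trans_lt (h.ball_lt_top _ _)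
  have hint : IntegrableOn (fun z => ‖f z - f x‖) B μ := by
    have h1 : IntegrableOn f B μ := (memLp_one_iff_integrable.1 hf1).mono_measure
      (Measure.restrict_mono hsU le_rfl)
    exact (h1.sub (integrableOn_const hBfin.ne)).norm
  have hbB : Metric.ball x s ⊆ B :=
    (Metric.ball_subset_ball hle).trans Metric.ball_subset_closedBall
  set u := B.indicator fun z => ‖f z - f x‖ with hu
  have hui : Integrable u μ := (integrable_indicator_iff Metric.isClosed_closedBall.measurableSet).2 hint
  have hug := isUpperGradient_norm_sub hf (f x) hG hfG hsU
  have key := h.poincare u _ hui.locallyIntegrable hug x s hs0 hs2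
  have hint' : IntegrableOn (fun z => ‖f z - f x‖) (Metric.ball x s) μ := hint.mono_set hbB
  have havg : ⨍ w in Metric.ball x s, u w ∂μ = ⨍ w in Metric.ball x s, ‖f w - f x‖ ∂μ :=
    setAverage_congr_fun measurableSet_ball
      (ae_of_all _ fun z hz => indicator_of_mem (hbB hz) _)
  rw [havg] at key
  refine ⟨⨍ w in Metric.ball x s, ‖f w - f x‖ ∂μ, ?_, ?_, ?_⟩
  · rw [setAverage_eq]
    exact smul_nonneg (by positivity) (integral_nonneg fun _ => norm_nonneg _)
  · have h0 : μ (Metric.ball x s) ≠ 0 := (h.ball_pos x s hs0).ne'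
    have ht : μ (Metric.ball x s) ≠ ∞ := (h.ball_lt_top x s).ne
    have := ofReal_integral_norm_eq_lintegral_enorm (μ := μ.restrict (Metric.ball x s)) hint'
    simp only [norm_norm, enorm_norm] at this
    rw [setAverage_eq, smul_eq_mul, ENNReal.ofReal_mul (by positivity), ← this, measureReal_def,
      ENNReal.ofReal_inv_of_pos (ENNReal.toReal_pos h0 ht), ENNReal.ofReal_toReal ht, mul_right_comm,
      ENNReal.inv_mul_cancel h0 ht, one_mul]
  · calc _ = ∫⁻ z in Metric.ball x s, ENNReal.ofReal
          |u z - ⨍ w in Metric.ball x s, ‖f w - f x‖ ∂μ| ∂μ := by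
          refine setLIntegral_congr_fun measurableSet_ball fun z hz => ?_
          simp only [hu, indicator_of_mem (hbB hz)]
      _ ≤ _ := key
      _ = _ := by
        congr 1
        refine setLIntegral_congr_fun measurableSet_ball fun z hz => ?_
        simp only [hz, if_true]
        exact (hfG (hsU (Metric.ball_subset_closedBall hz))).symm

/-- The means `a k` of `‖f - f x‖` over the balls of radius `s / 2 ^ k` tend to `0` by continuity at
`x`. Consecutive means differ by a Poincaré term, up to one doubling. The series is kept as it
stands because its terms are later integrated in `x` one by one. -/
theorem PIConstants.lintegral_norm_sub_le (h : PIConstants μ Λ m β τ) (hU : IsOpen U) {f : X → V}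
    (hf : LocallyLipschitzOn U f) (hf1 : MemLp f 1 (μ.restrict U)) {x : X} {s : ℝ} (hs0 : 0 < s)
    (hs2 : s ≤ 2) (hsU : Metric.closedBall x (Λ * s) ⊆ U) :
    (μ (Metric.ball x s))⁻¹ * ∫⁻ z in Metric.ball x s, ‖f z - f x‖ₑ ∂μ ≤
      ∑' k : ℕ, ENNReal.ofReal (s / 2 ^ k) * τ * β * ((μ (Metric.ball x (s / 2 ^ k)))⁻¹ *
        ∫⁻ z in Metric.ball x (Λ * (s / 2 ^ k)), pointwiseLip f z ∂μ) := by
  have hΛ0 : 0 < Λ := by linarith [h.one_le]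
  have hpos : ∀ k : ℕ, 0 < s / 2 ^ k := fun k => by positivity
  have hle : ∀ k : ℕ, s / 2 ^ k ≤ s := fun k =>
    div_le_self hs0.le (one_le_pow₀ one_le_two)
  let B : ℕ → Set X := fun k => Metric.ball x (s / 2 ^ k)
  have hB0 : ∀ k, μ (B k) ≠ 0 := fun k => (h.ball_pos x _ (hpos k)).ne'
  have hBt : ∀ k, μ (B k) ≠ ∞ := fun k => (h.ball_lt_top x _).ne
  choose a ha0 ha1 ha2 using fun k => h.poincare_norm_sub hU hf hf1 (hpos k) ((hle k).trans hs2)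
    ((Metric.closedBall_subset_closedBall (by gcongr; exact hle k)).trans hsU)
  have hxU : x ∈ U := hsU (Metric.mem_closedBall_self (by positivity))
  have hstep : ∀ k, ENNReal.ofReal (a k) ≤ ENNReal.ofReal (a (k + 1)) +
      ENNReal.ofReal (s / 2 ^ k) * τ * β * ((μ (B k))⁻¹ *
        ∫⁻ z in Metric.ball x (Λ * (s / 2 ^ k)), pointwiseLip f z ∂μ) := fun k => by
    have hsub : B (k + 1) ⊆ B k := Metric.ball_subset_ball
      (div_le_div_of_nonneg_left hs0.le (by positivity) (pow_le_pow_right₀ one_le_two (Nat.le_succ k)))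
    have hdbl : μ (B k) ≤ β * μ (B (k + 1)) := by
      have e : s / 2 ^ k = 2 * (s / 2 ^ (k + 1)) := by rw [pow_succ]; field_simp
      simp only [B]
      rw [e]
      refine h.doubling x _ (hpos _) ((hle _).trans (hs2.trans ?_))
      rw [pow_succ]
      nlinarith [one_le_pow₀ (one_le_two (α := ℝ)) (n := m)]
    have h1 : ENNReal.ofReal (a k) * μ (B (k + 1)) ≤ ENNReal.ofReal (a (k + 1)) * μ (B (k + 1)) +
        ∫⁻ z in B k, ENNReal.ofReal |‖f z - f x‖ - a k| ∂μ := by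
      rw [ha1 (k + 1)]
      calc ENNReal.ofReal (a k) * μ (B (k + 1)) = ∫⁻ z in B (k + 1), ENNReal.ofReal (a k) ∂μ := by
            rw [setLIntegral_const]
        _ ≤ ∫⁻ z in B (k + 1), (‖f z - f x‖ₑ + ENNReal.ofReal |‖f z - f x‖ - a k|) ∂μ := by
            refine lintegral_mono fun z => ?_
            rw [← ofReal_norm, ← ENNReal.ofReal_add (norm_nonneg _) (abs_nonneg _)]
            refine ENNReal.ofReal_le_ofReal ?_
            linarith [neg_abs_le (‖f z - f x‖ - a k)]
        _ = ∫⁻ z in B (k + 1), ‖f z - f x‖ₑ ∂μ +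
              ∫⁻ z in B (k + 1), ENNReal.ofReal |‖f z - f x‖ - a k| ∂μ := by
            refine lintegral_add_left' ?_ _
            have hmem : AEStronglyMeasurable f (μ.restrict (B (k + 1))) :=
              hf1.1.mono_measure (Measure.restrict_mono (Subset.trans (Metric.ball_subset_closedBall)
                ((Metric.closedBall_subset_closedBall ((hle _).trans
                  (le_mul_of_one_le_left hs0.le h.one_le))).trans hsU)) le_rfl)
            exact (hmem.sub aestronglyMeasurable_const).enorm
        _ ≤ _ := by gcongr
    have h2 := (ENNReal.mul_le_iff_le_inv (hB0 (k + 1)) (hBt (k + 1))).1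
      ((mul_comm _ _).trans_le h1)
    refine h2.trans ?_
    rw [mul_add, mul_comm _ (ENNReal.ofReal (a (k + 1)) * _), mul_assoc,
      ENNReal.mul_inv_cancel (hB0 (k + 1)) (hBt (k + 1)), mul_one]
    refine add_le_add le_rfl ?_
    have h3 : (μ (B (k + 1)))⁻¹ ≤ β * (μ (B k))⁻¹ := by
      rw [← div_eq_mul_inv, ENNReal.le_div_iff_mul_le (Or.inl (hB0 k)) (Or.inl (hBt k)), mul_comm,
        ← div_eq_mul_inv]
      exact ENNReal.div_le_of_le_mul hdbl
    calc (μ (B (k + 1)))⁻¹ * ∫⁻ z in B k, ENNReal.ofReal |‖f z - f x‖ - a k| ∂μ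
        ≤ (β * (μ (B k))⁻¹) * (ENNReal.ofReal (s / 2 ^ k) * τ *
          ∫⁻ z in Metric.ball x (Λ * (s / 2 ^ k)), pointwiseLip f z ∂μ) := mul_le_mul' h3 (ha2 k)
      _ = _ := by ring
  have hsum : ∀ n, ENNReal.ofReal (a 0) ≤ ENNReal.ofReal (a n) + ∑ k ∈ Finset.range n,
      ENNReal.ofReal (s / 2 ^ k) * τ * β * ((μ (B k))⁻¹ *
        ∫⁻ z in Metric.ball x (Λ * (s / 2 ^ k)), pointwiseLip f z ∂μ) := by
    intro n
    induction n with
    | zero => simp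
    | succ n ih =>
      rw [Finset.sum_range_succ, add_comm (∑ k ∈ Finset.range n, _), ← add_assoc]
      exact ih.trans (add_le_add_left (hstep n) _)
  have hlim : Tendsto (fun n => ENNReal.ofReal (a n)) atTop (𝓝 0) := by
    refine ENNReal.tendsto_nhds_zero.2 fun ε hε => ?_
    have hcont : ContinuousAt (fun z => ‖f z - f x‖ₑ) x :=
      ((hf.continuousOn.continuousAt (hU.mem_nhds hxU)).sub continuousAt_const).enorm
    have hev : ∀ᶠ z in 𝓝 x, ‖f z - f x‖ₑ < ε := by
      refine hcont.eventually (gt_mem_nhds ?_)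
      simpa using hε
    obtain ⟨δ, hδ, hb⟩ := Metric.eventually_nhds_iff_ball.1 hev
    have hsmall : Tendsto (fun k : ℕ => s / 2 ^ k) atTop (𝓝 0) := by
      have := (tendsto_pow_atTop_nhds_zero_of_lt_one (r := (1 / 2 : ℝ)) (by norm_num)
        (by norm_num)).const_mul s
      simpa [div_eq_mul_inv] using this
    filter_upwards [hsmall.eventually (gt_mem_nhds hδ)] with k hk
    have h1 : ENNReal.ofReal (a k) * μ (B k) ≤ ε * μ (B k) := by
      rw [ha1 k, ← setLIntegral_const]
      exact setLIntegral_mono' measurableSet_ball fun z hz =>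
        (hb z (Metric.ball_subset_ball hk.le hz)).le
    exact (ENNReal.mul_le_mul_iff_left (hB0 k) (hBt k)).1 h1
  have h0 : (μ (Metric.ball x s))⁻¹ * ∫⁻ z in Metric.ball x s, ‖f z - f x‖ₑ ∂μ =
      ENNReal.ofReal (a 0) := by
    have e : Metric.ball x s = B 0 := by simp [B]
    have := ha1 0
    rw [pow_zero, div_one] at this
    rw [← this, e, mul_comm, mul_assoc, ENNReal.mul_inv_cancel (hB0 0) (hBt 0), mul_one]
  rw [h0]
  refine ge_of_tendsto' (b := ENNReal.ofReal (a 0))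
    (f := fun n => ENNReal.ofReal (a n) + ∑' k : ℕ, ENNReal.ofReal (s / 2 ^ k) * τ * β *
      ((μ (B k))⁻¹ * ∫⁻ z in Metric.ball x (Λ * (s / 2 ^ k)), pointwiseLip f z ∂μ))
    (x := atTop) ?_ fun n => (hsum n).trans ?_
  · simpa using hlim.add_const _
  · gcongr
    exact ENNReal.sum_le_tsum _

end Telescoping

/-! ### Nonlocal energies bounded by the variation -/

section Energy

variable {X V : Type*} [MetricSpace X] [MeasurableSpace X] [NormedAddCommGroup V]

/-- The kernel equal to `w x` for `z` in the ball of radius `R x` around `x`. -/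
noncomputable def ballKernel (R : X → ℝ) (w : X → ℝ≥0∞) (x z : X) : ℝ≥0∞ :=
  if dist x z < R x then w x else 0

/-- The nonlocal energy of `f` on `U` associated with the kernel `κ`. -/
noncomputable def nonlocalEnergy {X V : Type*} [MeasurableSpace X] [NormedAddCommGroup V] (μ : Measure X) (U : Set X) (κ : X → X → ℝ≥0∞) (f : X → V) :
    ℝ≥0∞ :=
  ∫⁻ x in U, ∫⁻ z in U, κ x z * ‖f z - f x‖ₑ ∂μ ∂μ

/-- The kernel of difference quotients at scale `r`. -/
noncomputable def scaleKernel (μ : Measure X) (r : X → ℝ) : X → X → ℝ≥0∞ :=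
  ballKernel (fun x => 2 * r x) fun x => (ENNReal.ofReal (r x) * μ (Metric.ball x (r x)))⁻¹

theorem measurable_ballKernel [OpensMeasurableSpace X] [SecondCountableTopology X] {R : X → ℝ}
    {w : X → ℝ≥0∞} (hR : Measurable R) (hw : Measurable w) :
    Measurable (Function.uncurry (ballKernel R w)) :=
  Measurable.ite (measurableSet_lt measurable_dist (hR.comp measurable_fst))
    (hw.comp measurable_fst) measurable_const

theorem measurable_measure_ball [OpensMeasurableSpace X] [SecondCountableTopology X]
    (μ : Measure X) [SFinite μ] {R : X → ℝ} (hR : Measurable R) :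
    Measurable fun x => μ (Metric.ball x (R x)) := by
  have hs : MeasurableSet {p : X × X | dist p.2 p.1 < R p.1} :=
    measurableSet_lt (measurable_snd.dist measurable_fst) (hR.comp measurable_fst)
  exact measurable_measure_prodMk_left hs

theorem measurable_scaleKernel [OpensMeasurableSpace X] [SecondCountableTopology X]
    (μ : Measure X) [SFinite μ] {r : X → ℝ} (hr : Measurable r) :
    Measurable (Function.uncurry (scaleKernel μ r)) :=
  measurable_ballKernel (hr.const_mul 2) (hr.ennreal_ofReal.mul (measurable_measure_ball μ hr)).inv

theorem setLIntegral_ballKernel_mul [OpensMeasurableSpace X] {μ : Measure X} {U : Set X}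
    {R : X → ℝ} {w : X → ℝ≥0∞} {x : X} (hx : Metric.ball x (R x) ⊆ U) (hw : w x ≠ ∞)
    (g : X → ℝ≥0∞) :
    ∫⁻ z in U, ballKernel R w x z * g z ∂μ = w x * ∫⁻ z in Metric.ball x (R x), g z ∂μ := by
  have e : ∀ z, ballKernel R w x z * g z =
      (Metric.ball x (R x)).indicator (fun z => w x * g z) z := fun z => by
    by_cases hd : dist x z < R x
    · rw [indicator_of_mem (Metric.mem_ball'.2 hd), ballKernel, if_pos hd]
    · rw [indicator_of_notMem (fun hz => hd (Metric.mem_ball'.1 hz)), ballKernel, if_neg hd,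
        zero_mul]
  simp only [e]
  rw [setLIntegral_indicator measurableSet_ball, inter_eq_left.2 hx, lintegral_const_mul' _ _ hw]

variable {μ : Measure X} {U : Set X} {Λ : ℝ} {m : ℕ} {β τ : ℝ≥0}

theorem aemeasurable_setLIntegral_mul {X : Type*} [MeasurableSpace X] {μ : Measure X} {U : Set X}
    [SFinite μ] {κ : X → X → ℝ≥0∞}
    (hκ : Measurable (Function.uncurry κ)) {ρ : X → ℝ≥0∞} (hρ : AEMeasurable ρ (μ.restrict U)) :
    AEMeasurable (Function.uncurry fun x z => κ x z * ρ z)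
      ((μ.restrict U).prod (μ.restrict U)) :=
  hκ.aemeasurable.mul hρ.comp_snd

/-- By Tonelli's theorem the kernel need only be integrated in its first variable. For fixed `z`,
the contributing `x` have `σ x` comparable to `σ z`, so they lie in `B(z, 2Λ σ z)`, and the measure
of this ball is at most `β ^ m · μ (B(x, σ x))`. -/
theorem PIConstants.lintegral_ballKernel_le [BorelSpace X] [SecondCountableTopology X] [SFinite μ]
    (h : PIConstants μ Λ m β τ) (hU : IsOpen U) {σ : X → ℝ} (hσ0 : ∀ x ∈ U, 0 < σ x)
    (hσ2 : ∀ x, σ x ≤ 2) (hσL : ∀ x y, |σ x - σ y| ≤ dist x y / (4 * Λ)) (hσm : Measurable σ)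
    {ρ : X → ℝ≥0∞} (hρ : AEMeasurable ρ (μ.restrict U)) :
    ∫⁻ x in U, ∫⁻ z in U, ballKernel (fun x => Λ * σ x)
      (fun x => (μ (Metric.ball x (σ x)))⁻¹) x z * ρ z ∂μ ∂μ ≤ β ^ m * ∫⁻ z in U, ρ z ∂μ := by
  have hΛ := h.one_le
  have hΛ0 : 0 < Λ := by linarith
  set κ := ballKernel (fun x => Λ * σ x) (fun x => (μ (Metric.ball x (σ x)))⁻¹) with hκdef
  have hκ : Measurable (Function.uncurry κ) :=
    measurable_ballKernel (hσm.const_mul _) (measurable_measure_ball μ hσm).inv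
  rw [lintegral_lintegral_swap (aemeasurable_setLIntegral_mul hκ hρ),
    ← lintegral_const_mul'' _ hρ]
  refine setLIntegral_mono' hU.measurableSet fun z hz => ?_
  have hκz : Measurable fun x => κ x z := hκ.comp measurable_prodMk_right
  rw [lintegral_mul_const _ hκz]
  gcongr
  set B := Metric.ball z (2 * Λ * σ z) with hB
  have hσz := hσ0 z hz
  have hB0 : μ B ≠ 0 := (h.ball_pos z _ (by positivity)).ne'
  have hBt : μ B ≠ ∞ := (h.ball_lt_top z _).ne
  calc ∫⁻ x in U, κ x z ∂μ ≤ ∫⁻ x in U, B.indicator (fun _ => β ^ m * (μ B)⁻¹) x ∂μ := by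
        refine setLIntegral_mono' hU.measurableSet fun x hx => ?_
        simp only [hκdef, ballKernel]
        split_ifs with hd
        swap
        · exact zero_le
        have hσx := hσ0 x hx
        have h1 : dist x z / (4 * Λ) ≤ σ x / 4 := by
          rw [div_le_div_iff₀ (by positivity) (by positivity)]
          nlinarith
        have h2 := abs_le.1 ((hσL x z).trans h1)
        have hxB : x ∈ B := by
          rw [hB, Metric.mem_ball]
          nlinarith
        rw [indicator_of_mem hxB]
        -- With `σ z ≤ 5/4 · σ x` and `dist x z < Λ σ x`, distances from `x` are below `(5/2 + 1) Λ
        -- σ x ≤ 4Λ σ x`.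
        have hsub : B ⊆ Metric.ball x (2 ^ m * σ x) := by
          intro y hy
          rw [Metric.mem_ball] at hy ⊢
          have h3 := dist_triangle_right y x z
          have h4 : 4 * Λ * σ x ≤ 2 ^ m * σ x := by gcongr; exact h.le_two_pow
          nlinarith
        have h5 : μ B ≤ β ^ m * μ (Metric.ball x (σ x)) :=
          (measure_mono hsub).trans (h.ball_two_pow_le x hσx (hσ2 x) le_rfl)
        rw [← div_eq_mul_inv, ENNReal.le_div_iff_mul_le (Or.inl hB0) (Or.inl hBt), mul_comm,
          ← div_eq_mul_inv]
        exact ENNReal.div_le_of_le_mul h5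
    _ ≤ ∫⁻ x, B.indicator (fun _ => β ^ m * (μ B)⁻¹) x ∂μ := setLIntegral_le_lintegral _ _
    _ = β ^ m := by
        rw [lintegral_indicator_const measurableSet_ball, mul_assoc,
          ENNReal.inv_mul_cancel hB0 hBt, mul_one]

theorem PIConstants.scaleKernel_weight_ne_top (h : PIConstants μ Λ m β τ) {ε : ℝ} {r : X → ℝ}
    (hr : IsScale U Λ ε r) {x : X} (hx : x ∈ U) :
    (ENNReal.ofReal (r x) * μ (Metric.ball x (r x)))⁻¹ ≠ ∞ := by
  have h1 := hr.pos x hx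
  exact ENNReal.inv_ne_top.2 (mul_ne_zero (ENNReal.ofReal_pos.2 h1).ne' (h.ball_pos x _ h1).ne')

theorem IsScale.ball_two_subset {X : Type*} [MetricSpace X] {U : Set X} {Λ : ℝ} {ε : ℝ} {r : X → ℝ} (hr : IsScale U Λ ε r) (hΛ : 1 ≤ Λ) {x : X}
    (hx : x ∈ U) : Metric.ball x (2 * r x) ⊆ U := by
  have h1 := hr.pos x hx
  exact (Metric.ball_subset_closedBall.trans
    (Metric.closedBall_subset_closedBall (by nlinarith))).trans (hr.closedBall_subset x hx)

/-- Telescope from the radius `2 r x`. The factor `1 / r x` of the kernel cancels against the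
Poincaré radius `2 r x / 2 ^ k`, leaving a geometric weight. Passing from the measure of `B(x, r x)`
to that of `B(x, 2 r x)` costs the second factor `β`. -/
theorem PIConstants.setLIntegral_scaleKernel_le [BorelSpace X]
    (h : PIConstants μ Λ m β τ) (hU : IsOpen U) {ε : ℝ} {r : X → ℝ} (hr : IsScale U Λ ε r)
    {f : X → V} (hf : LocallyLipschitzOn U f) (hf1 : MemLp f 1 (μ.restrict U)) {x : X}
    (hx : x ∈ U) :
    ∫⁻ z in U, scaleKernel μ r x z * ‖f z - f x‖ₑ ∂μ ≤
      ∑' k : ℕ, 2 * (2⁻¹ : ℝ≥0∞) ^ k * (β ^ 2 * τ) *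
        ∫⁻ z in U, ballKernel (fun x => Λ * (2 * r x / 2 ^ k))
          (fun x => (μ (Metric.ball x (2 * r x / 2 ^ k)))⁻¹) x z * pointwiseLip f z ∂μ := by
  have hΛ0 : 0 < Λ := by linarith [h.one_le]
  have hrx := hr.pos x hx
  have hr1 := hr.le_one x
  have hcl : Metric.closedBall x (Λ * (2 * r x)) ⊆ U :=
    (Metric.closedBall_subset_closedBall (by nlinarith)).trans (hr.closedBall_subset x hx)
  have hpos : ∀ k : ℕ, 0 < 2 * r x / 2 ^ k := fun k => by positivity
  have e : ∀ k : ℕ, ∫⁻ z in U, ballKernel (fun x => Λ * (2 * r x / 2 ^ k))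
      (fun x => (μ (Metric.ball x (2 * r x / 2 ^ k)))⁻¹) x z * pointwiseLip f z ∂μ =
      (μ (Metric.ball x (2 * r x / 2 ^ k)))⁻¹ *
        ∫⁻ z in Metric.ball x (Λ * (2 * r x / 2 ^ k)), pointwiseLip f z ∂μ := fun k => by
    refine setLIntegral_ballKernel_mul (R := fun x => Λ * (2 * r x / 2 ^ k))
      (w := fun x => (μ (Metric.ball x (2 * r x / 2 ^ k)))⁻¹) ?_ ?_ _
    · refine Metric.ball_subset_closedBall.trans (Subset.trans ?_ hcl)
      refine Metric.closedBall_subset_closedBall ?_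
      gcongr
      exact div_le_self (by positivity) (one_le_pow₀ one_le_two)
    · exact ENNReal.inv_ne_top.2 (h.ball_pos x _ (hpos k)).ne'
  simp only [e]
  have e' : ∫⁻ z in U, scaleKernel μ r x z * ‖f z - f x‖ₑ ∂μ = _ :=
    setLIntegral_ballKernel_mul (R := fun x => 2 * r x)
      (w := fun x => (ENNReal.ofReal (r x) * μ (Metric.ball x (r x)))⁻¹)
      (hr.ball_two_subset h.one_le hx) (h.scaleKernel_weight_ne_top hr hx) _
  rw [e']
  have h0 : ENNReal.ofReal (r x) ≠ 0 := (ENNReal.ofReal_pos.2 hrx).ne'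
  have hB0 : μ (Metric.ball x (r x)) ≠ 0 := (h.ball_pos x _ hrx).ne'
  have hBt : μ (Metric.ball x (r x)) ≠ ∞ := (h.ball_lt_top x _).ne
  have hC0 : μ (Metric.ball x (2 * r x)) ≠ 0 := (h.ball_pos x _ (by positivity)).ne'
  have hCt : μ (Metric.ball x (2 * r x)) ≠ ∞ := (h.ball_lt_top x _).ne
  have hdbl : μ (Metric.ball x (2 * r x)) ≤ β * μ (Metric.ball x (r x)) :=
    h.doubling x _ hrx (hr1.trans (one_le_pow₀ one_le_two))
  have hinv : (μ (Metric.ball x (r x)))⁻¹ ≤ β * (μ (Metric.ball x (2 * r x)))⁻¹ := by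
    rw [← div_eq_mul_inv, ENNReal.le_div_iff_mul_le (Or.inl hC0) (Or.inl hCt), mul_comm,
      ← div_eq_mul_inv]
    exact ENNReal.div_le_of_le_mul hdbl
  have key := h.lintegral_norm_sub_le hU hf hf1 (x := x) (s := 2 * r x) (by positivity)
    (by linarith) hcl
  rw [ENNReal.mul_inv (Or.inl h0) (Or.inl ENNReal.ofReal_ne_top)]
  calc (ENNReal.ofReal (r x))⁻¹ * (μ (Metric.ball x (r x)))⁻¹ *
        ∫⁻ z in Metric.ball x (2 * r x), ‖f z - f x‖ₑ ∂μ
      ≤ (ENNReal.ofReal (r x))⁻¹ * (β * (μ (Metric.ball x (2 * r x)))⁻¹) *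
        ∫⁻ z in Metric.ball x (2 * r x), ‖f z - f x‖ₑ ∂μ := by gcongr
    _ = (ENNReal.ofReal (r x))⁻¹ * β * ((μ (Metric.ball x (2 * r x)))⁻¹ *
        ∫⁻ z in Metric.ball x (2 * r x), ‖f z - f x‖ₑ ∂μ) := by ring
    _ ≤ (ENNReal.ofReal (r x))⁻¹ * β * _ := mul_le_mul' le_rfl key
    _ = _ := by
      rw [← ENNReal.tsum_mul_left]
      refine tsum_congr fun k => ?_
      have e2 : ENNReal.ofReal (2 * r x / 2 ^ k) = ENNReal.ofReal (r x) * (2 * 2⁻¹ ^ k) := by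
        rw [mul_comm 2, mul_div_assoc, ENNReal.ofReal_mul hrx.le, ENNReal.ofReal_div_of_pos
          (by positivity), ENNReal.ofReal_pow (by norm_num), ENNReal.ofReal_ofNat,
          div_eq_mul_inv, ENNReal.inv_pow]
      rw [e2]
      have e3 : (ENNReal.ofReal (r x))⁻¹ * ENNReal.ofReal (r x) = 1 :=
        ENNReal.inv_mul_cancel h0 ENNReal.ofReal_ne_top
      calc _ = ((ENNReal.ofReal (r x))⁻¹ * ENNReal.ofReal (r x)) * (2 * 2⁻¹ ^ k * (β ^ 2 * τ) *
            ((μ (Metric.ball x (2 * r x / 2 ^ k)))⁻¹ *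
        ∫⁻ z in Metric.ball x (Λ * (2 * r x / 2 ^ k)), pointwiseLip f z ∂μ)) := by ring
        _ = _ := by rw [e3, one_mul]

/-- The nonlocal energies of a locally Lipschitz function are bounded by the integral of its
pointwise Lipschitz constant. -/
theorem PIConstants.nonlocalEnergy_le [BorelSpace X] [SecondCountableTopology X] [SFinite μ]
    (h : PIConstants μ Λ m β τ) (hU : IsOpen U) {ε : ℝ} {r : X → ℝ} (hr : IsScale U Λ ε r)
    {f : X → V} (hf : LocallyLipschitzOn U f) (hf1 : MemLp f 1 (μ.restrict U)) :
    nonlocalEnergy μ U (scaleKernel μ r) f ≤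
      4 * (β ^ 2 * τ) * β ^ m * ∫⁻ x in U, pointwiseLip f x ∂μ := by
  have hΛ0 : 0 < Λ := by linarith [h.one_le]
  have hrm : Measurable r := (hr.continuous h.one_le).measurable
  have hlip := aemeasurable_pointwiseLip hU hf.continuousOn μ
  have hσm : ∀ k : ℕ, Measurable fun x => 2 * r x / 2 ^ k := fun k => by fun_prop
  let κ : ℕ → X → X → ℝ≥0∞ := fun k => ballKernel (fun x => Λ * (2 * r x / 2 ^ k))
          (fun x => (μ (Metric.ball x (2 * r x / 2 ^ k)))⁻¹)
  have hκ : ∀ k, Measurable (Function.uncurry (κ k)) := fun k =>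
    measurable_ballKernel ((hσm k).const_mul _) (measurable_measure_ball μ (hσm k)).inv
  calc nonlocalEnergy μ U (scaleKernel μ r) f
      ≤ ∫⁻ x in U, ∑' k : ℕ, 2 * (2⁻¹ : ℝ≥0∞) ^ k * (β ^ 2 * τ) *
          ∫⁻ z in U, κ k x z * pointwiseLip f z ∂μ ∂μ :=
        setLIntegral_mono' hU.measurableSet fun x hx =>
          h.setLIntegral_scaleKernel_le hU hr hf hf1 hx
    _ = ∑' k : ℕ, 2 * (2⁻¹ : ℝ≥0∞) ^ k * (β ^ 2 * τ) *
          ∫⁻ x in U, ∫⁻ z in U, κ k x z * pointwiseLip f z ∂μ ∂μ := by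
        have hm : ∀ k, AEMeasurable (fun x => ∫⁻ z in U, κ k x z * pointwiseLip f z ∂μ)
            (μ.restrict U) := fun k =>
          (aemeasurable_setLIntegral_mul (hκ k) hlip).lintegral_prod_right'
        rw [lintegral_tsum fun k => (hm k).const_mul _]
        exact tsum_congr fun k => lintegral_const_mul'' _ (hm k)
    _ ≤ ∑' k : ℕ, 2 * (2⁻¹ : ℝ≥0∞) ^ k * (β ^ 2 * τ) *
          (β ^ m * ∫⁻ x in U, pointwiseLip f x ∂μ) := by
        refine ENNReal.tsum_le_tsum fun k => ?_
        gcongr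
        refine h.lintegral_ballKernel_le hU (fun x hx => ?_) (fun x => ?_) (fun x y => ?_)
          (hσm k) hlip
        · have := hr.pos x hx
          positivity
        · rw [div_le_iff₀ (by positivity)]
          have h1 := hr.le_one x
          have h2 : (1 : ℝ) ≤ 2 ^ k := one_le_pow₀ one_le_two
          linarith
        · rw [← sub_div, ← mul_sub, abs_div, abs_mul, abs_of_pos (a := (2 : ℝ) ^ k) (by positivity),
            abs_of_pos (a := (2 : ℝ)) two_pos]
          refine (div_le_self (by positivity) (one_le_pow₀ one_le_two)).trans ?_
          have := hr.lipschitz x y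
          calc 2 * |r x - r y| ≤ 2 * (dist x y / (8 * Λ)) := by gcongr
            _ = _ := by field_simp; ring
    _ = _ := by
        simp only [mul_assoc]
        rw [ENNReal.tsum_mul_left, ENNReal.tsum_mul_right, ENNReal.tsum_geometric]
        have : (1 - 2⁻¹ : ℝ≥0∞)⁻¹ = 2 := by rw [ENNReal.one_sub_inv_two, inv_inv]
        rw [this]
        ring

theorem aemeasurable_kernel_mul_enorm_sub {X V : Type*} [MeasurableSpace X]
    [NormedAddCommGroup V] {μ : Measure X} {U : Set X} [SFinite μ] {κ : X → X → ℝ≥0∞}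
    (hκ : Measurable (Function.uncurry κ)) {f : X → V}
    (hf : AEStronglyMeasurable f (μ.restrict U)) :
    AEMeasurable (Function.uncurry fun x z => κ x z * ‖f z - f x‖ₑ)
      ((μ.restrict U).prod (μ.restrict U)) :=
  hκ.aemeasurable.mul (hf.comp_snd.sub hf.comp_fst).enorm

theorem nonlocalEnergy_le_liminf {X V : Type*} [MeasurableSpace X]
    [NormedAddCommGroup V] {μ : Measure X} {U : Set X} [SFinite μ] (hU : MeasurableSet U) {κ : X → X → ℝ≥0∞}
    (hκ : Measurable (Function.uncurry κ)) (hκt : ∀ x ∈ U, ∀ z, κ x z ≠ ∞) {f : X → V}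
    {u : ℕ → X → V}
    (hu : ∀ n, AEStronglyMeasurable (u n) (μ.restrict U))
    (hlim : ∀ᵐ x ∂μ.restrict U, Tendsto (fun n => u n x) atTop (𝓝 (f x))) :
    nonlocalEnergy μ U κ f ≤ liminf (fun n => nonlocalEnergy μ U κ (u n)) atTop := by
  have hm := fun n => aemeasurable_kernel_mul_enorm_sub hκ (hu n)
  calc nonlocalEnergy μ U κ f
      ≤ ∫⁻ x in U, liminf (fun n => ∫⁻ z in U, κ x z * ‖u n z - u n x‖ₑ ∂μ) atTop ∂μ := by
        refine lintegral_mono_ae ?_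
        filter_upwards [hlim, ae_restrict_mem hU] with x hx hxU
        calc ∫⁻ z in U, κ x z * ‖f z - f x‖ₑ ∂μ
            ≤ ∫⁻ z in U, liminf (fun n => κ x z * ‖u n z - u n x‖ₑ) atTop ∂μ := by
              refine lintegral_mono_ae ?_
              filter_upwards [hlim] with z hz
              exact (ENNReal.Tendsto.const_mul (hz.sub hx).enorm
                (Or.inr (hκt x hxU z))).liminf_eq.ge
          _ ≤ _ := lintegral_liminf_le' fun n =>
              (hκ.comp measurable_prodMk_left).aemeasurable.mul
                ((hu n).sub aestronglyMeasurable_const).enorm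
    _ ≤ _ := lintegral_liminf_le' fun n => (hm n).lintegral_prod_right'

theorem PIConstants.nonlocalEnergy_le_VAR [BorelSpace X] [SecondCountableTopology X] [SFinite μ]
    (h : PIConstants μ Λ m β τ) (hU : IsOpen U) {ε : ℝ} {r : X → ℝ} (hr : IsScale U Λ ε r)
    {f : X → V} (hf : AEStronglyMeasurable f (μ.restrict U)) :
    nonlocalEnergy μ U (scaleKernel μ r) f ≤ (4 * (β ^ 2 * τ) * β ^ m + 1) * VAR μ U f := by
  -- The summand `1` in the constant keeps it nonzero, so that the right-hand side is `∞` in this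
  -- case.
  rcases eq_or_ne (VAR μ U f) ∞ with ht | ht
  · rw [ht, ENNReal.mul_top (by simp)]; exact le_top
  obtain ⟨u, hu, hlim⟩ := exists_isLipApprox_tendsto ht
  obtain ⟨ns, hns, hae⟩ := (tendstoInMeasure_of_tendsto_eLpNorm one_ne_zero
    (fun n => (hu.memLp n).1) hf hu.tendsto).exists_seq_tendsto_ae
  have hκ := measurable_scaleKernel μ (hr.continuous h.one_le).measurable
  refine (nonlocalEnergy_le_liminf hU.measurableSet hκ (fun x hx z => ?_)
    (fun n => (hu.memLp (ns n)).1) hae).trans ?_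
  · simp only [scaleKernel, ballKernel]
    split_ifs
    · exact h.scaleKernel_weight_ne_top hr hx
    · simp
  · have hC : (4 * (β ^ 2 * τ) * β ^ m : ℝ≥0∞) ≠ ∞ := by finiteness
    calc liminf (fun n => nonlocalEnergy μ U (scaleKernel μ r) (u (ns n))) atTop
        ≤ liminf (fun n => 4 * (β ^ 2 * τ) * β ^ m *
            ∫⁻ x in U, pointwiseLip (u (ns n)) x ∂μ) atTop :=
          liminf_le_liminf (Eventually.of_forall fun n =>
            h.nonlocalEnergy_le hU hr (hu.locallyLipschitz _) (hu.memLp _))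
      _ = 4 * (β ^ 2 * τ) * β ^ m * VAR μ U f :=
          (ENNReal.Tendsto.const_mul (hlim.comp hns.tendsto_atTop) (Or.inr hC)).liminf_eq
      _ ≤ _ := by gcongr; exact le_self_add

end Energy

/-! ### Stability of weighted means -/

section WeightedMean

variable {X V : Type*} [MeasurableSpace X] [NormedAddCommGroup V] [NormedSpace ℝ V]

/-- The mean of `f` with respect to the weight `a`. -/
noncomputable def weightedMean (ν : Measure X) (a : X → ℝ) (f : X → V) : V :=
  (∫ z, a z ∂ν)⁻¹ • ∫ z, a z • f z ∂ν

variable {ν : Measure X} {a b : X → ℝ} {f : X → V} {L δ : ℝ}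

theorem norm_integral_smul_le (hf : Integrable f ν) (ha : ∀ z, |a z| ≤ L) :
    ‖∫ z, a z • f z ∂ν‖ ≤ L * ∫ z, ‖f z‖ ∂ν := by
  rw [← integral_const_mul]
  refine norm_integral_le_of_norm_le (hf.norm.const_mul _) (ae_of_all _ fun z => ?_)
  rw [norm_smul, Real.norm_eq_abs]
  gcongr
  exact ha z

theorem weightedMean_sub [CompleteSpace V] [IsFiniteMeasure ν] (hf : Integrable f ν)
    (hm : Measurable a) (ha : ∀ z, |a z| ≤ L) (h0 : ∫ z, a z ∂ν ≠ 0) (c : V) :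
    weightedMean ν a f - c = (∫ z, a z ∂ν)⁻¹ • ∫ z, a z • (f z - c) ∂ν := by
  have hb : ∀ᵐ z ∂ν, ‖a z‖ ≤ L := ae_of_all _ ha
  have hai : Integrable a ν := Integrable.of_bound hm.aestronglyMeasurable L hb
  have h1 : Integrable (fun z => a z • f z) ν := hf.bdd_smul L hm.aestronglyMeasurable hb
  have h2 : Integrable (fun z => a z • c) ν := hai.smul_const c
  simp only [smul_sub]
  rw [integral_sub h1 h2, integral_smul_const, smul_sub, smul_smul, inv_mul_cancel₀ h0, one_smul]
  rfl

theorem norm_weightedMean_sub_le [CompleteSpace V] [IsFiniteMeasure ν] (hf : Integrable f ν)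
    (hm : Measurable a) (ha : ∀ z, |a z| ≤ L) (hδ : 0 < δ) (hδa : δ ≤ ∫ z, a z ∂ν)
    (c : V) : ‖weightedMean ν a f - c‖ ≤ δ⁻¹ * (L * ∫ z, ‖f z - c‖ ∂ν) := by
  have hA : 0 < ∫ z, a z ∂ν := hδ.trans_le hδa
  have hg : Integrable (fun z => f z - c) ν := hf.sub (integrable_const c)
  rw [weightedMean_sub hf hm ha hA.ne', norm_smul, norm_inv, Real.norm_of_nonneg hA.le]
  gcongr
  exact norm_integral_smul_le hg ha

/-- Subtracting `c` from both means replaces `f` by `f - c`. The difference then splits into one of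
numerators, bounded by `D`, and one of normalising factors, bounded by `D` times the total mass. -/
theorem norm_weightedMean_sub_weightedMean_le [CompleteSpace V] [IsFiniteMeasure ν]
    (hf : Integrable f ν) (hma : Measurable a) (hmb : Measurable b) (ha : ∀ z, |a z| ≤ L)
    (hb : ∀ z, |b z| ≤ L) (hδ : 0 < δ) (hδa : δ ≤ ∫ z, a z ∂ν)
    (hδb : δ ≤ ∫ z, b z ∂ν) {D : ℝ} (hD : ∀ z, |a z - b z| ≤ D) (hD0 : 0 ≤ D) (c : V) :
    ‖weightedMean ν a f - weightedMean ν b f‖ ≤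
      (δ⁻¹ * D + δ⁻¹ * δ⁻¹ * (D * ν.real univ) * L) * ∫ z, ‖f z - c‖ ∂ν := by
  have hA : 0 < ∫ z, a z ∂ν := hδ.trans_le hδa
  have hB : 0 < ∫ z, b z ∂ν := hδ.trans_le hδb
  have hg : Integrable (fun z => f z - c) ν := hf.sub (integrable_const c)
  have hba : ∀ᵐ z ∂ν, ‖a z‖ ≤ L := ae_of_all _ ha
  have hbb : ∀ᵐ z ∂ν, ‖b z‖ ≤ L := ae_of_all _ hb
  have h1 : Integrable (fun z => a z • (f z - c)) ν := hg.bdd_smul L hma.aestronglyMeasurable hba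
  have h2 : Integrable (fun z => b z • (f z - c)) ν := hg.bdd_smul L hmb.aestronglyMeasurable hbb
  have hai : Integrable a ν := Integrable.of_bound hma.aestronglyMeasurable L hba
  have hbi : Integrable b ν := Integrable.of_bound hmb.aestronglyMeasurable L hbb
  have hAB : |∫ z, b z ∂ν - ∫ z, a z ∂ν| ≤ D * ν.real univ := by
    rw [← integral_sub hbi hai, ← Real.norm_eq_abs]
    refine norm_integral_le_of_norm_le_const (ae_of_all _ fun z => ?_)
    rw [Real.norm_eq_abs, abs_sub_comm]
    exact hD z
  have e : weightedMean ν a f - weightedMean ν b f =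
      (∫ z, a z ∂ν)⁻¹ • (∫ z, (a z - b z) • (f z - c) ∂ν) +
        ((∫ z, a z ∂ν)⁻¹ * (∫ z, b z ∂ν)⁻¹ * (∫ z, b z ∂ν - ∫ z, a z ∂ν)) •
          ∫ z, b z • (f z - c) ∂ν := by
    have e1 : (∫ z, a z ∂ν)⁻¹ * (∫ z, b z ∂ν)⁻¹ * (∫ z, b z ∂ν - ∫ z, a z ∂ν) =
        (∫ z, a z ∂ν)⁻¹ - (∫ z, b z ∂ν)⁻¹ := by field_simp
    rw [e1, ← sub_sub_sub_cancel_right _ _ c, weightedMean_sub hf hma ha hA.ne',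
      weightedMean_sub hf hmb hb hB.ne']
    simp only [sub_smul _ _ (f _ - c)]
    rw [integral_sub h1 h2, smul_sub, sub_smul]
    abel
  rw [e, add_mul]
  refine (norm_add_le _ _).trans (add_le_add ?_ ?_)
  · rw [norm_smul, norm_inv, Real.norm_of_nonneg hA.le, mul_assoc]
    gcongr
    exact norm_integral_smul_le hg hD
  · rw [norm_smul, norm_mul, norm_mul, norm_inv, norm_inv, Real.norm_of_nonneg hA.le,
      Real.norm_of_nonneg hB.le, Real.norm_eq_abs, mul_assoc _ L]
    gcongr
    exact norm_integral_smul_le hg hb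

end WeightedMean

/-! ### Convolution at a variable scale: the variation bounded by energies -/

section Convolution

variable {X V : Type*} [MetricSpace X] [MeasurableSpace X] [NormedAddCommGroup V] [NormedSpace ℝ V]
  {μ : Measure X} {U : Set X} {Λ : ℝ} {m : ℕ} {β τ : ℝ≥0} {ε : ℝ} {r : X → ℝ} {f : X → V}

/-- The convolution of `f` with a Lipschitz bump of varying radius `r`. -/
noncomputable def convolve (μ : Measure X) (U : Set X) (r : X → ℝ) (f : X → V) (x : X) : V :=
  weightedMean (μ.restrict U) (fun z => max (r x - dist x z) 0) f

/-- The slope of `r` is at most `1/8`, so within distance `r x / 8` it changes by at most `r x /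
64`. -/
theorem IsScale.near {X : Type*} [MetricSpace X] {U : Set X} {Λ ε : ℝ} {r : X → ℝ}
    (hr : IsScale U Λ ε r) (hΛ : 1 ≤ Λ) {x x' : X} (hx' : dist x' x < r x / 8) :
    r x' ≤ 65 / 64 * r x ∧ 63 / 64 * r x ≤ r x' := by
  have h1 : dist x' x / (8 * Λ) ≤ dist x' x / 8 :=
    div_le_div_of_nonneg_left dist_nonneg (by norm_num) (by linarith)
  have h2 := abs_le.1 ((hr.lipschitz x' x).trans h1)
  constructor <;> linarith

/-- Bumps centred near `x` are all supported in the ball of radius `2 r x`. This gives one common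
reference measure for comparing means at different centres. -/
theorem convolve_eq [OpensMeasurableSpace X] (hr : IsScale U Λ ε r) (hΛ : 1 ≤ Λ) {x x' : X}
    (hx : x ∈ U) (hx' : dist x' x < r x / 8) :
    convolve μ U r f x' =
      weightedMean (μ.restrict (Metric.ball x (2 * r x))) (fun z => max (r x' - dist x' z) 0) f := by
  have hrx := hr.pos x hx
  have hsub := hr.ball_two_subset hΛ hx
  have h0 : ∀ z, z ∉ Metric.ball x (2 * r x) → max (r x' - dist x' z) 0 = 0 := fun z hz => by
    rw [Metric.mem_ball, not_lt] at hz
    have := (hr.near hΛ hx').1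
    have := dist_triangle z x' x
    rw [dist_comm z x'] at this
    exact max_eq_right (by linarith)
  have e1 : ∫ z in U, max (r x' - dist x' z) 0 ∂μ =
      ∫ z in Metric.ball x (2 * r x), max (r x' - dist x' z) 0 ∂μ :=
    (setIntegral_eq_integral_of_forall_compl_eq_zero fun z hz => h0 z fun hb => hz (hsub hb)).trans
      (setIntegral_eq_integral_of_forall_compl_eq_zero h0).symm
  have e2 : ∫ z in U, max (r x' - dist x' z) 0 • f z ∂μ =
      ∫ z in Metric.ball x (2 * r x), max (r x' - dist x' z) 0 • f z ∂μ :=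
    (setIntegral_eq_integral_of_forall_compl_eq_zero fun z hz => by
      rw [h0 z fun hb => hz (hsub hb), zero_smul]).trans
      (setIntegral_eq_integral_of_forall_compl_eq_zero fun z hz => by rw [h0 z hz, zero_smul]).symm
  rw [convolve, weightedMean, weightedMean, e1, e2]

/-- On the ball of radius `r x / 2` the bump is at least `(63 - 32 - 8) / 64 · r x ≥ r x / 4`, and
one doubling compares that ball with the one of radius `r x`. -/
theorem PIConstants.integral_bump_ge [OpensMeasurableSpace X] (h : PIConstants μ Λ m β τ)
    (hr : IsScale U Λ ε r) {x x' : X} (hx : x ∈ U) (hx' : dist x' x < r x / 8) :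
    r x * μ.real (Metric.ball x (r x)) / (4 * β) ≤
      ∫ z in Metric.ball x (2 * r x), max (r x' - dist x' z) 0 ∂μ := by
  have hrx := hr.pos x hx
  have hnear := hr.near h.one_le hx'
  have hfin : ∀ s, μ (Metric.ball x s) ≠ ∞ := fun s => (h.ball_lt_top x s).ne
  have hdbl : μ.real (Metric.ball x (r x)) ≤ β * μ.real (Metric.ball x (r x / 2)) := by
    have h1 := h.doubling x (r x / 2) (by positivity)
      (by have := hr.le_one x; have : (1 : ℝ) ≤ 2 ^ (m + 1) := one_le_pow₀ one_le_two; linarith)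
    rw [mul_div_cancel₀ _ two_ne_zero] at h1
    have := ENNReal.toReal_mono (ENNReal.mul_ne_top ENNReal.coe_ne_top (hfin _)) h1
    simpa [measureReal_def] using this
  have hM : 0 < μ.real (Metric.ball x (r x)) :=
    ENNReal.toReal_pos (h.ball_pos x _ hrx).ne' (hfin _)
  have hβ : 0 < (β : ℝ) := by
    by_contra hn
    have : (β : ℝ) = 0 := le_antisymm (not_lt.1 hn) β.2
    rw [this, zero_mul] at hdbl
    linarith
  have hm : Measurable fun z => max (r x' - dist x' z) 0 := by fun_prop
  have hint : IntegrableOn (fun z => max (r x' - dist x' z) 0) (Metric.ball x (2 * r x)) μ := by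
    refine Measure.integrableOn_of_bounded (M := r x') (hfin _) hm.aestronglyMeasurable
      (ae_of_all _ fun z => ?_)
    rw [Real.norm_of_nonneg (le_max_right _ _)]
    exact max_le (by linarith [dist_nonneg (x := x') (y := z)]) (by linarith)
  calc r x * μ.real (Metric.ball x (r x)) / (4 * β)
      ≤ r x * (β * μ.real (Metric.ball x (r x / 2))) / (4 * β) := by gcongr
    _ = r x / 4 * μ.real (Metric.ball x (r x / 2)) := by field_simp
    _ = ∫ z in Metric.ball x (r x / 2), r x / 4 ∂μ := by
        rw [setIntegral_const, smul_eq_mul, mul_comm]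
    _ ≤ ∫ z in Metric.ball x (r x / 2), max (r x' - dist x' z) 0 ∂μ := by
        refine setIntegral_mono_on (integrableOn_const (hfin _))
          (hint.mono_set (Metric.ball_subset_ball (by linarith))) measurableSet_ball fun z hz => ?_
        rw [Metric.mem_ball] at hz
        have := dist_triangle_right x' z x
        exact le_max_of_le_left (by linarith)
    _ ≤ _ := setIntegral_mono_set hint (ae_of_all _ fun z => le_max_right _ _)
        (Metric.ball_subset_ball (by linarith)).eventuallyLE

theorem PIConstants.setLIntegral_scaleKernel {X V : Type*} [MetricSpace X] [MeasurableSpace X]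
    [NormedAddCommGroup V] {μ : Measure X} {U : Set X} {Λ : ℝ} {m : ℕ} {β τ : ℝ≥0} {ε : ℝ}
    {r : X → ℝ} {f : X → V} [OpensMeasurableSpace X] (h : PIConstants μ Λ m β τ)
    (hr : IsScale U Λ ε r) (hf : MemLp f 1 (μ.restrict U)) {x : X} (hx : x ∈ U) (c : V) :
    ∫⁻ z in U, scaleKernel μ r x z * ‖f z - c‖ₑ ∂μ =
      ENNReal.ofReal ((r x * μ.real (Metric.ball x (r x)))⁻¹ *
        ∫ z in Metric.ball x (2 * r x), ‖f z - c‖ ∂μ) := by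
  have hrx := hr.pos x hx
  have hM : 0 < μ.real (Metric.ball x (r x)) :=
    ENNReal.toReal_pos (h.ball_pos x _ hrx).ne' (h.ball_lt_top x _).ne
  have hfi : IntegrableOn f (Metric.ball x (2 * r x)) μ :=
    (memLp_one_iff_integrable.1 hf).mono_measure
      (Measure.restrict_mono (hr.ball_two_subset h.one_le hx) le_rfl)
  have e' : ∫⁻ z in U, scaleKernel μ r x z * ‖f z - c‖ₑ ∂μ = _ :=
    setLIntegral_ballKernel_mul (R := fun x => 2 * r x)
      (w := fun x => (ENNReal.ofReal (r x) * μ (Metric.ball x (r x)))⁻¹)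
      (hr.ball_two_subset h.one_le hx) (h.scaleKernel_weight_ne_top hr hx) _
  rw [e', ENNReal.ofReal_mul (by positivity), ENNReal.ofReal_inv_of_pos (by positivity),
    ENNReal.ofReal_mul hrx.le, ofReal_measureReal (h.ball_lt_top x _).ne]
  congr 1
  exact (ofReal_integral_norm_eq_lintegral_enorm
    (hfi.sub (integrableOn_const (h.ball_lt_top x _).ne))).symm

theorem PIConstants.edist_convolve_le [OpensMeasurableSpace X] [CompleteSpace V]
    (h : PIConstants μ Λ m β τ) (hr : IsScale U Λ ε r) (hf : MemLp f 1 (μ.restrict U)) {x : X}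
    (hx : x ∈ U) {y z : X} (hy : y ∈ Metric.ball x (r x / 8)) (hz : z ∈ Metric.ball x (r x / 8))
    (c : V) :
    edist (convolve μ U r f y) (convolve μ U r f z) ≤
      ((8 * β + 64 * β ^ 3 : ℝ≥0) * ∫⁻ z in U, scaleKernel μ r x z * ‖f z - c‖ₑ ∂μ) *
        edist y z := by
  rw [Metric.mem_ball] at hy hz
  have hrx := hr.pos x hx
  have hfin : ∀ s, μ (Metric.ball x s) ≠ ∞ := fun s => (h.ball_lt_top x s).ne
  have hM : 0 < μ.real (Metric.ball x (r x)) :=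
    ENNReal.toReal_pos (h.ball_pos x _ hrx).ne' (hfin _)
  have hdbl : μ.real (Metric.ball x (2 * r x)) ≤ β * μ.real (Metric.ball x (r x)) := by
    have h1 := h.doubling x (r x) hrx ((hr.le_one x).trans (one_le_pow₀ one_le_two))
    have := ENNReal.toReal_mono (ENNReal.mul_ne_top ENNReal.coe_ne_top (hfin _)) h1
    simpa [measureReal_def] using this
  have hM2 : 0 < μ.real (Metric.ball x (2 * r x)) :=
    ENNReal.toReal_pos (h.ball_pos x _ (by positivity)).ne' (hfin _)
  have hβ : 0 < (β : ℝ) := pos_of_mul_pos_left (hM2.trans_le hdbl) hM.le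
  have hfi : IntegrableOn f (Metric.ball x (2 * r x)) μ :=
    (memLp_one_iff_integrable.1 hf).mono_measure
      (Measure.restrict_mono (hr.ball_two_subset h.one_le hx) le_rfl)
  have : IsFiniteMeasure (μ.restrict (Metric.ball x (2 * r x))) := ⟨by
    rw [Measure.restrict_apply_univ]; exact h.ball_lt_top x _⟩
  have hbd : ∀ y, dist y x < r x / 8 → ∀ w, |max (r y - dist y w) 0| ≤ 2 * r x := by
    intro y hy w
    have := (hr.near h.one_le hy).1
    rw [abs_of_nonneg (le_max_right _ _)]
    exact max_le (by linarith [dist_nonneg (x := y) (y := w)]) (by linarith)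
  have hD : ∀ w, |max (r y - dist y w) 0 - max (r z - dist z w) 0| ≤ 2 * dist y z := by
    intro w
    refine (abs_max_sub_max_le_abs _ _ _).trans ?_
    have h1 : |r y - r z| ≤ dist y z := (hr.lipschitz y z).trans
      (div_le_self dist_nonneg (by linarith [h.one_le]))
    have h2 := abs_dist_sub_le y z w
    have h3 := abs_sub (r y - r z) (dist y w - dist z w)
    rw [show r y - dist y w - (r z - dist z w) = r y - r z - (dist y w - dist z w) by ring]
    linarith
  have key := norm_weightedMean_sub_weightedMean_le (f := f)
    (ν := μ.restrict (Metric.ball x (2 * r x))) hfi (a := fun w => max (r y - dist y w) 0)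
    (b := fun w => max (r z - dist z w) 0) (by fun_prop) (by fun_prop) (hbd y hy) (hbd z hz)
    (δ := r x * μ.real (Metric.ball x (r x)) / (4 * β)) (by positivity)
    (h.integral_bump_ge hr hx hy) (h.integral_bump_ge hr hx hz) hD (by positivity) c
  rw [← convolve_eq hr h.one_le hx hy, ← convolve_eq hr h.one_le hx hz,
    measureReal_restrict_apply_univ] at key
  rw [h.setLIntegral_scaleKernel hr hf hx, edist_dist, edist_dist, dist_eq_norm,
    ← ENNReal.ofReal_coe_nnreal, ← ENNReal.ofReal_mul NNReal.zero_le_coe,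
    ← ENNReal.ofReal_mul (by positivity)]
  refine ENNReal.ofReal_le_ofReal (key.trans ?_)
  have hJ : 0 ≤ ∫ w in Metric.ball x (2 * r x), ‖f w - c‖ ∂μ := integral_nonneg fun _ => norm_nonneg _
  set J := ∫ w in Metric.ball x (2 * r x), ‖f w - c‖ ∂μ
  set M := μ.real (Metric.ball x (r x))
  set d := dist y z
  have hd : 0 ≤ d := dist_nonneg
  -- The first product is the `8 β` term. The second is the `64 β ^ 3` term: two factors `4 β` come
  -- from the normalisers and one `β` from the mass of the doubled ball.
  calc _ ≤ ((r x * M / (4 * β))⁻¹ * (2 * d) + (r x * M / (4 * β))⁻¹ * (r x * M / (4 * β))⁻¹ *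
        (2 * d * (β * M)) * (2 * r x)) * J := by gcongr
    _ = _ := by
      push_cast
      field_simp
      ring

theorem PIConstants.enorm_convolve_sub_le [OpensMeasurableSpace X] [CompleteSpace V]
    (h : PIConstants μ Λ m β τ) (hr : IsScale U Λ ε r) (hf : MemLp f 1 (μ.restrict U)) {x : X}
    (hx : x ∈ U) (c : V) :
    ‖convolve μ U r f x - c‖ₑ ≤
      4 * β * ENNReal.ofReal (r x) * ∫⁻ z in U, scaleKernel μ r x z * ‖f z - c‖ₑ ∂μ := by
  have hrx := hr.pos x hx
  have hfin : ∀ s, μ (Metric.ball x s) ≠ ∞ := fun s => (h.ball_lt_top x s).ne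
  have hM : 0 < μ.real (Metric.ball x (r x)) :=
    ENNReal.toReal_pos (h.ball_pos x _ hrx).ne' (hfin _)
  have hdbl : μ.real (Metric.ball x (2 * r x)) ≤ β * μ.real (Metric.ball x (r x)) := by
    have h1 := h.doubling x (r x) hrx ((hr.le_one x).trans (one_le_pow₀ one_le_two))
    have := ENNReal.toReal_mono (ENNReal.mul_ne_top ENNReal.coe_ne_top (hfin _)) h1
    simpa [measureReal_def] using this
  have hM2 : 0 < μ.real (Metric.ball x (2 * r x)) :=
    ENNReal.toReal_pos (h.ball_pos x _ (by positivity)).ne' (hfin _)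
  have hβ : 0 < (β : ℝ) := pos_of_mul_pos_left (hM2.trans_le hdbl) hM.le
  have hfi : IntegrableOn f (Metric.ball x (2 * r x)) μ :=
    (memLp_one_iff_integrable.1 hf).mono_measure
      (Measure.restrict_mono (hr.ball_two_subset h.one_le hx) le_rfl)
  have : IsFiniteMeasure (μ.restrict (Metric.ball x (2 * r x))) := ⟨by
    rw [Measure.restrict_apply_univ]; exact h.ball_lt_top x _⟩
  have hx0 : dist x x < r x / 8 := by rw [dist_self]; positivity
  have hbd : ∀ w, |max (r x - dist x w) 0| ≤ r x := by
    intro w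
    rw [abs_of_nonneg (le_max_right _ _)]
    exact max_le (by linarith [dist_nonneg (x := x) (y := w)]) hrx.le
  have key := norm_weightedMean_sub_le (f := f)
    (ν := μ.restrict (Metric.ball x (2 * r x))) hfi (a := fun w => max (r x - dist x w) 0)
    (by fun_prop) hbd (δ := r x * μ.real (Metric.ball x (r x)) / (4 * β)) (by positivity)
    (h.integral_bump_ge hr hx hx0) c
  rw [← convolve_eq hr h.one_le hx hx0] at key
  have e4 : (4 * β : ℝ≥0∞) = ENNReal.ofReal (4 * β) := by
    rw [ENNReal.ofReal_mul (by norm_num), ENNReal.ofReal_coe_nnreal, ENNReal.ofReal_ofNat]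
  rw [h.setLIntegral_scaleKernel hr hf hx, e4, ← ENNReal.ofReal_mul (by positivity),
    ← ENNReal.ofReal_mul (by positivity), ← ofReal_norm]
  refine ENNReal.ofReal_le_ofReal (key.trans_eq ?_)
  field_simp

theorem PIConstants.setLIntegral_scaleKernel_ne_top {X V : Type*} [MetricSpace X]
    [MeasurableSpace X] [NormedAddCommGroup V] {μ : Measure X} {U : Set X} {Λ : ℝ} {m : ℕ}
    {β τ : ℝ≥0} {ε : ℝ} {r : X → ℝ} {f : X → V} [OpensMeasurableSpace X]
    (h : PIConstants μ Λ m β τ) (hr : IsScale U Λ ε r) (hf : MemLp f 1 (μ.restrict U)) {x : X}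
    (hx : x ∈ U) (c : V) : ∫⁻ z in U, scaleKernel μ r x z * ‖f z - c‖ₑ ∂μ ≠ ∞ := by
  rw [h.setLIntegral_scaleKernel hr hf hx]
  exact ENNReal.ofReal_ne_top

theorem PIConstants.locallyLipschitzOn_convolve [OpensMeasurableSpace X] [CompleteSpace V]
    (h : PIConstants μ Λ m β τ) (hr : IsScale U Λ ε r) (hf : MemLp f 1 (μ.restrict U)) :
    LocallyLipschitzOn U (convolve μ U r f) := by
  refine locallyLipschitzOn_of_ball fun x hx => ?_
  have hrx := hr.pos x hx
  refine ⟨(8 * β + 64 * β ^ 3) *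
    (∫⁻ z in U, scaleKernel μ r x z * ‖f z - f x‖ₑ ∂μ).toNNReal, r x / 8, by positivity,
    fun y hy z hz => ?_⟩
  rw [ENNReal.coe_mul, ENNReal.coe_toNNReal (h.setLIntegral_scaleKernel_ne_top hr hf hx _)]
  exact h.edist_convolve_le hr hf hx hy hz (f x)

theorem PIConstants.pointwiseLip_convolve_le [OpensMeasurableSpace X] [CompleteSpace V]
    (h : PIConstants μ Λ m β τ) (hr : IsScale U Λ ε r) (hf : MemLp f 1 (μ.restrict U)) {x : X}
    (hx : x ∈ U) : pointwiseLip (convolve μ U r f) x ≤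
      (8 * β + 64 * β ^ 3 : ℝ≥0) * ∫⁻ z in U, scaleKernel μ r x z * ‖f z - f x‖ₑ ∂μ := by
  have hr8 : 0 < r x / 8 := by linarith [hr.pos x hx]
  refine pointwiseLip_le_of_bound ?_
  filter_upwards [Metric.ball_mem_nhds x hr8] with y hy
  exact h.edist_convolve_le hr hf hx (Metric.mem_ball_self hr8) hy (f x)

theorem PIConstants.lintegral_pointwiseLip_convolve_le [OpensMeasurableSpace X] [CompleteSpace V]
    (h : PIConstants μ Λ m β τ) (hU : MeasurableSet U) (hr : IsScale U Λ ε r)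
    (hf : MemLp f 1 (μ.restrict U)) :
    ∫⁻ x in U, pointwiseLip (convolve μ U r f) x ∂μ ≤
      (8 * β + 64 * β ^ 3 : ℝ≥0) * nonlocalEnergy μ U (scaleKernel μ r) f := by
  rw [nonlocalEnergy, ← lintegral_const_mul' _ _ ENNReal.coe_ne_top]
  exact setLIntegral_mono' hU fun x hx => h.pointwiseLip_convolve_le hr hf hx

theorem PIConstants.eLpNorm_convolve_sub_le [OpensMeasurableSpace X] [CompleteSpace V]
    (h : PIConstants μ Λ m β τ) (hU : MeasurableSet U) (hr : IsScale U Λ ε r)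
    (hf : MemLp f 1 (μ.restrict U)) :
    eLpNorm (convolve μ U r f - f) 1 (μ.restrict U) ≤
      4 * β * ENNReal.ofReal ε * nonlocalEnergy μ U (scaleKernel μ r) f := by
  rw [eLpNorm_one_eq_lintegral_enorm, nonlocalEnergy, ← lintegral_const_mul' _ _ (by finiteness)]
  refine setLIntegral_mono' hU fun x hx => (h.enorm_convolve_sub_le hr hf hx (f x)).trans ?_
  gcongr
  exact hr.le x

/-- The variation is controlled by the nonlocal energies at small scales. -/
theorem PIConstants.VAR_le_liminf_nonlocalEnergy [BorelSpace X] [SecondCountableTopology X]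
    [CompleteSpace V] (h : PIConstants μ Λ m β τ) (hU : IsOpen U) {r : ℕ → X → ℝ}
    (hr : ∀ n : ℕ, IsScale U Λ (1 / (n + 1)) (r n)) (hf : MemLp f 1 (μ.restrict U)) :
    VAR μ U f ≤ ((8 * β + 64 * β ^ 3 : ℝ≥0) + 1) *
      liminf (fun n => nonlocalEnergy μ U (scaleKernel μ (r n)) f) atTop := by
  set E : ℕ → ℝ≥0∞ := fun n => nonlocalEnergy μ U (scaleKernel μ (r n)) f
  rcases eq_or_ne (liminf E atTop) ∞ with ht | ht
  · rw [ht, ENNReal.mul_top (by simp)]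
    exact le_top
  have hlt : liminf E atTop < ∞ := lt_top_iff_ne_top.2 ht
  have := nhdsGT_neBot_of_exists_gt ⟨∞, hlt⟩
  have hc0 : Tendsto (fun c : ℝ≥0∞ => (8 * β + 64 * β ^ 3 : ℝ≥0) * c) (𝓝[>] liminf E atTop)
      (𝓝 ((8 * β + 64 * β ^ 3 : ℝ≥0) * liminf E atTop)) :=
    (ENNReal.Tendsto.const_mul tendsto_id (Or.inr ENNReal.coe_ne_top)).mono_left nhdsWithin_le_nhds
  refine le_trans (ge_of_tendsto hc0 ?_) (mul_le_mul' le_self_add le_rfl)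
  filter_upwards [self_mem_nhdsWithin, nhdsWithin_le_nhds (Iio_mem_nhds hlt)] with c hc hct
  refine VAR_le_of_forall_approx fun ε hε => ?_
  have hfreq : ∃ᶠ n in atTop, E n < c := frequently_lt_of_liminf_lt (by isBoundedDefault) hc
  have hlim : Tendsto (fun n : ℕ => 4 * β * ENNReal.ofReal (1 / (n + 1)) * c) atTop (𝓝 0) := by
    have h1 : Tendsto (fun n : ℕ => ENNReal.ofReal (1 / ((n : ℝ) + 1))) atTop (𝓝 0) := by
      simpa using ENNReal.tendsto_ofReal tendsto_one_div_add_atTop_nhds_zero_nat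
    have h2 := ENNReal.Tendsto.mul_const (b := c) (ENNReal.Tendsto.const_mul (a := 4 * (β : ℝ≥0∞)) h1
      (Or.inr (by finiteness))) (Or.inr (ne_of_lt hct))
    simpa using h2
  obtain ⟨n, hnc, hn⟩ := (hfreq.and_eventually (hlim.eventually_le_const hε)).exists
  have hUm := hU.measurableSet
  have hL := h.locallyLipschitzOn_convolve (hr n) hf
  have hE : eLpNorm (convolve μ U (r n) f - f) 1 (μ.restrict U) ≤
      4 * β * ENNReal.ofReal (1 / (n + 1)) * c :=
    (h.eLpNorm_convolve_sub_le hUm (hr n) hf).trans (by gcongr)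
  have hsub : MemLp (convolve μ U (r n) f - f) 1 (μ.restrict U) :=
    ⟨(hL.continuousOn.aestronglyMeasurable hUm).sub hf.1, hE.trans_lt (by finiteness)⟩
  refine ⟨convolve μ U (r n) f, hL, ?_, hE.trans hn,
    (h.lintegral_pointwiseLip_convolve_le hUm (hr n) hf).trans (by gcongr)⟩
  simpa using hsub.add hf

end Convolution

/-! ### Exchanging the roles of the two variables -/

section Interchange

/-- In a second countable space every open set is a countable union of balls, and preimages of balls
are sublevel sets of the distance functions. -/
theorem measurable_of_measurable_edist {α β : Type*} [MeasurableSpace α] [PseudoEMetricSpace β]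
    [SecondCountableTopology β] [MeasurableSpace β] [BorelSpace β] {g : α → β}
    (h : ∀ b, Measurable fun a => edist (g a) b) : Measurable g := by
  refine measurable_of_isOpen fun s hs => ?_
  choose! ε hε hsub using fun x (hx : x ∈ s) => EMetric.isOpen_iff.1 hs x hx
  obtain ⟨T, hT, hTs⟩ := TopologicalSpace.isOpen_iUnion_countable
    (fun x : s => Metric.eball (x : β) (ε x)) fun _ => Metric.isOpen_eball
  have e : s = ⋃ x ∈ T, Metric.eball ((x : s) : β) (ε x) := by
    rw [hTs]
    refine Subset.antisymm (fun x hx => mem_iUnion.2 ⟨⟨x, hx⟩, Metric.mem_eball_self (hε x hx)⟩) ?_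
    exact iUnion_subset fun x => hsub x x.2
  rw [e]
  simp only [preimage_iUnion]
  exact MeasurableSet.biUnion hT fun x _ => measurableSet_lt (h _) measurable_const

variable {X Y : Type*} [MeasurableSpace X] [MeasurableSpace Y] {m : Measure X} {ν : Measure Y}

/-- The chosen joint representative is only almost everywhere measurable. Replacing it by a
measurable one alters, by Fubini, the slices `g y` only on null sets and for almost every `y`. -/
theorem exists_measurable_jointRep [SFinite m] [SFinite ν] (f : Lp (Lp ℝ 1 ν) 1 m) :
    ∃ H : X × Y → ℝ, Measurable H ∧ IsJointRep m ν f H ∧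
      ∀ᵐ y ∂ν, interchange f y =ᵐ[m] fun x => H (x, y) := by
  have hf : IsJointRep m ν f (jointRep f) := Classical.choose_spec (exists_isJointRep m ν f)
  have hmk := hf.1.aestronglyMeasurable.ae_eq_mk
  refine ⟨hf.1.aestronglyMeasurable.mk _, hf.1.aestronglyMeasurable.stronglyMeasurable_mk.measurable,
    ⟨hf.1.congr hmk, ?_⟩, ?_⟩
  · filter_upwards [hf.2, Measure.ae_ae_of_ae_prod hmk] with x hx hx'
    exact (EventuallyEq.symm hx').trans hx
  · have h1 : ∀ᵐ p ∂ν.prod m, jointRep f p.swap = hf.1.aestronglyMeasurable.mk _ p.swap :=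
      
      (Measure.measurePreserving_swap (μ := ν) (ν := m)).quasiMeasurePreserving.ae hmk
    filter_upwards [Measure.ae_ae_of_ae_prod h1, hf.1.prod_left_ae] with y hy hyi
    rw [interchange, dif_pos hyi]
    exact hyi.coeFn_toL1.trans hy

/-- The distance from `g y` to a fixed `c` is `∫ |H (x, y) - c x|`, measurable in `y` by Tonelli's
theorem. Separability of `L¹` upgrades this to measurability of `g`. -/
theorem aemeasurable_interchange [SFinite m] [SFinite ν] [SecondCountableTopology (Lp ℝ 1 m)]
    (f : Lp (Lp ℝ 1 ν) 1 m) : AEMeasurable (interchange f) ν := by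
  classical
  obtain ⟨H, hH, hHf, hHg⟩ := exists_measurable_jointRep f
  let g : Y → Lp ℝ 1 m := fun y =>
    if h : Integrable (fun x => H (x, y)) m then h.toL1 _ else 0
  have hD : MeasurableSet {y | Integrable (fun x => H (x, y)) m} :=
    measurableSet_integrable (f := fun y x => H (x, y))
      (hH.comp measurable_swap).stronglyMeasurable
  refine ⟨g, measurable_of_measurable_edist fun c => ?_, ?_⟩
  · have e : (fun y => edist (g y) c) = {y | Integrable (fun x => H (x, y)) m}.piecewise
        (fun y => ∫⁻ x, ‖H (x, y) - c x‖ₑ ∂m) fun _ => edist 0 c := by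
      funext y
      by_cases hy : Integrable (fun x => H (x, y)) m
      · rw [piecewise_eq_of_mem _ _ _ (mem_ofPred_eq ▸ hy)]
        simp only [g, dif_pos hy]
        rw [L1.edist_def]
        refine lintegral_congr_ae ?_
        filter_upwards [hy.coeFn_toL1] with x hx
        rw [hx, edist_eq_enorm_sub]
      · rw [piecewise_eq_of_notMem _ _ _ (mem_ofPred_eq ▸ hy)]
        simp only [g, dif_neg hy]
    rw [e]
    refine Measurable.piecewise hD ?_ measurable_const
    have hc : Measurable c := (Lp.stronglyMeasurable c).measurable
    exact Measurable.lintegral_prod_right' (f := fun p : Y × X => ‖H p.swap - c p.2‖ₑ)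
      ((hH.comp measurable_swap).sub (hc.comp measurable_snd)).enorm
  · filter_upwards [hHg, hHf.1.prod_left_ae] with y hy hyi
    simp only [g, dif_pos hyi]
    exact Lp.ext (hy.trans hyi.coeFn_toL1.symm)

theorem lintegral_enorm_interchange_lt_top [SFinite m] [SFinite ν] (f : Lp (Lp ℝ 1 ν) 1 m) :
    ∫⁻ y, ‖interchange f y‖ₑ ∂ν < ∞ := by
  obtain ⟨H, hH, hHf, hHg⟩ := exists_measurable_jointRep f
  have e : ∫⁻ y, ‖interchange f y‖ₑ ∂ν = ∫⁻ y, ∫⁻ x, ‖H (x, y)‖ₑ ∂m ∂ν := by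
    refine lintegral_congr_ae ?_
    filter_upwards [hHg] with y hy
    rw [Lp.enorm_def, eLpNorm_one_eq_lintegral_enorm]
    refine lintegral_congr_ae ?_
    filter_upwards [hy] with x hx
    rw [hx]
  rw [e, ← lintegral_prod_symm _ hH.enorm.aemeasurable]
  exact hHf.1.2

theorem isCutMeasure_cutMeasure [SFinite m] [SFinite ν] [SecondCountableTopology (Lp ℝ 1 m)]
    (f : Lp (Lp ℝ 1 ν) 1 m) : IsCutMeasure (cutMeasure f) := by
  have h1 : Measurable fun E : Cut m => ‖(E : Lp ℝ 1 m)‖ₑ := measurable_subtype_coe.enorm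
  have h2 : Measurable fun u : Lp ℝ 1 m => ‖u‖ₑ := measurable_enorm
  have h3 : Measurable fun p : Lp ℝ 1 m × ℝ => ‖((Slice p : Cut m) : Lp ℝ 1 m)‖ₑ :=
    h1.comp measurable_Slice
  rw [IsCutMeasure, cutMeasure, lintegral_map h1 measurable_Slice, lintegral_prod _ h3.aemeasurable]
  refine (lintegral_mono fun u => lintegral_enorm_Slice_le u).trans_lt ?_
  rw [tautMeasure, lintegral_map' h2.aemeasurable (aemeasurable_interchange f)]
  exact lintegral_enorm_interchange_lt_top f

theorem totalPerimeter_cutMeasure {X Y : Type*} [MetricSpace X] [MeasurableSpace X] [BorelSpace X]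
    [MeasurableSpace Y] {μ : Measure X} [SFinite μ] {ν : Measure Y} [SFinite ν] {U : Set X}
    (hU : IsOpen U) [SecondCountableTopology (Lp ℝ 1 (μ.restrict U))]
    (f : Lp (Lp ℝ 1 ν) 1 (μ.restrict U)) :
    totalPerimeter μ U (cutMeasure f) = ∫⁻ y, VAR μ U (interchange f y) ∂ν := by
  have h1 : Measurable (PER μ U) := measurable_PER
  have h2 : Measurable fun p : Lp ℝ 1 (μ.restrict U) × ℝ => PER μ U (Slice p) :=
    h1.comp measurable_Slice
  rw [totalPerimeter, cutMeasure, lintegral_map h1 measurable_Slice,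
    lintegral_prod _ h2.aemeasurable]
  simp only [lintegral_PER_Slice hU]
  rw [tautMeasure, lintegral_map' lowerSemicontinuous_VAR.measurable.aemeasurable
    (aemeasurable_interchange f)]

/-- The norm of `f z - f x` in `L¹(Y)` is `∫ |H (z, y) - H (x, y)| dν`, so the energy is a triple
integral of a nonnegative function and the `y`-integral may be taken last. This identity has no
analogue for `VAR` itself. -/
theorem nonlocalEnergy_interchange {X Y : Type*} [MeasurableSpace X] [MeasurableSpace Y]
    {μ : Measure X} [SFinite μ] {ν : Measure Y} [SFinite ν] {U : Set X} {κ : X → X → ℝ≥0∞}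
    (hκ : Measurable (Function.uncurry κ)) (f : Lp (Lp ℝ 1 ν) 1 (μ.restrict U)) :
    AEMeasurable (fun y => nonlocalEnergy μ U κ (interchange f y)) ν ∧
      ∫⁻ y, nonlocalEnergy μ U κ (interchange f y) ∂ν = nonlocalEnergy μ U κ f := by
  obtain ⟨H, hH, hHf, hHg⟩ := exists_measurable_jointRep f
  have hF : Measurable fun p : (Y × X) × X =>
      κ p.1.2 p.2 * ‖H (p.2, p.1.1) - H (p.1.2, p.1.1)‖ₑ := by
    have h1 : Measurable fun p : (Y × X) × X => κ p.1.2 p.2 :=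
      hκ.comp (measurable_fst.snd.prodMk measurable_snd)
    exact h1.mul (by fun_prop)
  have hF1 : Measurable fun p : Y × X =>
      ∫⁻ z in U, κ p.2 z * ‖H (z, p.1) - H (p.2, p.1)‖ₑ ∂μ := hF.lintegral_prod_right'
  have hF2 : Measurable fun y : Y =>
      ∫⁻ x in U, ∫⁻ z in U, κ x z * ‖H (z, y) - H (x, y)‖ₑ ∂μ ∂μ := hF1.lintegral_prod_right'
  have hae : (fun y => nonlocalEnergy μ U κ (interchange f y)) =ᵐ[ν]
      fun y => ∫⁻ x in U, ∫⁻ z in U, κ x z * ‖H (z, y) - H (x, y)‖ₑ ∂μ ∂μ := by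
    filter_upwards [hHg] with y hy
    refine lintegral_congr_ae ?_
    filter_upwards [hy] with x hx
    refine lintegral_congr_ae ?_
    filter_upwards [hy] with z hz
    rw [hx, hz]
  refine ⟨⟨_, hF2, hae⟩, ?_⟩
  rw [lintegral_congr_ae hae, lintegral_lintegral_swap hF1.aemeasurable, nonlocalEnergy]
  refine lintegral_congr_ae ?_
  filter_upwards [hHf.2] with x hx
  have hFx : Measurable fun p : Y × X => κ x p.2 * ‖H (p.2, p.1) - H (x, p.1)‖ₑ :=
    hF.comp ((measurable_fst.prodMk measurable_const).prodMk measurable_snd)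
  rw [lintegral_lintegral_swap hFx.aemeasurable]
  refine lintegral_congr_ae ?_
  filter_upwards [hHf.2] with z hz
  rw [lintegral_const_mul _ (by fun_prop), Lp.enorm_def, eLpNorm_one_eq_lintegral_enorm]
  congr 1
  refine lintegral_congr_ae ?_
  filter_upwards [hx, hz, Lp.coeFn_sub (f z) (f x)] with y hxy hzy hs
  rw [hs, Pi.sub_apply, hxy, hzy]

end Interchange

/-- The energies mediate in both directions. If the variations of the `g y` are integrable, the
energies of `f` are bounded uniformly in the scale, and convolution bounds `VAR f`. Conversely `VAR
(g y)` is bounded by the liminf of its energies, Fatou's lemma integrates this over `y`, and the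
energies of `f` are at most a multiple of `VAR f`. -/
theorem PIConstants.VAR_lt_top_iff {X Y : Type*} [MetricSpace X] [MeasurableSpace X] [BorelSpace X]
    [SecondCountableTopology X] [MeasurableSpace Y] {μ : Measure X} [SFinite μ] {ν : Measure Y}
    [SFinite ν] {U : Set X} [SecondCountableTopology (Lp ℝ 1 (μ.restrict U))] {Λ : ℝ} {m : ℕ}
    {β τ : ℝ≥0} (h : PIConstants μ Λ m β τ) (hU : IsOpen U)
    (f : Lp (Lp ℝ 1 ν) 1 (μ.restrict U)) :
    ∫⁻ y, VAR μ U (interchange f y) ∂ν < ∞ ↔ VAR μ U f < ∞ := by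
  choose r hr using fun n : ℕ =>
    exists_isScale hU h.one_le (show (0 : ℝ) < 1 / (n + 1) by positivity)
  have hκ : ∀ n, Measurable (Function.uncurry (scaleKernel μ (r n))) := fun n =>
    measurable_scaleKernel μ ((hr n).continuous h.one_le).measurable
  have hE := fun n => nonlocalEnergy_interchange (hκ n) f
  have hm : AEMeasurable (fun y => VAR μ U (interchange f y)) ν :=
    lowerSemicontinuous_VAR.measurable.comp_aemeasurable (aemeasurable_interchange f)
  set K : ℝ≥0∞ := (8 * β + 64 * β ^ 3 : ℝ≥0) + 1
  set C : ℝ≥0∞ := 4 * (β ^ 2 * τ) * β ^ m + 1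
  have hK : K ≠ ∞ := by finiteness
  have hC : C ≠ ∞ := by finiteness
  constructor
  · intro hlt
    calc VAR μ U f
        ≤ K * liminf (fun n => nonlocalEnergy μ U (scaleKernel μ (r n)) f) atTop :=
          h.VAR_le_liminf_nonlocalEnergy hU hr (Lp.memLp f)
      _ ≤ K * (C * ∫⁻ y, VAR μ U (interchange f y) ∂ν) := by
          refine mul_le_mul' le_rfl (liminf_le_of_frequently_le' (Frequently.of_forall fun n => ?_))
          rw [← (hE n).2, ← lintegral_const_mul'' _ hm]
          exact lintegral_mono fun y =>
            h.nonlocalEnergy_le_VAR hU (hr n) (Lp.aestronglyMeasurable (interchange f y))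
      _ < ∞ := by finiteness
  · intro hlt
    calc ∫⁻ y, VAR μ U (interchange f y) ∂ν
        ≤ ∫⁻ y, K * liminf (fun n =>
            nonlocalEnergy μ U (scaleKernel μ (r n)) (interchange f y)) atTop ∂ν :=
          lintegral_mono fun y => h.VAR_le_liminf_nonlocalEnergy hU hr (Lp.memLp _)
      _ = K * ∫⁻ y, liminf (fun n =>
            nonlocalEnergy μ U (scaleKernel μ (r n)) (interchange f y)) atTop ∂ν :=
          lintegral_const_mul' _ _ hK
      _ ≤ K * liminf (fun n => nonlocalEnergy μ U (scaleKernel μ (r n)) f) atTop := by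
          refine mul_le_mul' le_rfl ((lintegral_liminf_le' fun n => (hE n).1).trans_eq ?_)
          simp only [(hE _).2]
      _ ≤ K * (C * VAR μ U f) :=
          mul_le_mul' le_rfl (liminf_le_of_frequently_le' (Frequently.of_forall fun n =>
            h.nonlocalEnergy_le_VAR hU (hr n) (Lp.aestronglyMeasurable f)))
      _ < ∞ := by finiteness

theorem mainTheorem7 {X : Type*} [MetricSpace X] [MeasurableSpace X] [BorelSpace X]
    {Y : Type*} [MeasurableSpace Y]
    (μ : Measure X) (hμ : IsPISpace μ) (ν : Measure Y) [SigmaFinite ν]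
    (U : Set X) (hU : IsOpen U) (f : Lp (Lp ℝ 1 ν) 1 (μ.restrict U)) :
    (IsFPCutMeasure μ U (cutMeasure f) ↔ IsBV μ U f) ∧
      totalPerimeter μ U (cutMeasure f) = ∫⁻ y, VAR μ U (interchange f y) ∂ν := by
  have := hμ.sigmaFinite
  have := secondCountableTopology_of_ball_pos hμ.ball_pos
  -- Separability of `L¹(U)` follows from second countability of `X` together with the finiteness of
  -- the exponent.
  have : Fact ((1 : ℝ≥0∞) ≠ ∞) := ⟨ENNReal.one_ne_top⟩
  have hsc : SecondCountableTopology (Lp ℝ 1 (μ.restrict U)) := inferInstance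
  obtain ⟨Λ, m, β, τ, h⟩ := hμ.exists_constants
  have hper := totalPerimeter_cutMeasure hU f
  refine ⟨?_, hper⟩
  rw [IsFPCutMeasure, hper, h.VAR_lt_top_iff hU f, isBV_iff_VAR_lt_top]
  exact and_iff_right (isCutMeasure_cutMeasure f)
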